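/- **Setting.** Let $A,B$ be finite sets and let $(X,\mu,T)$ be an invertible measure-preserving system on a probability space. Write $T_A$ for the leftward shift on $A^{\mathbb Z}$. An $A$-valued process is a measurable map $\xi:X\to A^{\mathbb Z}$ with $\xi\circ T=T_A\circ\xi$ $\mu$-a.s.; put $\xi_{[0;n)}=(\xi_0,\dots,\xi_{n-1})$. Let $\xi:X\to A^{\mathbb Z}$ and $\pi:X\to B^{\mathbb Z}$ be processes. **Extremality.** Let $d_n(\mathbf a,\mathbf a')=\frac1n|\{i: a_i\ne a_i'\}|$ on $A^n$, and let $\overline{d_n}$ be the associated transportation metric on $\Pr(A^n)$, $\overline{d_n}(\rho,\rho')=\inf\int d_n\,d\gamma$ over couplings $\gamma$ of $\rho,\rho'$. For $\kappa,r>0$, a probability measure $\rho$ on $A^n$ is $(\kappa,r)$-extremal if for every representation $\rho=\int\rho_\omega\,P(d\omega)$ as a mixture of probability measures over a probability space $(\Omega,P)$, $$\int\overline{d_n}(\rho_\omega,\rho)\,P(d\omega)\le\frac1\kappa\int \mathrm D(\rho_\omega\,\|\,\rho)\,P(d\omega)+r,$$ where $\mathrm D$ is Kullback–Leibler divergence.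 The process $\xi$ is *relatively $(\kappa,r)$-extremal over $\pi$* if for all sufficiently large $n$ there is a function $\mathbf b\mapsto r_{\mathbf b}\in(0,\infty)$ on $B^n$ such that, for a version of the conditional distribution of $\xi_{[0;n)}$ given $\pi_{[0;n)}$, the measure $\mu(\xi_{[0;n)}\in\cdot\mid\pi_{[0;n)}=\mathbf b)$ is $(\kappa n,r_{\mathbf b})$-extremal for every $\mathbf b\in B^n$, and $\sum_{\mathbf b}\mu(\pi_{[0;n)}=\mathbf b)\,r_{\mathbf b}\le r$. **Finite determination.** For a shift-invariant probability measure $\nu$ on $B^{\mathbb Z}$, let $\mathrm{Ext}(\nu,A)$ be the set of shift-invariant probability measures on $B^{\mathbb Z}\times A^{\mathbb Z}$ with marginal $\nu$ on $B^{\mathbb Z}$, and let $\beta$ be the projection to $B^{\mathbb Z}$. For $\lambda,\theta\in\mathrm{Ext}(\nu,A)$ let $$\overline\delta(\lambda,\theta\mid\beta)=\inf_\gamma\gamma\{(b,a,a'):a_0\ne a_0'\},$$ the infimum over shift-invariant probability measures $\gamma$ on $B^{\mathbb Z}\times A^{\mathbb Z}\times A^{\mathbb Z}$ under which $(b,a)$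 has law $\lambda$ and $(b,a')$ has law $\theta$. Let $\lambda_{[0;n)}$ be the law of $(b_{[0;n)},a_{[0;n)})$ under $\lambda$, let $\|\cdot\|$ be the total variation norm (the sum of the absolute values of the point masses), and let $\mathrm h(\lambda\mid\beta)$ be the relative Kolmogorov–Sinai entropy: the supremum, over all finite-alphabet processes $\eta$ on the system $(B^{\mathbb Z}\times A^{\mathbb Z},\lambda,T_B\times T_A)$, of $\lim_n\frac1n\mathrm H_\lambda(\eta_{[0;n)}\mid\beta)$. For $\delta>0$, the process $\xi$ is *relatively $\delta$-finitely determined over $\pi$* if, for $\nu=\pi_*\mu$ and $\lambda=(\pi,\xi)_*\mu\in\mathrm{Ext}(\nu,A)$, there are $\varepsilon>0$ and $n\in\mathbb N$ such that every $\theta\in\mathrm{Ext}(\nu,A)$ with $\mathrm h(\theta\mid\beta)>\mathrm h(\lambda\mid\beta)-\varepsilon$ and $\|\theta_{[0;n)}-\lambda_{[0;n)}\|<\varepsilon$ satisfies $\overline\delta(\lambda,\theta\mid\beta)<\delta$. **Proposition.** Let $r>0$. If $\xi$ is relatively $(\kappa,r)$-extremal over $\pi$ for some $\kappa>0$, then $\xi$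 is relatively $(7r)$-finitely determined over $\pi$. -/

import Mathlib

open MeasureTheory ProbabilityTheory Filter
open scoped ENNReal

namespace RelOrnstein

universe u

noncomputable section

/-! ### Transportation distance and extremality on a metric probability space -/

/-- The set of couplings of two measures on `K`. -/
def Couplings {K : Type*} [MeasurableSpace K] (μ ν : Measure K) : Set (Measure (K × K)) :=
  {γ | γ.map Prod.fst = μ ∧ γ.map Prod.snd = ν}

/-- The transportation distance between `μ` and `ν` for the metric `d`. -/
def transportDist {K : Type*} [MeasurableSpace K] (d : K → K → ℝ) (μ ν : Measure K) : ℝ≥0∞ :=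
  ⨅ γ ∈ Couplings μ ν, ∫⁻ p, ENNReal.ofReal (d p.1 p.2) ∂γ

/-- The metric probability space `(K, d, μ)` is `(κ, r)`-extremal: for every representation of `μ`
as a mixture `∫ η_ω P(dω)` of probability measures, the mean transportation distance from `η_ω`
to `μ` is at most `κ⁻¹` times the mean KL divergence of `η_ω` from `μ`, plus `r`.
(Pushing `P` forward to the space of measures on `K` shows that the universe of the index space
`Ω` is immaterial.) -/
def IsExtremal {K : Type u} [MeasurableSpace K] (d : K → K → ℝ) (μ : Measure K) (κ r : ℝ) : Prop :=
  ∀ (Ω : Type u) [MeasurableSpace Ω] (P : Measure Ω) [IsProbabilityMeasure P]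
    (η : Kernel Ω K) [IsMarkovKernel η], P.bind η = μ →
    ∫⁻ ω, transportDist d (η ω) μ ∂P
      ≤ (∫⁻ ω, InformationTheory.klDiv (η ω) μ ∂P) / ENNReal.ofReal κ + ENNReal.ofReal r

/-- A probability measure `ν` on `Y` together with a kernel `η` from `Y` to `(K, d)` is
`(κ, r)`-extremal. -/
def IsExtremalPair {Y K : Type*} [MeasurableSpace Y] [MeasurableSpace K] (d : K → K → ℝ)
    (ν : Measure Y) (η : Kernel Y K) (κ r : ℝ) : Prop :=
  ∃ ρ : Y → ℝ, Measurable ρ ∧ (∀ y, 0 < ρ y) ∧ (∀ y, IsExtremal d (η y) κ (ρ y)) ∧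
    ∫⁻ y, ENNReal.ofReal (ρ y) ∂ν ≤ ENNReal.ofReal r

/-- The random variable `F` with values in `(K, d)` is `(κ, r)`-extremal over the random variable
`G`: the law of `G` and a conditional distribution of `F` given `G` form an extremal pair. -/
def IsExtremalOver {X Y K : Type*} [MeasurableSpace X] [MeasurableSpace Y] [MeasurableSpace K]
    (d : K → K → ℝ) (μ : Measure X) (F : X → K) (G : X → Y) (κ r : ℝ) : Prop :=
  ∃ η : Kernel Y K, IsMarkovKernel η ∧
    (μ.map G).compProd η = μ.map (fun x => (G x, F x)) ∧
    IsExtremalPair d (μ.map G) η κ r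

/-- The normalized Hamming metric on `A ^ n`. -/
def hammingMetric {A : Type*} [DecidableEq A] (n : ℕ) (a a' : Fin n → A) : ℝ :=
  (hammingDist a a' : ℝ) / n

/-! ### Processes -/

/-- The leftward shift on `A ^ ℤ`. -/
def shift {A : Type*} (a : ℤ → A) : ℤ → A := fun n => a (n + 1)

/-- The block `a_{[0;n)}` of a bi-infinite sequence. -/
def block {A : Type*} (n : ℕ) (a : ℤ → A) : Fin n → A := fun i => a (i : ℤ)

/-- `ξ` is an `A`-valued process on `(X, μ, T)`: a factor map to `A ^ ℤ` with the shift. -/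
def IsProcess {X A : Type*} [MeasurableSpace X] [MeasurableSpace A] (μ : Measure X) (T : X → X)
    (ξ : X → ℤ → A) : Prop :=
  Measurable ξ ∧ ∀ᵐ x ∂μ, ξ (T x) = shift (ξ x)

/-- The process `ξ` is relatively `(κ, r)`-extremal over the process `π`. -/
def IsRelExtremal {X A B : Type*} [MeasurableSpace X] [MeasurableSpace A] [MeasurableSpace B]
    [DecidableEq A] (μ : Measure X) (ξ : X → ℤ → A) (π : X → ℤ → B) (κ r : ℝ) : Prop :=
  ∀ᶠ n : ℕ in atTop,
    IsExtremalOver (hammingMetric n) μ (fun x => block n (ξ x)) (fun x => block n (π x)) (κ * n) r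

/-! ### Relative Kolmogorov–Sinai entropy -/

/-- The conditional Shannon entropy `H_μ(F | π)` of a finite-valued random variable `F` given the
`σ`-algebra generated by `π`. -/
def condEntropy {X Y C : Type*} [MeasurableSpace X] [MeasurableSpace Y] [Fintype C]
    (μ : Measure X) (F : X → C) (π : X → Y) : ℝ :=
  ∫ x, ∑ c, Real.negMulLog
    ((μ⟦F ⁻¹' {c} | MeasurableSpace.comap π inferInstance⟧) x) ∂μ

/-- The relative Kolmogorov–Sinai entropy `h(ξ, μ, T | π)` of a process over a factor map: the
limit of `H(ξ_{[0;n)} | π) / n`. (It exists by subadditivity when `ξ` is a process and `π` is a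
factor map of an invertible measure-preserving system.) -/
def processEntropy {X Y C : Type*} [MeasurableSpace X] [MeasurableSpace Y] [Fintype C]
    (μ : Measure X) (ξ : X → ℤ → C) (π : X → Y) : ℝ :=
  limUnder atTop (fun n : ℕ => condEntropy μ (fun x => block n (ξ x)) π / n)

/-- The relative Kolmogorov–Sinai entropy `h(μ, T | π)` of a system over a factor map: the
supremum of `h(ξ, μ, T | π)` over all finite-alphabet processes `ξ` on the system. -/
def systemEntropy {X Y : Type*} [MeasurableSpace X] [MeasurableSpace Y]
    (μ : Measure X) (T : X → X) (π : X → Y) : EReal :=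
  ⨆ (k : ℕ) (ξ : X → ℤ → Fin k) (_ : IsProcess μ T ξ), ((processEntropy μ ξ π : ℝ) : EReal)

/-! ### Relative finite determination -/

/-- The shift on `B ^ ℤ × A ^ ℤ`. -/
def shift₂ {A B : Type*} : (ℤ → B) × (ℤ → A) → (ℤ → B) × (ℤ → A) := Prod.map shift shift

/-- The shift on `B ^ ℤ × A ^ ℤ × A ^ ℤ`. -/
def shift₃ {A B : Type*} : (ℤ → B) × (ℤ → A) × (ℤ → A) → (ℤ → B) × (ℤ → A) × (ℤ → A) :=
  Prod.map shift (Prod.map shift shift)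

/-- `Ext(ν, A)`: shift-invariant probability measures on `B ^ ℤ × A ^ ℤ` with marginal `ν` on
`B ^ ℤ`. -/
def Ext {B : Type*} [MeasurableSpace B] (ν : Measure (ℤ → B)) (A : Type*) [MeasurableSpace A] :
    Set (Measure ((ℤ → B) × (ℤ → A))) :=
  {l | IsProbabilityMeasure l ∧ MeasurePreserving shift₂ l l ∧ l.map Prod.fst = ν}

/-- Relative joinings of `l` and `θ` over the common `B ^ ℤ` coordinate. -/
def Join {A B : Type*} [MeasurableSpace A] [MeasurableSpace B]
    (l θ : Measure ((ℤ → B) × (ℤ → A))) : Set (Measure ((ℤ → B) × (ℤ → A) × (ℤ → A))) :=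
  {γ | IsProbabilityMeasure γ ∧ MeasurePreserving shift₃ γ γ ∧
    γ.map (fun p => (p.1, p.2.1)) = l ∧ γ.map (fun p => (p.1, p.2.2)) = θ}

/-- The relative `d`-bar distance between `l` and `θ` over the `B ^ ℤ` coordinate. -/
def relDbar {A B : Type*} [MeasurableSpace A] [MeasurableSpace B]
    (l θ : Measure ((ℤ → B) × (ℤ → A))) : ℝ≥0∞ :=
  ⨅ γ ∈ Join l θ, γ {p | p.2.1 0 ≠ p.2.2 0}

/-- The finite-dimensional distribution `l_{[0;n)}` on `B ^ n × A ^ n`. -/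
def blockLaw {A B : Type*} [MeasurableSpace A] [MeasurableSpace B] (n : ℕ)
    (l : Measure ((ℤ → B) × (ℤ → A))) : Measure ((Fin n → B) × (Fin n → A)) :=
  l.map (Prod.map (block n) (block n))

/-- The total variation norm `‖μ - ν‖` of a difference of finite measures on a finite set. -/
def tvNorm {S : Type*} [Fintype S] [MeasurableSpace S] (μ ν : Measure S) : ℝ :=
  ∑ s, |μ.real {s} - ν.real {s}|

/-- The shift-invariant measure `l ∈ Ext(ν, A)` is relatively `δ`-finitely determined over the
canonical `B`-valued process. -/
def IsRelFDMeasure {A B : Type*} [Fintype A] [Fintype B] [MeasurableSpace A] [MeasurableSpace B]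
    (ν : Measure (ℤ → B)) (l : Measure ((ℤ → B) × (ℤ → A))) (δ : ℝ) : Prop :=
  l ∈ Ext ν A ∧ ∃ ε : ℝ, 0 < ε ∧ ∃ n : ℕ, ∀ θ ∈ Ext ν A,
    systemEntropy l shift₂ (Prod.fst : (ℤ → B) × (ℤ → A) → (ℤ → B)) - (ε : EReal)
      < systemEntropy θ shift₂ (Prod.fst : (ℤ → B) × (ℤ → A) → (ℤ → B)) →
    tvNorm (blockLaw n θ) (blockLaw n l) < ε →
    relDbar l θ < ENNReal.ofReal δ

/-- The process `ξ` is relatively `δ`-finitely determined over the process `π`. -/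
def IsRelFD {X A B : Type*} [MeasurableSpace X] [Fintype A] [Fintype B] [MeasurableSpace A]
    [MeasurableSpace B] (μ : Measure X) (ξ : X → ℤ → A) (π : X → ℤ → B) (δ : ℝ) : Prop :=
  IsRelFDMeasure (μ.map π) (μ.map (fun x => (π x, ξ x))) δ

end

end RelOrnstein

namespace RelOrnstein

universe u

set_option linter.unusedSectionVars false

noncomputable section

/-! ### Finite-valued random variables and Shannon entropy -/

section FiniteEntropy

variable {Ω S T U : Type*} [MeasurableSpace Ω]

/-! Write `l` for the joint law of `(π, ξ)`. The proof couples `l` with a nearby `θ` block by block,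
all blocks having one fixed length `n`, and uses extremality to keep the average cost of every new
block small.

Choose `n` so that extremality holds and the conditional entropy of an `n`-block of `a` given the
simultaneous block of `b` is at most `n (L + s)`, where `L` is the entropy rate of the
`A`-coordinate relative to the whole factor (`exists_le_systemEntropy`). In the other direction,
`systemEntropy_le` shows that the entropy of the next block, given all earlier blocks and any
stretch `b_{[0;N)}`, is never below `n` times the entropy of the system. For `l` the two bounds
differ by at most `n s`. For a `θ` close to `l` in entropy and in `n`-block law they differ by at
most `3 n s`, because the conditional block entropy is continuous in the block law
(`exists_blockCondEntropy_le`). This difference is the conditional mutual information between the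
next block and (past, more of `b`) given the simultaneous `b`-word. It is also the mean divergence
of the finer conditional laws of the block from the coarser one (`sum_mul_log_eq`).

The finer laws form a mixture of the coarser one, so extremality turns small mean divergence into
small mean transportation distance (`transports_of_finExtremal`, `transports_nextMass`). For `θ` the
coarse law is not the extremal measure `η y` but is close to it in total variation; a preliminary
maximal coupling corrects this, and by the log-sum inequality it does not increase the divergence.

Under both `l` and `θ`, then, the next block given the past and `b` is on average close to one and
the same measure, which depends on `b` only. Coupling through that measure extends any coupling of
the pasts by one more block, at a bounded additional cost (`exists_chain_coupling`). The resulting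
couplings of `K` blocks are padded to bi-infinite sequences and averaged over shifts, and a weak
limit as `K` grows is a joining over `b` with the same bound (`relDbar_le_of_block_couplings`,
`relDbar_le_of_averages`).

The entropy estimates are carried out for abstract stationary submodular set functions; martingale
convergence links them to the conditional entropies in the definitions. -/

/-- The mass function of a random variable. -/
def mass (μ : Measure Ω) (X : Ω → S) (s : S) : ℝ := μ.real (X ⁻¹' {s})

lemma mass_nonneg (μ : Measure Ω) (X : Ω → S) (s : S) : 0 ≤ mass μ X s := measureReal_nonneg

lemma mass_le_one (μ : Measure Ω) [IsProbabilityMeasure μ] (X : Ω → S) (s : S) :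
    mass μ X s ≤ 1 := measureReal_le_one

lemma mass_congr {μ : Measure Ω} {X Y : Ω → S} (h : X =ᵐ[μ] Y) : mass μ X = mass μ Y := by
  ext s
  refine measureReal_congr ?_
  filter_upwards [h] with ω hω
  change (X ω = s) = (Y ω = s)
  rw [hω]

variable [Fintype S] [Fintype T] [Fintype U]
  [MeasurableSpace S] [MeasurableSpace T] [MeasurableSpace U]
  [MeasurableSingletonClass S] [MeasurableSingletonClass T] [MeasurableSingletonClass U]

open Classical in
lemma measureReal_preimage_eq_sum (μ : Measure Ω) [IsFiniteMeasure μ] {X : Ω → S}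
    (hX : Measurable X) (D : Set S) :
    μ.real (X ⁻¹' D) = ∑ s, if s ∈ D then mass μ X s else 0 := by
  rw [← Finset.sum_filter]
  unfold mass
  rw [← measureReal_biUnion_finset]
  · congr 1
    ext ω
    simp
  · intro s _ t _ hst
    exact Disjoint.preimage _ (by simpa using hst)
  · intro s _
    exact hX (measurableSet_singleton s)

omit [Fintype T] [MeasurableSpace T] [MeasurableSingletonClass T] in
open Classical in
lemma mass_comp (μ : Measure Ω) [IsFiniteMeasure μ] {X : Ω → S} (hX : Measurable X)
    (f : S → T) (t : T) :
    mass μ (fun ω => f (X ω)) t = ∑ s, if f s = t then mass μ X s else 0 :=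
  measureReal_preimage_eq_sum μ hX (f ⁻¹' {t})

lemma sum_mass (μ : Measure Ω) [IsProbabilityMeasure μ] {X : Ω → S} (hX : Measurable X) :
    ∑ s, mass μ X s = 1 := by
  have := measureReal_preimage_eq_sum μ hX Set.univ
  simpa using this.symm

lemma sum_mass_right (μ : Measure Ω) [IsFiniteMeasure μ] {X : Ω → S} {Y : Ω → T}
    (hX : Measurable X) (hY : Measurable Y) (s : S) :
    ∑ t, mass μ (fun ω => (X ω, Y ω)) (s, t) = mass μ X s := by
  classical
  rw [mass_comp μ (hX.prodMk hY) Prod.fst s, Fintype.sum_prod_type,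
    Finset.sum_eq_single s] <;> simp +contextual

lemma sum_mass_left (μ : Measure Ω) [IsFiniteMeasure μ] {X : Ω → S} {Y : Ω → T}
    (hX : Measurable X) (hY : Measurable Y) (t : T) :
    ∑ s, mass μ (fun ω => (X ω, Y ω)) (s, t) = mass μ Y t := by
  classical
  rw [mass_comp μ (hX.prodMk hY) Prod.snd t, Fintype.sum_prod_type_right,
    Finset.sum_eq_single t] <;> simp +contextual

/-- The Shannon entropy of a finite-valued random variable. -/
def entropy (μ : Measure Ω) (X : Ω → S) : ℝ := ∑ s, Real.negMulLog (mass μ X s)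

omit [MeasurableSpace S] [MeasurableSingletonClass S] in
lemma entropy_congr {μ : Measure Ω} {X Y : Ω → S} (h : X =ᵐ[μ] Y) :
    entropy μ X = entropy μ Y := by
  rw [entropy, entropy, mass_congr h]

omit [MeasurableSpace S] [MeasurableSingletonClass S] in
lemma entropy_nonneg (μ : Measure Ω) [IsProbabilityMeasure μ] (X : Ω → S) : 0 ≤ entropy μ X :=
  Finset.sum_nonneg fun s _ => Real.negMulLog_nonneg (mass_nonneg μ X s) (mass_le_one μ X s)

lemma entropy_comp_le (μ : Measure Ω) [IsProbabilityMeasure μ] {X : Ω → S} (hX : Measurable X)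
    (f : S → T) : entropy μ (fun ω => f (X ω)) ≤ entropy μ X := by
  classical
  have h1 : ∀ t, Real.negMulLog (mass μ (fun ω => f (X ω)) t)
      = ∑ s, if f s = t then -(mass μ X s * Real.log (mass μ (fun ω => f (X ω)) (f s))) else 0 := by
    intro t
    rw [Real.negMulLog_eq_neg]
    dsimp only
    nth_rewrite 1 [mass_comp μ hX f t]
    rw [Finset.sum_mul, ← Finset.sum_neg_distrib]
    refine Finset.sum_congr rfl fun s _ => ?_
    split_ifs with h
    · rw [h]
    · simp
  unfold entropy
  simp_rw [h1]
  rw [Finset.sum_comm]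
  refine Finset.sum_le_sum fun s _ => ?_
  rw [Finset.sum_ite_eq, if_pos (Finset.mem_univ _), Real.negMulLog_eq_neg, neg_le_neg_iff]
  rcases (mass_nonneg μ X s).eq_or_lt with h0 | h0
  · simp [← h0]
  refine mul_le_mul_of_nonneg_left (Real.log_le_log h0 ?_) h0.le
  exact measureReal_mono (fun ω (hω : X ω = s) => by simp [hω])

lemma entropy_eq_of_comp (μ : Measure Ω) [IsProbabilityMeasure μ] {X : Ω → S} {Y : Ω → T}
    (hX : Measurable X) (hY : Measurable Y) (f : S → T) (g : T → S)
    (hf : ∀ ω, f (X ω) = Y ω) (hg : ∀ ω, g (Y ω) = X ω) : entropy μ X = entropy μ Y := by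
  have e1 : Y = fun ω => f (X ω) := funext fun ω => (hf ω).symm
  have e2 : X = fun ω => g (Y ω) := funext fun ω => (hg ω).symm
  refine le_antisymm ?_ ?_
  · nth_rewrite 1 [e2]; exact entropy_comp_le μ hY g
  · nth_rewrite 1 [e1]; exact entropy_comp_le μ hX f

/-- This is `log x ≤ x - 1` at `x = a b / (c p)`, multiplied by `p`. The order hypotheses handle
degenerate cases: `p > 0` forces `a, b, c > 0`, and for `p = 0` the quotient is nonnegative. -/
lemma mul_log_sub_ge {p a b c : ℝ} (hp : 0 ≤ p) (ha : p ≤ a) (hb : p ≤ b) (hac : a ≤ c) :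
    p - a * b / c ≤ p * (Real.log p + Real.log c - Real.log a - Real.log b) := by
  rcases hp.eq_or_lt with h0 | h0
  · subst h0
    simp only [zero_mul, zero_sub, neg_nonpos]
    exact div_nonneg (mul_nonneg ha hb) (ha.trans hac)
  have ha0 := h0.trans_le ha
  have hb0 := h0.trans_le hb
  have hc0 := ha0.trans_le hac
  have h := Real.log_le_sub_one_of_pos (x := a * b / (c * p)) (by positivity)
  rw [Real.log_div (by positivity) (by positivity), Real.log_mul ha0.ne' hb0.ne',
    Real.log_mul hc0.ne' h0.ne'] at h
  have h2 := mul_le_mul_of_nonneg_left h hp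
  have e : p * (a * b / (c * p) - 1) = a * b / c - p := by field_simp
  rw [e] at h2
  linarith

/-- Conditional mutual information is nonnegative. -/
lemma entropy_submodular (μ : Measure Ω) [IsProbabilityMeasure μ]
    {X : Ω → S} {Y : Ω → T} {Z : Ω → U}
    (hX : Measurable X) (hY : Measurable Y) (hZ : Measurable Z) :
    entropy μ (fun ω => (X ω, Y ω, Z ω)) + entropy μ Z
      ≤ entropy μ (fun ω => (X ω, Z ω)) + entropy μ (fun ω => (Y ω, Z ω)) := by
  set P : S → T → U → ℝ := fun x y z => mass μ (fun ω => (X ω, Y ω, Z ω)) (x, y, z) with hP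
  have hYZ : ∀ y z, ∑ x, P x y z = mass μ (fun ω => (Y ω, Z ω)) (y, z) := fun y z =>
    sum_mass_left μ hX (hY.prodMk hZ) (y, z)
  have hXZ : ∀ x z, ∑ y, P x y z = mass μ (fun ω => (X ω, Z ω)) (x, z) := by
    intro x z
    have := sum_mass_left μ hY (hX.prodMk hZ) (x, z)
    rw [← this]
    refine Finset.sum_congr rfl fun y _ => ?_
    refine congrArg μ.real ?_
    ext ω
    simp only [Set.mem_preimage, Set.mem_singleton_iff, Prod.mk.injEq]
    tauto
  have hZ1 : ∀ z, ∑ x, mass μ (fun ω => (X ω, Z ω)) (x, z) = mass μ Z z :=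
    sum_mass_left μ hX hZ
  have hZ2 : ∀ z, ∑ y, mass μ (fun ω => (Y ω, Z ω)) (y, z) = mass μ Z z :=
    sum_mass_left μ hY hZ
  set a : S → U → ℝ := fun x z => mass μ (fun ω => (X ω, Z ω)) (x, z) with ha
  set b : T → U → ℝ := fun y z => mass μ (fun ω => (Y ω, Z ω)) (y, z) with hb
  set c : U → ℝ := fun z => mass μ Z z with hc
  have E0 : entropy μ (fun ω => (X ω, Y ω, Z ω))
      = ∑ x, ∑ y, ∑ z, -(P x y z * Real.log (P x y z)) := by
    simp only [entropy, Fintype.sum_prod_type, Real.negMulLog_eq_neg, hP]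
  have E1 : entropy μ Z = ∑ x, ∑ y, ∑ z, -(P x y z * Real.log (c z)) := by
    simp only [entropy, Real.negMulLog_eq_neg, Finset.sum_neg_distrib]
    congr 1
    refine Eq.trans ?_ (Finset.sum_congr rfl fun x _ => Finset.sum_comm)
    rw [Finset.sum_comm]
    refine Finset.sum_congr rfl fun z _ => ?_
    rw [hc, ← hZ1 z, Finset.sum_mul]
    refine Finset.sum_congr rfl fun x _ => ?_
    rw [← Finset.sum_mul, hXZ, hZ1 z]
  have E2 : entropy μ (fun ω => (X ω, Z ω)) = ∑ x, ∑ y, ∑ z, -(P x y z * Real.log (a x z)) := by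
    simp only [entropy, Real.negMulLog_eq_neg, Finset.sum_neg_distrib, Fintype.sum_prod_type]
    congr 1
    refine Finset.sum_congr rfl fun x _ => ?_
    rw [Finset.sum_comm]
    refine Finset.sum_congr rfl fun z _ => ?_
    rw [← Finset.sum_mul, hXZ]
  have E3 : entropy μ (fun ω => (Y ω, Z ω)) = ∑ x, ∑ y, ∑ z, -(P x y z * Real.log (b y z)) := by
    simp only [entropy, Real.negMulLog_eq_neg, Finset.sum_neg_distrib, Fintype.sum_prod_type]
    congr 1
    symm
    rw [Finset.sum_comm]
    refine Finset.sum_congr rfl fun y _ => ?_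
    rw [Finset.sum_comm]
    refine Finset.sum_congr rfl fun z _ => ?_
    rw [← Finset.sum_mul, hYZ]
  have hPn : ∀ x y z, 0 ≤ P x y z := fun x y z => mass_nonneg _ _ _
  have key : ∀ x y z, P x y z - a x z * b y z / c z
      ≤ P x y z * (Real.log (P x y z) + Real.log (c z) - Real.log (a x z) - Real.log (b y z)) := by
    intro x y z
    refine mul_log_sub_ge (hPn x y z) ?_ ?_ ?_
    · rw [ha]; dsimp only; rw [← hXZ]
      exact Finset.single_le_sum (f := fun y => P x y z) (fun y _ => hPn x y z) (Finset.mem_univ y)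
    · rw [hb]; dsimp only; rw [← hYZ]
      exact Finset.single_le_sum (f := fun x => P x y z) (fun x _ => hPn x y z) (Finset.mem_univ x)
    · rw [hc]; dsimp only; rw [← hZ1]
      exact Finset.single_le_sum (f := fun x => a x z) (fun x _ => mass_nonneg _ _ _)
        (Finset.mem_univ x)
  -- The reference masses `a b / c` are those of the coupling that makes `X` and `Y` conditionally
  -- independent given `Z`, so they also sum to 1. Where `c` vanishes so does `a`, and the division
  -- by zero is harmless.
  have hsum : ∑ x, ∑ y, ∑ z, (P x y z - a x z * b y z / c z) = 0 := by
    have h1 : ∑ x, ∑ y, ∑ z, P x y z = 1 := by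
      have := sum_mass μ (hX.prodMk (hY.prodMk hZ))
      simpa only [Fintype.sum_prod_type] using this
    have h2 : ∑ x, ∑ y, ∑ z, a x z * b y z / c z = 1 := by
      have : ∀ x, ∑ y, ∑ z, a x z * b y z / c z = ∑ z, a x z := by
        intro x
        rw [Finset.sum_comm]
        refine Finset.sum_congr rfl fun z _ => ?_
        rw [← Finset.sum_div, ← Finset.mul_sum, hZ2 z]
        by_cases h0 : mass μ Z z = 0
        · have : a x z = 0 := by
            have h3 := hZ1 z
            rw [h0, Finset.sum_eq_zero_iff_of_nonneg (fun _ _ => mass_nonneg _ _ _)] at h3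
            exact h3 x (Finset.mem_univ x)
          simp [this]
        · rw [hc]; field_simp
      simp_rw [this]
      have := sum_mass μ (hX.prodMk hZ)
      simpa only [Fintype.sum_prod_type] using this
    simp only [Finset.sum_sub_distrib, h1, h2, sub_self]
  have hfin : ∑ x, ∑ y, ∑ z, (P x y z - a x z * b y z / c z) ≤ ∑ x, ∑ y, ∑ z,
      P x y z * (Real.log (P x y z) + Real.log (c z) - Real.log (a x z) - Real.log (b y z)) :=
    Finset.sum_le_sum fun x _ => Finset.sum_le_sum fun y _ => Finset.sum_le_sum fun z _ => key x y z
  rw [hsum] at hfin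
  rw [E0, E1, E2, E3, ← sub_nonneg]
  refine hfin.trans_eq ?_
  simp only [← Finset.sum_add_distrib, ← Finset.sum_sub_distrib]
  refine Finset.sum_congr rfl fun x _ => Finset.sum_congr rfl fun y _ =>
    Finset.sum_congr rfl fun z _ => ?_
  ring

lemma entropy_le_log_card (μ : Measure Ω) [IsProbabilityMeasure μ] [Nonempty S] {X : Ω → S}
    (hX : Measurable X) : entropy μ X ≤ Real.log (Fintype.card S) := by
  have hc : (0 : ℝ) < Fintype.card S := by exact_mod_cast Fintype.card_pos
  have h : ∀ s, Real.negMulLog (mass μ X s) ≤ (Fintype.card S : ℝ)⁻¹ - mass μ X s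
      + mass μ X s * Real.log (Fintype.card S) := by
    intro s
    rcases (mass_nonneg μ X s).eq_or_lt with h0 | h0
    · rw [← h0]; simp
    have := Real.log_le_sub_one_of_pos (x := ((Fintype.card S : ℝ) * mass μ X s)⁻¹) (by positivity)
    rw [Real.log_inv, Real.log_mul hc.ne' h0.ne'] at this
    have h2 := mul_le_mul_of_nonneg_left this h0.le
    have e : mass μ X s * (((Fintype.card S : ℝ) * mass μ X s)⁻¹ - 1)
        = (Fintype.card S : ℝ)⁻¹ - mass μ X s := by field_simp
    rw [e] at h2
    rw [Real.negMulLog_eq_neg]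
    linarith
  refine (Finset.sum_le_sum fun s _ => h s).trans_eq ?_
  rw [Finset.sum_add_distrib, Finset.sum_sub_distrib, ← Finset.sum_mul, sum_mass μ hX]
  simp [Finset.card_univ, hc.ne']

end FiniteEntropy

/-! ### Joint entropy of finite subfamilies -/

section JointEntropy

variable {Ω ι C : Type*} [MeasurableSpace Ω] [DecidableEq ι]
  [Fintype C] [MeasurableSpace C] [MeasurableSingletonClass C]

omit [Fintype C] [MeasurableSingletonClass C] [DecidableEq ι] in
lemma measurable_subfamily {x : ι → Ω → C} (hx : ∀ i, Measurable (x i)) (I : Finset ι) :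
    Measurable (fun ω (i : I) => x i ω) :=
  measurable_pi_lambda _ fun i => hx i

/-- The joint entropy of the variables `x i`, `i ∈ I`. -/
def jointEntropy (μ : Measure Ω) (x : ι → Ω → C) (I : Finset ι) : ℝ :=
  entropy μ (fun ω (i : I) => x i ω)

variable (μ : Measure Ω) [IsProbabilityMeasure μ] {x : ι → Ω → C}

lemma jointEntropy_mono (hx : ∀ i, Measurable (x i)) {I J : Finset ι} (h : I ⊆ J) :
    jointEntropy μ x I ≤ jointEntropy μ x J :=
  entropy_comp_le μ (measurable_subfamily hx J) (fun v (i : I) => v ⟨i, h i.2⟩)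

/-- Conditional mutual information of the subfamilies `I` and `J` given `K` is nonnegative. Since `K
⊆ J`, adjoining the variables of `K` to those of `J` changes no entropy, and overlaps of the index
sets are equally harmless. -/
lemma jointEntropy_submodular (hx : ∀ i, Measurable (x i)) (I : Finset ι) {J K : Finset ι}
    (h : K ⊆ J) :
    jointEntropy μ x (I ∪ J) - jointEntropy μ x J ≤ jointEntropy μ x (I ∪ K) - jointEntropy μ x K := by
  have hI := measurable_subfamily hx I
  have hJ := measurable_subfamily hx J
  have hK := measurable_subfamily hx K
  have h0 := entropy_submodular μ hI hJ hK
  have h1 : jointEntropy μ x (I ∪ J) ≤ _ :=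
    (entropy_comp_le μ (hI.prodMk (hJ.prodMk hK)) (fun v (i : (I ∪ J : Finset ι)) =>
      if hi : (i : ι) ∈ I then v.1 ⟨i, hi⟩
      else v.2.1 ⟨i, (Finset.mem_union.1 i.2).resolve_left hi⟩)).trans' (le_of_eq (by
        unfold jointEntropy; congr; ext ω i; simp))
  have h2 : _ ≤ jointEntropy μ x (I ∪ K) :=
    entropy_comp_le μ (measurable_subfamily hx (I ∪ K))
      (fun v => ((fun i : I => v ⟨i, Finset.mem_union_left _ i.2⟩),
        (fun i : K => v ⟨i, Finset.mem_union_right _ i.2⟩)))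
  have h3 : _ ≤ jointEntropy μ x J :=
    entropy_comp_le μ hJ (fun v => (v, (fun i : K => v ⟨i, h i.2⟩)))
  unfold jointEntropy at *
  linarith

lemma jointEntropy_le_card [Nonempty C] (hx : ∀ i, Measurable (x i)) (I : Finset ι) :
    jointEntropy μ x I ≤ I.card * Real.log (Fintype.card C) := by
  refine (entropy_le_log_card μ (measurable_subfamily hx I)).trans_eq ?_
  simp

omit [MeasurableSpace C] [MeasurableSingletonClass C] in
lemma jointEntropy_nonneg (I : Finset ι) : 0 ≤ jointEntropy μ x I := entropy_nonneg μ _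

end JointEntropy

/-! ### Conditional entropy as a limit of finite entropies -/

section CondEntropy

variable {Ω S T Y : Type*} [mΩ : MeasurableSpace Ω]
  [Fintype S] [MeasurableSpace S] [MeasurableSingletonClass S]
  [Fintype T] [MeasurableSpace T] [MeasurableSingletonClass T] [MeasurableSpace Y]

lemma integral_comp_eq_sum (μ : Measure Ω) [IsProbabilityMeasure μ] {X : Ω → T}
    (hX : Measurable X) (f : T → ℝ) : ∫ ω, f (X ω) ∂μ = ∑ t, mass μ X t * f t := by
  rw [← integral_map (φ := X) (f := f) hX.aemeasurable
    (measurable_of_countable f).aestronglyMeasurable, integral_fintype Integrable.of_finite]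
  refine Finset.sum_congr rfl fun t _ => ?_
  rw [smul_eq_mul, map_measureReal_apply hX (measurableSet_singleton t), mass]

lemma condExp_comap_finite (μ : Measure Ω) [IsProbabilityMeasure μ] {F : Ω → S} {X : Ω → T}
    (hF : Measurable F) (hX : Measurable X) (c : S) :
    (fun ω => mass μ (fun ω => (F ω, X ω)) (c, X ω) / mass μ X (X ω))
      =ᵐ[μ] μ⟦F ⁻¹' {c} | MeasurableSpace.comap X inferInstance⟧ := by
  classical
  have hm : MeasurableSpace.comap X inferInstance ≤ mΩ := hX.comap_le
  have hFc : MeasurableSet (F ⁻¹' {c}) := hF (measurableSet_singleton c)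
  set f : T → ℝ := fun t => mass μ (fun ω => (F ω, X ω)) (c, t) / mass μ X t with hf
  refine ae_eq_condExp_of_forall_setIntegral_eq hm ((integrable_const 1).indicator hFc) ?_ ?_ ?_
  · intro s _ _
    refine (Integrable.of_bound (C := ∑ t, |f t|)
      ((measurable_of_countable f).comp hX).aestronglyMeasurable ?_).integrableOn
    refine ae_of_all _ fun ω => ?_
    exact Finset.single_le_sum (f := fun t => |f t|) (fun t _ => abs_nonneg _) (Finset.mem_univ (X ω))
  · rintro s ⟨D, hD, rfl⟩ _
    rw [← integral_indicator (hX hD), ← integral_indicator (hX hD)]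
    have e1 : (X ⁻¹' D).indicator (fun ω => f (X ω)) = fun ω => (D.indicator f) (X ω) := by
      ext ω; simp [Set.indicator]
    change ∫ ω, (X ⁻¹' D).indicator (fun ω => f (X ω)) ω ∂μ = _
    rw [e1, integral_comp_eq_sum μ hX]
    have e2 : (X ⁻¹' D).indicator ((F ⁻¹' {c}).indicator fun _ => (1 : ℝ))
        = fun ω => (fun p : S × T => if p.1 = c ∧ p.2 ∈ D then (1 : ℝ) else 0) (F ω, X ω) := by
      ext ω
      by_cases h1 : X ω ∈ D <;> by_cases h2 : F ω = c <;> simp [Set.indicator, h1, h2]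
    rw [e2, integral_comp_eq_sum μ (hF.prodMk hX), Fintype.sum_prod_type_right]
    refine Finset.sum_congr rfl fun t _ => ?_
    rw [Finset.sum_eq_single c (by intro b _ hb; simp [hb]) (by simp)]
    by_cases ht : t ∈ D
    · simp only [Set.indicator_of_mem ht, hf, ht, and_self, if_true, mul_one]
      by_cases h0 : mass μ X t = 0
      · have := sum_mass_left μ hF hX t
        rw [h0, Finset.sum_eq_zero_iff_of_nonneg (fun _ _ => mass_nonneg _ _ _)] at this
        rw [this c (Finset.mem_univ c)]; simp
      · field_simp
    · simp [ht]
  · refine Measurable.aestronglyMeasurable (m := MeasurableSpace.comap X inferInstance) ?_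
    exact (measurable_of_countable f).comp (comap_measurable X)

lemma condEntropy_finite (μ : Measure Ω) [IsProbabilityMeasure μ] {F : Ω → S} {X : Ω → T}
    (hF : Measurable F) (hX : Measurable X) :
    condEntropy μ F X = entropy μ (fun ω => (F ω, X ω)) - entropy μ X := by
  set P : S → T → ℝ := fun c t => mass μ (fun ω => (F ω, X ω)) (c, t) with hP
  have h1 : condEntropy μ F X
      = ∫ ω, (fun t => ∑ c, Real.negMulLog (P c t / mass μ X t)) (X ω) ∂μ := by
    refine integral_congr_ae ?_
    have := ae_all_iff.2 fun c => condExp_comap_finite μ hF hX c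
    filter_upwards [this] with ω hω
    refine Finset.sum_congr rfl fun c _ => ?_
    rw [← hω c]
  rw [h1, integral_comp_eq_sum μ hX (fun t => ∑ c, Real.negMulLog (P c t / mass μ X t)), entropy, entropy, Fintype.sum_prod_type_right,
    ← Finset.sum_sub_distrib]
  refine Finset.sum_congr rfl fun t _ => ?_
  have hs : ∑ c, P c t = mass μ X t := sum_mass_left μ hF hX t
  have hPn : ∀ c, 0 ≤ P c t := fun c => mass_nonneg _ _ _
  have hM : Real.negMulLog (mass μ X t) = ∑ c, -(P c t * Real.log (mass μ X t)) := by
    rw [Finset.sum_neg_distrib, ← Finset.sum_mul, hs, Real.negMulLog_eq_neg]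
  rw [hM, Finset.mul_sum, ← Finset.sum_sub_distrib]
  refine Finset.sum_congr rfl fun c _ => ?_
  change _ = Real.negMulLog (P c t) - _
  rcases (hPn c).eq_or_lt with h0 | h0
  · simp [← h0]
  have h2 : 0 < mass μ X t :=
    hs ▸ h0.trans_le (Finset.single_le_sum (fun c _ => hPn c) (Finset.mem_univ c))
  simp only [Real.negMulLog_eq_neg]
  rw [Real.log_div h0.ne' h2.ne']
  field_simp
  ring

lemma abs_negMulLog_le {y : ℝ} (h0 : 0 ≤ y) (h1 : y ≤ 1) : |Real.negMulLog y| ≤ 1 := by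
  rw [abs_of_nonneg (Real.negMulLog_nonneg h0 h1)]
  linarith [Real.negMulLog_le_one_sub_self h0]

lemma condExp_indicator_mem (μ : Measure Ω) [IsProbabilityMeasure μ] {s : Set Ω}
    (hs : MeasurableSet s) (m : MeasurableSpace Ω) :
    ∀ᵐ ω ∂μ, 0 ≤ (μ⟦s | m⟧) ω ∧ (μ⟦s | m⟧) ω ≤ 1 := by
  by_cases hm : m ≤ mΩ
  · have h1 : 0 ≤ᵐ[μ] μ⟦s | m⟧ :=
      condExp_nonneg (ae_of_all _ fun ω => Set.indicator_nonneg (fun _ _ => zero_le_one) _)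
    have h2 : μ⟦s | m⟧ ≤ᵐ[μ] μ[(fun _ => (1 : ℝ)) | m] :=
      condExp_mono ((integrable_const 1).indicator hs) (integrable_const 1)
        (ae_of_all _ fun ω => Set.indicator_le_self' (fun _ _ => zero_le_one) _)
    rw [condExp_const hm] at h2
    filter_upwards [h1, h2] with ω a b using ⟨a, b⟩
  · rw [condExp_of_not_le hm]
    exact ae_of_all _ fun ω => ⟨le_rfl, zero_le_one⟩

/-- Lévy's upward theorem gives almost sure convergence of the conditional probabilities. As
`negMulLog` is continuous, and bounded on `[0, 1]`, dominated convergence passes to the integrals.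
This reduces entropy given an infinite sequence to finite Shannon entropies. -/
lemma tendsto_condEntropy (μ : Measure Ω) [IsProbabilityMeasure μ] {F : Ω → S}
    (hF : Measurable F) {V : ℕ → Type*} [∀ j, MeasurableSpace (V j)] {X : ∀ j, Ω → V j}
    (hX : ∀ j, Measurable (X j)) (G : Ω → Y)
    (hmono : Monotone fun j => MeasurableSpace.comap (X j) inferInstance)
    (hsup : ⨆ j, MeasurableSpace.comap (X j) inferInstance = MeasurableSpace.comap G inferInstance) :
    Tendsto (fun j => condEntropy μ F (X j)) atTop (nhds (condEntropy μ F G)) := by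
  let ℱ : Filtration ℕ mΩ := ⟨fun j => MeasurableSpace.comap (X j) inferInstance, hmono,
    fun j => (hX j).comap_le⟩
  have hmeas : ∀ c, MeasurableSet (F ⁻¹' {c}) := fun c => hF (measurableSet_singleton c)
  refine tendsto_integral_of_dominated_convergence (fun _ => (Fintype.card S : ℝ)) ?_
    (integrable_const _) ?_ ?_
  · intro j
    refine Finset.aestronglyMeasurable_fun_sum _ fun c _ => ?_
    exact Real.continuous_negMulLog.comp_aestronglyMeasurable
      integrable_condExp.aestronglyMeasurable
  · intro j
    have := ae_all_iff.2 fun c => condExp_indicator_mem μ (hmeas c)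
      (MeasurableSpace.comap (X j) inferInstance)
    filter_upwards [this] with ω hω
    rw [Real.norm_eq_abs]
    refine (Finset.abs_sum_le_sum_abs _ _).trans ?_
    refine (Finset.sum_le_sum fun c _ => abs_negMulLog_le (hω c).1 (hω c).2).trans_eq ?_
    simp [Finset.card_univ]
  · have := ae_all_iff.2 fun c =>
      tendsto_ae_condExp (μ := μ) (ℱ := ℱ) ((F ⁻¹' {c}).indicator fun _ => (1 : ℝ))
    filter_upwards [this] with ω hω
    refine tendsto_finsetSum _ fun c _ => ?_
    refine (Real.continuous_negMulLog.tendsto _).comp ?_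
    have h2 := hω c
    have e : (⨆ n, ℱ n) = MeasurableSpace.comap G inferInstance := hsup
    rw [e] at h2
    exact h2

lemma condEntropy_eq_zero (μ : Measure Ω) [IsProbabilityMeasure μ] {F : Ω → S}
    (hF : Measurable F) : condEntropy μ F (id : Ω → Ω) = 0 := by
  unfold condEntropy
  have : ∀ ω, ∑ c, Real.negMulLog
      ((μ⟦F ⁻¹' {c} | MeasurableSpace.comap (id : Ω → Ω) inferInstance⟧) ω) = 0 := by
    intro ω
    refine Finset.sum_eq_zero fun c _ => ?_
    rw [MeasurableSpace.comap_id, condExp_of_stronglyMeasurable le_rfl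
      (stronglyMeasurable_const.indicator (hF (measurableSet_singleton c)))
      ((integrable_const 1).indicator (hF (measurableSet_singleton c)))]
    by_cases h : ω ∈ F ⁻¹' {c} <;> simp [h]
  simp only [this, integral_zero]

end CondEntropy

/-! ### Stationary polymatroids -/

section Polymatroid

variable {κ : Type*} [DecidableEq κ]

/-- Translation of a finite set of space-time coordinates. -/
def translate (d : ℤ) (I : Finset (κ × ℤ)) : Finset (κ × ℤ) :=
  I.image fun p => (p.1, p.2 + d)

/-- The coordinates of channel `c` in the time interval `[i, j)`. -/
def seg (c : κ) (i j : ℤ) : Finset (κ × ℤ) := {c} ×ˢ Finset.Ico i j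

omit [DecidableEq κ] in
lemma mem_seg {c : κ} {i j : ℤ} {p : κ × ℤ} : p ∈ seg c i j ↔ p.1 = c ∧ i ≤ p.2 ∧ p.2 < j := by
  simp only [seg, Finset.mem_product, Finset.mem_singleton, Finset.mem_Ico]

lemma mem_translate {d : ℤ} {I : Finset (κ × ℤ)} {p : κ × ℤ} :
    p ∈ translate d I ↔ (p.1, p.2 - d) ∈ I := by
  simp only [translate, Finset.mem_image]
  constructor
  · rintro ⟨q, hq, rfl⟩; simpa using hq
  · intro h; exact ⟨_, h, by simp⟩

lemma translate_seg (d : ℤ) (c : κ) (i j : ℤ) :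
    translate d (seg c i j) = seg c (i + d) (j + d) := by
  ext p
  simp only [mem_translate, mem_seg]
  constructor <;> rintro ⟨h1, h2, h3⟩ <;> exact ⟨h1, by omega, by omega⟩

lemma translate_union (d : ℤ) (I J : Finset (κ × ℤ)) :
    translate d (I ∪ J) = translate d I ∪ translate d J := Finset.image_union _ _

lemma translate_neg_translate (d : ℤ) (I : Finset (κ × ℤ)) : translate (-d) (translate d I) = I := by
  ext p; simp [mem_translate]

omit [DecidableEq κ] in
lemma seg_subset_seg {c : κ} {i j i' j' : ℤ} (hi : i' ≤ i) (hj : j ≤ j') :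
    seg c i j ⊆ seg c i' j' := by
  intro p
  simp only [mem_seg]
  rintro ⟨h1, h2, h3⟩
  exact ⟨h1, by omega, by omega⟩

lemma seg_union_seg (c : κ) {i j k : ℤ} (hi : i ≤ j) (hj : j ≤ k) :
    seg c i j ∪ seg c j k = seg c i k := by
  ext p
  simp only [Finset.mem_union, mem_seg]
  constructor
  · rintro (⟨h1, h2, h3⟩ | ⟨h1, h2, h3⟩) <;> exact ⟨h1, by omega, by omega⟩
  · rintro ⟨h1, h2, h3⟩
    rcases lt_or_ge p.2 j with h | h
    · exact Or.inl ⟨h1, h2, h⟩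
    · exact Or.inr ⟨h1, h, h3⟩

omit [DecidableEq κ] in
lemma card_seg (c : κ) (i : ℤ) (n : ℕ) : (seg c i (i + n)).card = n := by simp [seg]

/-- The abstract properties of the joint entropies of a stationary family of processes. -/
structure StationaryPolymatroid (h : Finset (κ × ℤ) → ℝ) (R : ℝ) : Prop where
  nonneg : ∀ I, 0 ≤ h I
  mono : ∀ {I J}, I ⊆ J → h I ≤ h J
  submodular : ∀ (I) {J K}, K ⊆ J → h (I ∪ J) - h J ≤ h (I ∪ K) - h K
  translate : ∀ d I, h (translate d I) = h I
  le_card : ∀ I, h I ≤ I.card * R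

/-- The increment `h(I | J)`. -/
def increment (h : Finset (κ × ℤ) → ℝ) (I J : Finset (κ × ℤ)) : ℝ := h (I ∪ J) - h J

/-- `g I` is the limit of the increments `h(I | b_[-m,m))`, where `b` is a channel. -/
def IsLimitIncrement (h g : Finset (κ × ℤ) → ℝ) (b : κ) : Prop :=
  ∀ I, Tendsto (fun m : ℕ => increment h I (seg b (-m) m)) atTop (nhds (g I))

/-- Comparing slopes discards boundary terms that do not grow with the length. -/
lemma le_of_forall_nat_affine {a b c d : ℝ} (h : ∀ j : ℕ, 0 < j → a * j + b ≤ c * j + d) :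
    a ≤ c := by
  by_contra hac
  push Not at hac
  obtain ⟨j, hj⟩ := exists_nat_gt (max ((d - b) / (a - c)) 1)
  have hj0 : 0 < j := by
    have := (le_max_right _ _).trans_lt hj
    exact_mod_cast zero_lt_one.trans this
  have h1 := (le_max_left _ _).trans_lt hj
  rw [div_lt_iff₀ (by linarith)] at h1
  have := h j hj0
  nlinarith

/-! ### Limit increments and entropy rates of stationary polymatroids -/

namespace StationaryPolymatroid

variable {h g : Finset (κ × ℤ) → ℝ} {R : ℝ} (H : StationaryPolymatroid h R)
include H

lemma increment_anti (I : Finset (κ × ℤ)) {J K : Finset (κ × ℤ)} (hKJ : K ⊆ J) :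
    increment h I J ≤ increment h I K := H.submodular I hKJ

lemma increment_mono {I I' : Finset (κ × ℤ)} (hI : I ⊆ I') (J : Finset (κ × ℤ)) :
    increment h I J ≤ increment h I' J :=
  sub_le_sub_right (H.mono (Finset.union_subset_union_left hI)) _

omit H in
lemma increment_union (h : Finset (κ × ℤ) → ℝ) (I I' J : Finset (κ × ℤ)) :
    increment h (I ∪ I') J = increment h I J + increment h I' (I ∪ J) := by
  have : I ∪ I' ∪ J = I' ∪ (I ∪ J) := by
    rw [Finset.union_comm I I', Finset.union_assoc]
  rw [increment, increment, increment, this]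
  ring

lemma increment_translate (d : ℤ) (I J : Finset (κ × ℤ)) :
    increment h (RelOrnstein.translate d I) (RelOrnstein.translate d J) = increment h I J := by
  rw [increment, increment, ← translate_union, H.translate, H.translate]

lemma increment_nonneg (I J : Finset (κ × ℤ)) : 0 ≤ increment h I J :=
  sub_nonneg.2 (H.mono Finset.subset_union_right)

lemma increment_le_card (I J : Finset (κ × ℤ)) : increment h I J ≤ I.card * R := by
  have h1 := H.increment_anti I (Finset.empty_subset J)
  have h2 := H.le_card I
  have h3 := H.nonneg ∅
  simp only [increment, Finset.union_empty] at *
  linarith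

variable {b : κ} (hg : IsLimitIncrement h g b)
include hg

lemma limit_nonneg (I : Finset (κ × ℤ)) : 0 ≤ g I :=
  ge_of_tendsto' (hg I) fun _ => H.increment_nonneg _ _

lemma limit_mono {I I' : Finset (κ × ℤ)} (hI : I ⊆ I') : g I ≤ g I' :=
  le_of_tendsto_of_tendsto' (hg I) (hg I') fun _ => H.increment_mono hI _

/-- The window of `b` eventually swallows the part of `J` outside `I`, and conditioning on more
lowers an increment. So an infinite conditioning may be bounded through any finite part of it. -/
lemma limit_union_le (I I' : Finset (κ × ℤ)) {J : Finset (κ × ℤ)} {m : ℕ}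
    (hJ : J ⊆ I ∪ seg b (-m) m) : g (I ∪ I') ≤ g I + increment h I' J := by
  refine le_of_tendsto_of_tendsto (hg (I ∪ I')) ((hg I).add_const _) ?_
  filter_upwards [eventually_ge_atTop m] with k hk
  rw [increment_union]
  refine add_le_add le_rfl (H.increment_anti _ (hJ.trans ?_))
  exact Finset.union_subset_union_right (seg_subset_seg (by omega) (by omega))

lemma limit_union_le_add (I I' : Finset (κ × ℤ)) : g (I ∪ I') ≤ g I + g I' := by
  refine le_of_tendsto_of_tendsto' (hg (I ∪ I')) ((hg I).add (hg I')) fun k => ?_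
  rw [increment_union]
  exact add_le_add le_rfl (H.increment_anti _ Finset.subset_union_right)

/-- The window `[-m, m)` moved by `d` still lies in the window of radius `m + |d|`, which has the
same limit. -/
lemma limit_translate_le (d : ℤ) (I : Finset (κ × ℤ)) :
    g (RelOrnstein.translate d I) ≤ g I := by
  refine le_of_tendsto_of_tendsto' ((hg (RelOrnstein.translate d I)).comp
    (tendsto_add_atTop_nat d.natAbs)) (hg I) fun m => ?_
  rw [← H.increment_translate d I]
  refine H.increment_anti _ ?_
  rw [translate_seg]
  dsimp only
  exact seg_subset_seg (by omega) (by omega)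

lemma limit_translate (d : ℤ) (I : Finset (κ × ℤ)) : g (RelOrnstein.translate d I) = g I := by
  refine le_antisymm (H.limit_translate_le hg d I) ?_
  have := H.limit_translate_le hg (-d) (RelOrnstein.translate d I)
  rwa [translate_neg_translate] at this

lemma limit_subadditive (c : κ) : Subadditive fun n : ℕ => g (seg c 0 n) := by
  intro m n
  have h1 := H.limit_union_le_add hg (seg c 0 m) (seg c m (m + n))
  have h2 := H.limit_translate hg m (seg c 0 n)
  rw [translate_seg, zero_add, add_comm] at h2
  rw [seg_union_seg c (by omega) (by omega)] at h1
  rw [h2] at h1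
  exact_mod_cast h1

omit H hg in
lemma bddBelow_range_div {u : ℕ → ℝ} (hu : ∀ n, 0 ≤ u n) :
    BddBelow (Set.range fun n : ℕ => u n / n) :=
  ⟨0, by rintro _ ⟨n, rfl⟩; exact div_nonneg (hu n) (Nat.cast_nonneg n)⟩

lemma tendsto_limit_div (c : κ) :
    Tendsto (fun n : ℕ => g (seg c 0 n) / n) atTop (nhds (H.limit_subadditive hg c).lim) :=
  (H.limit_subadditive hg c).tendsto_lim (bddBelow_range_div fun _ => H.limit_nonneg hg _)

/-- After time `p` the channel is revealed in blocks of length `n`. Each block has, in its past and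
in `b`, a translate of the conditioning set on the right, hence costs at most that increment. The `+
1` rounds up the number of blocks. -/
lemma limit_seg_le (a : κ) {p n N : ℕ} (hn : 0 < n) (M : ℕ) :
    g (seg a 0 M) ≤ g (seg a 0 p)
      + (M / n + 1) * increment h (seg a p (p + n)) (seg b 0 N ∪ seg a 0 p) := by
  set c := increment h (seg a p (p + n)) (seg b 0 N ∪ seg a 0 p) with hc
  have hc0 : 0 ≤ c := H.increment_nonneg _ _
  have step : ∀ q : ℕ, p ≤ q → g (seg a 0 (q + n)) ≤ g (seg a 0 q) + c := by
    intro q hq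
    have h1 := H.limit_union_le hg (seg a 0 q) (seg a q (q + n))
      (J := RelOrnstein.translate (q - p) (seg b 0 N ∪ seg a 0 p)) (m := q + N) ?_
    · rw [seg_union_seg a (by omega) (by omega)] at h1
      refine h1.trans_eq ?_
      rw [hc, ← H.increment_translate (q - p) (seg a p (p + n)), translate_seg]
      congr 3 <;> ring
    · rw [translate_union, translate_seg, translate_seg, Finset.union_comm]
      exact Finset.union_subset_union (seg_subset_seg (by omega) (by omega))
        (seg_subset_seg (by push_cast; omega) (by push_cast; omega))
  have hj : ∀ j : ℕ, g (seg a 0 (p + j * n : ℕ)) ≤ g (seg a 0 p) + j * c := by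
    intro j
    induction j with
    | zero => simp
    | succ j ih =>
      have h2 := step (p + j * n) (by omega)
      have e : ((p + j * n : ℕ) : ℤ) + n = (p + (j + 1) * n : ℕ) := by push_cast; ring
      rw [e] at h2
      push_cast at *
      linarith
  have hM : M ≤ p + (M / n + 1) * n := by
    have := Nat.lt_div_mul_add (a := M) hn
    rw [add_mul, one_mul]
    omega
  refine (H.limit_mono hg (seg_subset_seg (le_refl 0) (by exact_mod_cast hM))).trans
    ((hj (M / n + 1)).trans ?_)
  have : ((M / n : ℕ) : ℝ) ≤ M / n := Nat.cast_div_le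
  push_cast
  gcongr

/-- If the channel `e` is asymptotically determined by the channels `a` and `b`, then its entropy
rate relative to `b` is at most any conditional block entropy of `a`. -/
theorem lim_le_increment (a e : κ)
    (he : Tendsto (fun m : ℕ => increment h (seg e 0 1) (seg b (-m) m ∪ seg a (-m) m)) atTop (nhds 0))
    {p n N : ℕ} (hn : 0 < n) :
    (H.limit_subadditive hg e).lim
      ≤ increment h (seg a p (p + n)) (seg b 0 N ∪ seg a 0 p) / n := by
  set c := increment h (seg a p (p + n)) (seg b 0 N ∪ seg a 0 p) with hc
  -- It is enough to bound the rate by `c / n` plus the cost of reading one symbol of `e` from the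
  -- windows of radius `m` in `a` and `b`, since that cost tends to 0.
  refine ge_of_tendsto' (f := fun m : ℕ => c / n
    + increment h (seg e 0 1) (seg b (-m) m ∪ seg a (-m) m)) (by simpa using he.const_add (c / n))
    fun m => ?_
  set δ := increment h (seg e 0 1) (seg b (-m) m ∪ seg a (-m) m) with hδ
  have step : ∀ M j : ℕ, j ≤ M → g (seg a (-m) (M + m) ∪ seg e 0 j)
      ≤ g (seg a (-m) (M + m)) + j * δ := by
    intro M j
    induction j with
    | zero => intro _; simp [seg]
    | succ j ih =>
      intro hj
      have h1 := H.limit_union_le hg (seg a (-m) (M + m) ∪ seg e 0 j) (seg e j (j + 1))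
        (J := RelOrnstein.translate j (seg b (-m) m ∪ seg a (-m) m)) (m := j + m) ?_
      · rw [Finset.union_assoc, seg_union_seg e (by omega) (by omega)] at h1
        have h2 : increment h (seg e j (j + 1))
            (RelOrnstein.translate j (seg b (-m) m ∪ seg a (-m) m)) = δ := by
          rw [hδ, ← H.increment_translate j (seg e 0 1), translate_seg]
          congr 2 <;> ring
        rw [h2] at h1
        have := ih (by omega)
        push_cast
        linarith
      · rw [translate_union, translate_seg, translate_seg, Finset.union_comm, Finset.union_assoc]
        refine Finset.union_subset_union (seg_subset_seg (by omega) (by omega))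
          (Finset.subset_union_right.trans' (seg_subset_seg (by push_cast; omega) (by push_cast; omega)))
  -- Compare slopes in `M`: the initial segment of length `p` and the `2 m` extra symbols of `a`
  -- enter only the constant.
  refine le_of_forall_nat_affine (b := 0)
    (d := g (seg a 0 p) + (2 * m / n + 1) * c) fun M hM => ?_
  have h1 := (H.limit_subadditive hg e).lim_le_div
    (bddBelow_range_div fun _ => H.limit_nonneg hg _) hM.ne'
  rw [le_div_iff₀ (by exact_mod_cast hM)] at h1
  have h2 := H.limit_mono hg (Finset.subset_union_right (s₁ := seg a (-m) (M + m)) (s₂ := seg e 0 M))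
  have h3 := step M M le_rfl
  have h4 : g (seg a (-m) (M + m)) = g (seg a 0 (M + 2 * m : ℕ)) := by
    rw [← H.limit_translate hg m (seg a (-m) (M + m)), translate_seg]
    congr 2
    · ring
    · push_cast; ring
  have h5 := H.limit_seg_le hg a (p := p) (N := N) hn (M + 2 * m)
  rw [← hc] at h5
  rw [add_zero]
  refine h1.trans (h2.trans (h3.trans ?_))
  rw [h4]
  refine (add_le_add h5 le_rfl).trans_eq ?_
  push_cast
  field_simp
  ring

omit hg in
lemma block_subadditive (a b : κ) :
    Subadditive fun n : ℕ => increment h (seg a 0 n) (seg b 0 n) := by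
  intro m n
  have h1 := increment_union h (seg a 0 m) (seg a m (m + n)) (seg b 0 (m + n))
  rw [seg_union_seg a (by omega) (by omega)] at h1
  have h2 : increment h (seg a 0 m) (seg b 0 (m + n)) ≤ increment h (seg a 0 m) (seg b 0 m) :=
    H.increment_anti _ (seg_subset_seg (by omega) (by omega))
  have h3 : increment h (seg a m (m + n)) (seg a 0 m ∪ seg b 0 (m + n))
      ≤ increment h (seg a 0 n) (seg b 0 n) := by
    rw [← H.increment_translate m (seg a 0 n), translate_seg, translate_seg, zero_add,
      add_comm (n : ℤ) m]
    exact H.increment_anti _ ((seg_subset_seg (by omega) (by omega)).trans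
      Finset.subset_union_right)
  push_cast
  linarith

/-- Conditioning on the whole channel `b` or only on the simultaneous block of it gives the same
entropy rate. -/
theorem eventually_increment_le (a : κ) {s : ℝ} (hs : 0 < s) :
    ∀ᶠ n : ℕ in atTop, increment h (seg a 0 n) (seg b 0 n)
      ≤ n * ((H.limit_subadditive hg a).lim + s) := by
  have hbdd := bddBelow_range_div (u := fun n : ℕ => increment h (seg a 0 n) (seg b 0 n))
    fun _ => H.increment_nonneg _ _
  have hF := (H.block_subadditive a b).tendsto_lim hbdd
  set l := (H.block_subadditive a b).lim with hl
  -- Fix `n` and a radius `m`. Given `b` on `[-m, K n + m)`, each of the `K` blocks of `a` costs at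
  -- most `w`, because that interval contains the translate of `[-m, m)` belonging to the block. The
  -- `2 m` boundary symbols cost at most `2 m R`. Comparing slopes in `K` gives `l n ≤ w`, and then
  -- `m` tends to infinity.
  have hle : l ≤ (H.limit_subadditive hg a).lim := by
    refine ge_of_tendsto (H.tendsto_limit_div hg a) ?_
    filter_upwards [eventually_gt_atTop 0] with n hn
    rw [le_div_iff₀ (by exact_mod_cast hn)]
    refine ge_of_tendsto' (hg (seg a 0 n)) fun m => ?_
    set w := increment h (seg a 0 n) (seg b (-m) m) with hw
    have step : ∀ K j : ℕ, j ≤ K →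
        increment h (seg a 0 (j * n)) (seg b (-m) (K * n + m)) ≤ j * w := by
      intro K j
      induction j with
      | zero => intro _; simp [seg, increment]
      | succ j ih =>
        intro hj
        have hjK : (j : ℤ) * n + n ≤ K * n := by
          have : ((j + 1 : ℕ) : ℤ) * n ≤ K * n :=
            mul_le_mul_of_nonneg_right (by exact_mod_cast hj) (by positivity)
          push_cast at this
          linarith
        have h1 := increment_union h (seg a 0 (j * n)) (seg a (j * n) (j * n + n))
          (seg b (-m) (K * n + m))
        rw [seg_union_seg a (by positivity) (by omega)] at h1
        have h2 : increment h (seg a (j * n) (j * n + n))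
            (seg a 0 (j * n) ∪ seg b (-m) (K * n + m)) ≤ w := by
          rw [hw, ← H.increment_translate (j * n) (seg a 0 n), translate_seg, translate_seg,
            zero_add, add_comm (n : ℤ)]
          have : (0 : ℤ) ≤ j * n := by positivity
          exact H.increment_anti _ ((seg_subset_seg (by omega) (by omega)).trans
            Finset.subset_union_right)
        have h3 := ih (by omega)
        have e : ((j + 1 : ℕ) : ℤ) * n = j * n + n := by push_cast; ring
        rw [e, h1]
        push_cast
        linarith
    refine le_of_forall_nat_affine (b := l * (2 * m)) (d := 2 * m * R) fun K hK => ?_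
    have h1 := (H.block_subadditive a b).lim_le_div hbdd (n := K * n + 2 * m) (by positivity)
    rw [le_div_iff₀ (by positivity)] at h1
    have e1 : increment h (seg a 0 (K * n + 2 * m : ℕ)) (seg b 0 (K * n + 2 * m : ℕ))
        = increment h (seg a (-m) (K * n + m)) (seg b (-m) (K * n + m)) := by
      rw [← H.increment_translate m (seg a (-m) (K * n + m)), translate_seg, translate_seg]
      congr 2 <;> push_cast <;> ring
    have h2 := increment_union h (seg a 0 (K * n)) (seg a (-m) 0 ∪ seg a (K * n) (K * n + m))
      (seg b (-m) (K * n + m))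
    have e2 : seg a 0 (K * n) ∪ (seg a (-m) 0 ∪ seg a (K * n) (K * n + m))
        = seg a (-m) (K * n + m) := by
      rw [← Finset.union_assoc, Finset.union_comm (seg a 0 _),
        seg_union_seg a (by omega) (by positivity), seg_union_seg a (by
          have : (0 : ℤ) ≤ K * n := by positivity
          omega) (by omega)]
    rw [e2] at h2
    have h3 := step K K le_rfl
    have h4 := H.increment_le_card (seg a (-m) 0 ∪ seg a (K * n) (K * n + m))
      (seg a 0 (K * n) ∪ seg b (-m) (K * n + m))
    have hR : 0 ≤ R := by
      have h6 := (H.nonneg (seg a 0 (0 + (1 : ℕ)))).trans (H.le_card _)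
      rw [card_seg] at h6
      simpa using h6
    have h5 : ((seg a (-m) 0 ∪ seg a (K * n) (K * n + m)).card : ℝ) ≤ 2 * m := by
      have := Finset.card_union_le (seg a (-m) 0) (seg a (K * n) (K * n + m))
      rw [card_seg] at this
      have e3 : (seg a (-m) 0).card = m := by
        have := card_seg a (-m) m
        rwa [neg_add_cancel] at this
      rw [e3] at this
      exact_mod_cast this.trans_eq (by ring)
    have h7 := mul_le_mul_of_nonneg_right h5 hR
    rw [e1, h2] at h1
    push_cast at h1
    linarith
  have h1 : ∀ᶠ n : ℕ in atTop, increment h (seg a 0 n) (seg b 0 n) / n < l + s :=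
    hF.eventually_lt_const (by linarith)
  filter_upwards [h1, eventually_gt_atTop 0] with n hn hn0
  have hn0' : (0 : ℝ) < n := by exact_mod_cast hn0
  rw [div_lt_iff₀ hn0'] at hn
  nlinarith

end StationaryPolymatroid

end Polymatroid

/-! ### Entropy of stationary processes -/

section SameInfo

variable {Ω S T U V Y : Type*} [mΩ : MeasurableSpace Ω]
  [Fintype S] [MeasurableSpace S] [MeasurableSingletonClass S]
  [Fintype T] [MeasurableSpace T] [MeasurableSingletonClass T]
  [Fintype U] [MeasurableSpace U] [MeasurableSingletonClass U]
  [Fintype V] [MeasurableSpace V] [MeasurableSingletonClass V] [MeasurableSpace Y]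

/-- Two random variables determine each other. -/
def SameInfo {Ω S T : Type*} (X : Ω → S) (Y : Ω → T) : Prop :=
  ∀ ω ω', X ω = X ω' ↔ Y ω = Y ω'

lemma SameInfo.refl {Ω S : Type*} (X : Ω → S) : SameInfo X X := fun _ _ => Iff.rfl

lemma SameInfo.exists_comp {Ω S T : Type*} [Nonempty Ω] {X : Ω → S} {X' : Ω → T}
    (h : SameInfo X X') : ∃ f : S → T, ∀ ω, f (X ω) = X' ω := by
  classical
  refine ⟨fun s => if hs : ∃ ω, X ω = s then X' hs.choose else X' (Classical.arbitrary Ω), ?_⟩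
  intro ω
  have hs : ∃ ω', X ω' = X ω := ⟨ω, rfl⟩
  change (if hs : ∃ ω', X ω' = X ω then X' hs.choose else X' (Classical.arbitrary Ω)) = X' ω
  rw [dif_pos hs]
  exact (h _ _).1 hs.choose_spec

lemma SameInfo.entropy_eq (μ : Measure Ω) [IsProbabilityMeasure μ] {X : Ω → S} {X' : Ω → T}
    (h : SameInfo X X') (hX : Measurable X) (hX' : Measurable X') :
    entropy μ X = entropy μ X' := by
  have := nonempty_of_isProbabilityMeasure μ
  obtain ⟨f, hf⟩ := h.exists_comp
  obtain ⟨g, hg⟩ := SameInfo.exists_comp (X := X') (X' := X) fun ω ω' => (h ω ω').symm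
  exact entropy_eq_of_comp μ hX hX' f g hf hg

end SameInfo

/-! ### Joint entropies of a family of processes as a stationary polymatroid -/

section StationaryFamily

variable {Ω κ C S U Y : Type*} [mΩ : MeasurableSpace Ω] [DecidableEq κ]
  [Fintype C] [MeasurableSpace C] [MeasurableSingletonClass C]
  [Fintype S] [MeasurableSpace S] [MeasurableSingletonClass S]
  [Fintype U] [MeasurableSpace U] [MeasurableSingletonClass U] [MeasurableSpace Y]

/-- The joint entropies of a finite family of processes. -/
def familyEntropy (μ : Measure Ω) (x : κ → Ω → ℤ → C) (I : Finset (κ × ℤ)) : ℝ :=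
  jointEntropy μ (fun (p : κ × ℤ) ω => x p.1 ω p.2) I

/-- The restriction of a family of processes to a finite set of coordinates. -/
def subfamily (x : κ → Ω → ℤ → C) (I : Finset (κ × ℤ)) (ω : Ω) (p : I) : C := x p.1.1 ω p.1.2

omit mΩ [DecidableEq κ] [Fintype C] [MeasurableSpace C] [MeasurableSingletonClass C] in
lemma subfamily_eq_iff (x : κ → Ω → ℤ → C) (I : Finset (κ × ℤ)) (ω ω' : Ω) :
    subfamily x I ω = subfamily x I ω' ↔ ∀ p ∈ I, x p.1 ω p.2 = x p.1 ω' p.2 := by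
  simp [funext_iff, subfamily]

variable {μ : Measure Ω} [IsProbabilityMeasure μ] {T : Ω → Ω} {x : κ → Ω → ℤ → C}

omit [Fintype C] [MeasurableSingletonClass C] [DecidableEq κ] [IsProbabilityMeasure μ] in
lemma IsProcess.measurable_coord (hx : ∀ c, IsProcess μ T (x c)) (p : κ × ℤ) :
    Measurable fun ω => x p.1 ω p.2 := (measurable_pi_apply p.2).comp (hx p.1).1

omit [Fintype C] [MeasurableSingletonClass C] [DecidableEq κ] [IsProbabilityMeasure μ] in
lemma measurable_subfamily' (hx : ∀ c, IsProcess μ T (x c)) (I : Finset (κ × ℤ)) :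
    Measurable (subfamily x I) :=
  measurable_pi_lambda _ fun p => IsProcess.measurable_coord hx p.1

omit [Fintype S] [IsProbabilityMeasure μ] in
lemma mass_comp_measurePreserving (hT : MeasurePreserving T μ μ) {X : Ω → S} (hX : Measurable X) :
    mass μ (fun ω => X (T ω)) = mass μ X := by
  ext s
  exact hT.measureReal_preimage (hX (measurableSet_singleton s)).nullMeasurableSet

/-- Moving the coordinates by one agrees almost surely with composing by `T`, which preserves all
masses. -/
lemma familyEntropy_translate_one (hT : MeasurePreserving T μ μ) (hx : ∀ c, IsProcess μ T (x c))
    (I : Finset (κ × ℤ)) : familyEntropy μ x (translate 1 I) = familyEntropy μ x I := by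
  have h1 : entropy μ (subfamily x I) = entropy μ (fun ω => subfamily x I (T ω)) := by
    rw [entropy, entropy, mass_comp_measurePreserving hT (measurable_subfamily' hx I)]
  have h2 : (fun ω => subfamily x I (T ω)) =ᵐ[μ] fun ω (p : I) => x p.1.1 ω (p.1.2 + 1) := by
    have : ∀ᵐ ω ∂μ, ∀ p : I, x p.1.1 (T ω) = shift (x p.1.1 ω) :=
      ae_all_iff.2 fun p => (hx p.1.1).2
    filter_upwards [this] with ω hω
    ext p
    simp [subfamily, hω p, shift]
  have h3 : entropy μ (subfamily x (translate 1 I))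
      = entropy μ (fun ω (p : I) => x p.1.1 ω (p.1.2 + 1)) := by
    refine SameInfo.entropy_eq μ ?_ (measurable_subfamily' hx _)
      (measurable_pi_lambda _ fun p => IsProcess.measurable_coord hx (p.1.1, p.1.2 + 1))
    intro ω ω'
    rw [subfamily_eq_iff, funext_iff]
    constructor
    · intro h p
      exact h (p.1.1, p.1.2 + 1) (by simp [mem_translate])
    · intro h p hp
      have := h ⟨(p.1, p.2 - 1), mem_translate.1 hp⟩
      simpa using this
  change entropy μ (subfamily x (translate 1 I)) = entropy μ (subfamily x I)
  rw [h3, h1, entropy_congr h2]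

lemma familyEntropy_translate (hT : MeasurePreserving T μ μ) (hx : ∀ c, IsProcess μ T (x c))
    (d : ℤ) (I : Finset (κ × ℤ)) : familyEntropy μ x (translate d I) = familyEntropy μ x I := by
  have hadd : ∀ (d : ℤ) I, translate (d + 1) I = translate 1 (translate d (κ := κ) I) := by
    intro d I
    ext p
    simp only [mem_translate]
    rw [sub_sub, add_comm (1 : ℤ) d]
  induction d using Int.induction_on with
  | zero => congr 1; ext p; simp [mem_translate]
  | succ d ih => rw [hadd, familyEntropy_translate_one hT hx, ih]
  | pred d ih =>
    rw [← ih, ← familyEntropy_translate_one hT hx (translate (-d - 1) I), ← hadd]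
    simp

lemma stationaryPolymatroid_familyEntropy [Nonempty C] (hT : MeasurePreserving T μ μ)
    (hx : ∀ c, IsProcess μ T (x c)) :
    StationaryPolymatroid (familyEntropy μ x) (Real.log (Fintype.card C)) where
  nonneg I := jointEntropy_nonneg μ I
  mono h := jointEntropy_mono μ (IsProcess.measurable_coord hx) h
  submodular I _ _ h := jointEntropy_submodular μ (IsProcess.measurable_coord hx) I h
  translate d I := familyEntropy_translate hT hx d I
  le_card I := jointEntropy_le_card μ (IsProcess.measurable_coord hx) I

omit mΩ [Fintype C] [MeasurableSpace C] [MeasurableSingletonClass C] [Fintype S]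
  [MeasurableSpace S] [MeasurableSingletonClass S] [Fintype U] [MeasurableSpace U]
  [MeasurableSingletonClass U] in
lemma SameInfo.subfamily_union {F : Ω → S} {Z : Ω → U} {I J : Finset (κ × ℤ)}
    (hI : SameInfo (subfamily x I) F) (hJ : SameInfo (subfamily x J) Z) :
    SameInfo (subfamily x (I ∪ J)) (fun ω => (F ω, Z ω)) := by
  intro ω ω'
  rw [Prod.mk.injEq, ← hI ω ω', ← hJ ω ω', subfamily_eq_iff, subfamily_eq_iff, subfamily_eq_iff]
  simp only [Finset.mem_union]
  exact ⟨fun h => ⟨fun p hp => h p (Or.inl hp), fun p hp => h p (Or.inr hp)⟩,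
    fun h p hp => hp.elim (h.1 p) (h.2 p)⟩

lemma increment_familyEntropy (hx : ∀ c, IsProcess μ T (x c)) {F : Ω → S} {Z : Ω → U}
    (hF : Measurable F) (hZ : Measurable Z) {I J : Finset (κ × ℤ)}
    (hI : SameInfo (subfamily x I) F) (hJ : SameInfo (subfamily x J) Z) :
    increment (familyEntropy μ x) I J = entropy μ (fun ω => (F ω, Z ω)) - entropy μ Z := by
  have h1 : familyEntropy μ x J = entropy μ Z :=
    hJ.entropy_eq μ (measurable_subfamily' hx J) hZ
  have h2 : familyEntropy μ x (I ∪ J) = entropy μ (fun ω => (F ω, Z ω)) :=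
    (hI.subfamily_union hJ).entropy_eq μ (measurable_subfamily' hx _) (hF.prodMk hZ)
  rw [increment, h1, h2]

omit mΩ [DecidableEq κ] [Fintype C] [MeasurableSingletonClass C] in
lemma comap_subfamily_mono {I J : Finset (κ × ℤ)} (hIJ : I ⊆ J) :
    MeasurableSpace.comap (subfamily x I) inferInstance
      ≤ MeasurableSpace.comap (subfamily x J) inferInstance := by
  have : subfamily x I = (fun v (p : I) => v ⟨p.1, hIJ p.2⟩) ∘ subfamily x J := rfl
  rw [this, ← MeasurableSpace.comap_comp]
  refine MeasurableSpace.comap_mono ?_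
  exact (measurable_pi_lambda _ fun p => measurable_pi_apply _).comap_le

omit mΩ [DecidableEq κ] [Fintype C] [MeasurableSingletonClass C] in
lemma measurable_coord_comap_subfamily (x : κ → Ω → ℤ → C) {I : Finset (κ × ℤ)} {p : κ × ℤ}
    (hp : p ∈ I) :
    Measurable[MeasurableSpace.comap (subfamily x I) inferInstance] fun ω => x p.1 ω p.2 :=
  (measurable_pi_apply (⟨p, hp⟩ : {p // p ∈ I})).comp (comap_measurable (subfamily x I))

lemma tendsto_increment_familyEntropy (hx : ∀ c, IsProcess μ T (x c)) {F : Ω → S}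
    (hF : Measurable F) {I : Finset (κ × ℤ)} (hI : SameInfo (subfamily x I) F) (b : κ)
    (G : Ω → Y)
    (hG : MeasurableSpace.comap G inferInstance = MeasurableSpace.comap (x b) inferInstance) :
    Tendsto (fun m : ℕ => increment (familyEntropy μ x) I (seg b (-m) m)) atTop
      (nhds (condEntropy μ F G)) := by
  have h1 := tendsto_condEntropy μ hF (X := fun j : ℕ => subfamily x (seg b (-j) j))
    (fun j => measurable_subfamily' hx _) G ?_ ?_
  · refine h1.congr fun m => ?_
    rw [condEntropy_finite μ hF (measurable_subfamily' hx _)]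
    exact (increment_familyEntropy hx hF (measurable_subfamily' hx _) hI (SameInfo.refl _)).symm
  · intro i j hij
    exact comap_subfamily_mono (seg_subset_seg (by omega) (by omega))
  · rw [hG]
    refine le_antisymm (iSup_le fun j => ?_) ?_
    · refine measurable_iff_comap_le.1 (@measurable_pi_lambda _ _ _ (_) _ _ fun p => ?_)
      have e : (fun ω => subfamily x (seg b (-j) j) ω p) = (fun v => v p.1.2) ∘ (x b) := by
        ext ω
        simp only [subfamily, Function.comp_apply, (mem_seg.1 p.2).1]
      rw [e]
      exact (measurable_pi_apply _).comp (comap_measurable (x b))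
    · refine measurable_iff_comap_le.1 (@measurable_pi_lambda _ _ _ (_) _ _ fun i => ?_)
      -- The radius is `|i| + 1` because the interval is open on the right and would otherwise miss
      -- `i = |i|`.
      have hi : (b, i) ∈ seg b (-(i.natAbs + 1 : ℕ)) (i.natAbs + 1 : ℕ) :=
        mem_seg.2 ⟨rfl, by dsimp only; omega, by dsimp only; omega⟩
      have h2 := measurable_coord_comap_subfamily x hi
      exact h2.mono (le_iSup (fun j : ℕ => MeasurableSpace.comap
        (subfamily x (seg b (-j) j)) inferInstance) (i.natAbs + 1)) le_rfl

lemma isLimitIncrement_familyEntropy (hx : ∀ c, IsProcess μ T (x c)) (b : κ) (G : Ω → Y)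
    (hG : MeasurableSpace.comap G inferInstance = MeasurableSpace.comap (x b) inferInstance) :
    IsLimitIncrement (familyEntropy μ x) (fun I => condEntropy μ (subfamily x I) G) b :=
  fun I => tendsto_increment_familyEntropy hx (measurable_subfamily' hx I) (SameInfo.refl _) b G hG

end StationaryFamily

/-! ### Entropy of extensions -/

/-- The `k`-th block of length `n` of a bi-infinite sequence. -/
def blk {A : Type*} (n k : ℕ) (a : ℤ → A) : Fin n → A := fun j => a ((k : ℤ) * n + j)

/-- The first `k` blocks of length `n` of a bi-infinite sequence. -/
def blks {A : Type*} (n k : ℕ) (a : ℤ → A) : Fin k → Fin n → A := fun i => blk n i a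

section Ext

variable {A B D : Type*} [Fintype A] [MeasurableSpace A] [DiscreteMeasurableSpace A]
  [Fintype B] [MeasurableSpace B] [DiscreteMeasurableSpace B]
  [Fintype D] [MeasurableSpace D] [DiscreteMeasurableSpace D]

omit [Fintype A] [DiscreteMeasurableSpace A] in
lemma measurable_block (n : ℕ) : Measurable (block n : (ℤ → A) → Fin n → A) :=
  measurable_pi_lambda _ fun _ => measurable_pi_apply _

omit [Fintype A] [DiscreteMeasurableSpace A] in
lemma measurable_blk (n k : ℕ) : Measurable (blk n k : (ℤ → A) → Fin n → A) :=
  measurable_pi_lambda _ fun _ => measurable_pi_apply _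

omit [Fintype A] [DiscreteMeasurableSpace A] in
lemma measurable_blks (n k : ℕ) : Measurable (blks n k : (ℤ → A) → Fin k → Fin n → A) :=
  measurable_pi_lambda _ fun i => measurable_blk n i

omit [Fintype A] [DiscreteMeasurableSpace A] in
lemma measurable_shift : Measurable (shift : (ℤ → A) → ℤ → A) :=
  measurable_pi_lambda _ fun _ => measurable_pi_apply _

/-- The two coordinate processes of `B ^ ℤ × A ^ ℤ` and a third process, all with the same
alphabet. -/
def channels (b₀ : B) (a₀ : A) (d₀ : D) (η : (ℤ → B) × (ℤ → A) → ℤ → D) :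
    Fin 3 → (ℤ → B) × (ℤ → A) → ℤ → B × A × D :=
  ![fun ω i => (ω.1 i, a₀, d₀), fun ω i => (b₀, ω.2 i, d₀), fun ω i => (b₀, a₀, η ω i)]

variable {θ : Measure ((ℤ → B) × (ℤ → A))} {η : (ℤ → B) × (ℤ → A) → ℤ → D}
  (b₀ : B) (a₀ : A) (d₀ : D)

omit [Fintype A] [Fintype B] [Fintype D] [DiscreteMeasurableSpace A] [DiscreteMeasurableSpace B]
  [DiscreteMeasurableSpace D] in
lemma isProcess_channels (hη : IsProcess θ shift₂ η) (c : Fin 3) :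
    IsProcess θ shift₂ (channels b₀ a₀ d₀ η c) := by
  have hη1 := hη.1
  match c with
  | 0 =>
    refine ⟨measurable_pi_lambda _ fun i => ?_, ae_of_all _ fun ω => rfl⟩
    change Measurable fun ω : (ℤ → B) × (ℤ → A) => (ω.1 i, a₀, d₀)
    fun_prop
  | 1 =>
    refine ⟨measurable_pi_lambda _ fun i => ?_, ae_of_all _ fun ω => rfl⟩
    change Measurable fun ω : (ℤ → B) × (ℤ → A) => (b₀, ω.2 i, d₀)
    fun_prop
  | 2 =>
    refine ⟨measurable_pi_lambda _ fun i => ?_, ?_⟩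
    · change Measurable fun ω : (ℤ → B) × (ℤ → A) => (b₀, a₀, η ω i)
      fun_prop
    · filter_upwards [hη.2] with ω hω
      ext i : 1
      change (b₀, a₀, η (shift₂ ω) i) = (b₀, a₀, η ω (i + 1))
      rw [hω]; rfl

omit [Fintype A] [Fintype B] [Fintype D] [DiscreteMeasurableSpace A] [DiscreteMeasurableSpace B]
  [DiscreteMeasurableSpace D] in
lemma comap_channels_zero : MeasurableSpace.comap
    (Prod.fst : (ℤ → B) × (ℤ → A) → ℤ → B) inferInstance
      = MeasurableSpace.comap (channels b₀ a₀ d₀ η 0) inferInstance := by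
  have e1 : channels b₀ a₀ d₀ η 0
      = (fun (v : ℤ → B) i => (v i, a₀, d₀)) ∘ (Prod.fst : (ℤ → B) × (ℤ → A) → ℤ → B) := rfl
  have e2 : (Prod.fst : (ℤ → B) × (ℤ → A) → ℤ → B)
      = (fun (v : ℤ → B × A × D) i => (v i).1) ∘ channels b₀ a₀ d₀ η 0 := rfl
  refine le_antisymm ?_ ?_
  · rw [e2, ← MeasurableSpace.comap_comp]
    exact MeasurableSpace.comap_mono (Measurable.comap_le (by fun_prop))
  · rw [e1, ← MeasurableSpace.comap_comp]
    refine MeasurableSpace.comap_mono (Measurable.comap_le ?_)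
    exact measurable_pi_lambda _ fun i => by fun_prop

omit [Fintype A] [Fintype B] [Fintype D] [MeasurableSpace A] [MeasurableSpace B]
  [MeasurableSpace D] [DiscreteMeasurableSpace A] [DiscreteMeasurableSpace B]
  [DiscreteMeasurableSpace D] in
lemma subfamily_channels_eq_iff (c : Fin 3) (i j : ℤ) (ω ω' : (ℤ → B) × (ℤ → A)) :
    subfamily (channels b₀ a₀ d₀ η) (seg c i j) ω = subfamily (channels b₀ a₀ d₀ η) (seg c i j) ω' ↔
      ∀ k, i ≤ k → k < j → channels b₀ a₀ d₀ η c ω k = channels b₀ a₀ d₀ η c ω' k := by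
  rw [subfamily_eq_iff]
  constructor
  · intro h k h1 h2
    exact h (c, k) (mem_seg.2 ⟨rfl, h1, h2⟩)
  · rintro h ⟨c', k⟩ hp
    obtain ⟨h1, h2, h3⟩ := mem_seg.1 hp
    dsimp only at h1 h2 h3 ⊢
    rw [h1]
    exact h k h2 h3

lemma block_eq_iff {A : Type*} (n : ℕ) (a a' : ℤ → A) :
    block n a = block n a' ↔ ∀ k : ℤ, 0 ≤ k → k < n → a k = a' k := by
  rw [funext_iff]
  constructor
  · intro h k h1 h2
    have := h ⟨k.toNat, by omega⟩
    simpa [block, h1] using this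
  · intro h j
    exact h j (by positivity) (by exact_mod_cast j.2)

lemma blk_eq_iff {A : Type*} (n k : ℕ) (a a' : ℤ → A) :
    blk n k a = blk n k a' ↔ ∀ i : ℤ, (k * n : ℕ) ≤ i → i < (k * n : ℕ) + n → a i = a' i := by
  rw [funext_iff]
  constructor
  · intro h i h1 h2
    have := h ⟨(i - (k * n : ℕ)).toNat, by omega⟩
    have e : (k : ℤ) * n + ((i - (k * n : ℕ)).toNat : ℕ) = i := by
      rw [Int.toNat_of_nonneg (sub_nonneg.2 h1)]; push_cast; ring
    simpa only [blk, e] using this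
  · intro h j
    have := j.2
    exact h _ (by push_cast; omega) (by push_cast; omega)

lemma blks_eq_iff {A : Type*} (n k : ℕ) (a a' : ℤ → A) :
    blks n k a = blks n k a' ↔ ∀ i : ℤ, 0 ≤ i → i < (k * n : ℕ) → a i = a' i := by
  rw [funext_iff]
  constructor
  · intro h i h1 h2
    lift i to ℕ using h1
    have h3 : i < k * n := by exact_mod_cast h2
    have hn : 0 < n := Nat.pos_of_ne_zero fun h0 => by simp [h0] at h3
    have h4 := (blk_eq_iff n _ a a').1 (h ⟨i / n, Nat.div_lt_of_lt_mul (by rwa [mul_comm])⟩) i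
    refine h4 ?_ ?_
    · exact_mod_cast Nat.div_mul_le_self i n
    · have := Nat.lt_div_mul_add (a := i) hn
      exact_mod_cast this
  · intro h i
    refine (blk_eq_iff n i a a').2 fun j h1 h2 => h j (by omega) ?_
    have : ((i : ℕ) + 1) * n ≤ k * n := Nat.mul_le_mul_right n i.2
    rw [add_mul, one_mul] at this
    omega

lemma sameInfo_block_fst (n : ℕ) : SameInfo (subfamily (channels b₀ a₀ d₀ η) (seg 0 0 n))
    (fun ω => block n ω.1) := by
  intro ω ω'
  rw [subfamily_channels_eq_iff, block_eq_iff]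
  simp [channels]

lemma sameInfo_block_snd (n : ℕ) : SameInfo (subfamily (channels b₀ a₀ d₀ η) (seg 1 0 n))
    (fun ω => block n ω.2) := by
  intro ω ω'
  rw [subfamily_channels_eq_iff, block_eq_iff]
  simp [channels]

lemma sameInfo_blk_snd (n k : ℕ) : SameInfo
    (subfamily (channels b₀ a₀ d₀ η) (seg 1 (k * n : ℕ) ((k * n : ℕ) + n)))
    (fun ω => blk n k ω.2) := by
  intro ω ω'
  rw [subfamily_channels_eq_iff, blk_eq_iff]
  simp [channels]

lemma sameInfo_blks_snd (n k : ℕ) : SameInfo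
    (subfamily (channels b₀ a₀ d₀ η) (seg 1 0 (k * n : ℕ))) (fun ω => blks n k ω.2) := by
  intro ω ω'
  rw [subfamily_channels_eq_iff, blks_eq_iff]
  simp [channels]

lemma sameInfo_block_third (n : ℕ) : SameInfo (subfamily (channels b₀ a₀ d₀ η) (seg 2 0 n))
    (fun ω => block n (η ω)) := by
  intro ω ω'
  rw [subfamily_channels_eq_iff, block_eq_iff]
  simp [channels]

/-- The coordinates of `b` and `a` generate the whole σ-algebra, so every process on the extension
is determined by them in the limit. This is what lets the supremum in `systemEntropy` be controlled
by the `A`-coordinate alone. -/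
lemma tendsto_increment_channels [IsProbabilityMeasure θ] (hη : IsProcess θ shift₂ η) :
    Tendsto (fun m : ℕ => increment (familyEntropy θ (channels b₀ a₀ d₀ η)) (seg 2 0 1)
      (seg 0 (-m) m ∪ seg 1 (-m) m)) atTop (nhds 0) := by
  have hx := isProcess_channels b₀ a₀ d₀ hη
  have hF : Measurable fun ω => block 1 (η ω) := (measurable_block 1).comp hη.1
  have h1 := tendsto_condEntropy θ hF
    (X := fun j : ℕ => subfamily (channels b₀ a₀ d₀ η) (seg 0 (-j) j ∪ seg 1 (-j) j))
    (fun j => measurable_subfamily' hx _) (id : (ℤ → B) × (ℤ → A) → _) ?_ ?_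
  · rw [condEntropy_eq_zero θ hF] at h1
    refine h1.congr fun m => ?_
    rw [condEntropy_finite θ hF (measurable_subfamily' hx _)]
    exact (increment_familyEntropy hx hF (measurable_subfamily' hx _)
      (sameInfo_block_third b₀ a₀ d₀ 1) (SameInfo.refl _)).symm
  · intro i j hij
    exact comap_subfamily_mono (Finset.union_subset_union
      (seg_subset_seg (by omega) (by omega)) (seg_subset_seg (by omega) (by omega)))
  · rw [MeasurableSpace.comap_id]
    refine le_antisymm (iSup_le fun j => (measurable_subfamily' hx _).comap_le) ?_
    have key : ∀ (c : Fin 3) (i : ℤ), c = 0 ∨ c = 1 → Measurable[⨆ j : ℕ, MeasurableSpace.comap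
        (subfamily (channels b₀ a₀ d₀ η) (seg 0 (-j) j ∪ seg 1 (-j) j)) inferInstance]
        fun ω => channels b₀ a₀ d₀ η c ω i := by
      intro c i hc
      have hi : (c, i) ∈ seg 0 (-(i.natAbs + 1 : ℕ)) (i.natAbs + 1 : ℕ)
          ∪ seg 1 (-(i.natAbs + 1 : ℕ)) (i.natAbs + 1 : ℕ) := by
        rw [Finset.mem_union, mem_seg, mem_seg]
        dsimp only
        rcases hc with rfl | rfl
        · exact Or.inl ⟨rfl, by omega, by omega⟩
        · exact Or.inr ⟨rfl, by omega, by omega⟩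
      exact (measurable_coord_comap_subfamily (channels b₀ a₀ d₀ η) hi).mono
        (le_iSup (fun j : ℕ => MeasurableSpace.comap (subfamily (channels b₀ a₀ d₀ η)
          (seg 0 (-j) j ∪ seg 1 (-j) j)) inferInstance) (i.natAbs + 1)) le_rfl
    set m := ⨆ j : ℕ, MeasurableSpace.comap
        (subfamily (channels b₀ a₀ d₀ η) (seg 0 (-j) j ∪ seg 1 (-j) j)) inferInstance
    refine sup_le ?_ ?_
    · refine measurable_iff_comap_le.1 (@measurable_pi_lambda _ _ _ (m) _ _ fun i => ?_)
      exact measurable_fst.comp (key 0 i (Or.inl rfl))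
    · refine measurable_iff_comap_le.1 (@measurable_pi_lambda _ _ _ (m) _ _ fun i => ?_)
      exact (measurable_fst.comp measurable_snd).comp (key 1 i (Or.inr rfl))

/-- Fekete's lemma supplies the convergence without which `limUnder` is meaningless. The entropies
of the block of `ζ` and of the channel segment agree because both are limits of the same increments.
-/
lemma processEntropy_eq_lim [IsProbabilityMeasure θ]
    (hη : IsProcess θ shift₂ η) {c : Fin 3} {D' : Type*} [Fintype D'] [MeasurableSpace D']
    [DiscreteMeasurableSpace D'] {ζ : (ℤ → B) × (ℤ → A) → ℤ → D'} (hζ : Measurable ζ)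
    (hc : ∀ n : ℕ, SameInfo (subfamily (channels b₀ a₀ d₀ η) (seg c 0 n)) (fun ω => block n (ζ ω)))
    {R : ℝ} (H : StationaryPolymatroid (familyEntropy θ (channels b₀ a₀ d₀ η)) R)
    (hg : IsLimitIncrement (familyEntropy θ (channels b₀ a₀ d₀ η))
      (fun I => condEntropy θ (subfamily (channels b₀ a₀ d₀ η) I) Prod.fst) 0) :
    processEntropy θ ζ Prod.fst = (H.limit_subadditive hg c).lim := by
  refine Tendsto.limUnder_eq ((H.tendsto_limit_div hg c).congr fun n => ?_)
  congr 1
  exact tendsto_nhds_unique (hg (seg c 0 n))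
    (tendsto_increment_familyEntropy (isProcess_channels b₀ a₀ d₀ hη)
      ((measurable_block n).comp hζ) (hc n) 0 Prod.fst (comap_channels_zero b₀ a₀ d₀))

omit [DiscreteMeasurableSpace A] [DiscreteMeasurableSpace B] [Fintype A] [Fintype B] in
lemma nonempty_alphabets (θ : Measure ((ℤ → B) × (ℤ → A))) [IsProbabilityMeasure θ] :
    Nonempty B ∧ Nonempty A := by
  obtain ⟨ω⟩ := nonempty_of_isProbabilityMeasure θ
  exact ⟨⟨ω.1 0⟩, ⟨ω.2 0⟩⟩

/-- The entropy of an extension is at most any of the conditional block entropies of its second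
coordinate process. -/
theorem systemEntropy_le [IsProbabilityMeasure θ] (hθ : MeasurePreserving shift₂ θ θ)
    {n : ℕ} (hn : 0 < n) (k N : ℕ) :
    systemEntropy θ shift₂ (Prod.fst : (ℤ → B) × (ℤ → A) → (ℤ → B)) ≤
      (((entropy θ (fun ω => (blk n k ω.2, block N ω.1, blks n k ω.2))
        - entropy θ (fun ω => (block N ω.1, blks n k ω.2))) / n : ℝ) : EReal) := by
  obtain ⟨⟨b₀⟩, ⟨a₀⟩⟩ := nonempty_alphabets θ
  refine iSup_le fun q => iSup_le fun η => iSup_le fun hη => ?_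
  obtain ⟨ω⟩ := nonempty_of_isProbabilityMeasure θ
  have d₀ : Fin q := η ω 0
  have : Nonempty (B × A × Fin q) := ⟨(b₀, a₀, d₀)⟩
  have hx := isProcess_channels b₀ a₀ d₀ hη
  have H := stationaryPolymatroid_familyEntropy hθ hx
  have hg := isLimitIncrement_familyEntropy hx 0 Prod.fst (comap_channels_zero b₀ a₀ d₀)
  rw [processEntropy_eq_lim b₀ a₀ d₀ hη hη.1 (sameInfo_block_third b₀ a₀ d₀) H hg]
  -- With `p = k * n`, the `n` symbols after time `p` form the `k`-th block and the earlier ones the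
  -- first `k` blocks.
  have h1 := H.lim_le_increment hg 1 2 (tendsto_increment_channels b₀ a₀ d₀ hη) (p := k * n)
    (N := N) hn
  rw [increment_familyEntropy hx (F := fun ω => blk n k ω.2)
    (Z := fun ω => (block N ω.1, blks n k ω.2)) ((measurable_blk n k).comp measurable_snd)
    (((measurable_block N).comp measurable_fst).prodMk ((measurable_blks n k).comp measurable_snd))
    (sameInfo_blk_snd b₀ a₀ d₀ n k)
    ((sameInfo_block_fst b₀ a₀ d₀ N).subfamily_union (sameInfo_blks_snd b₀ a₀ d₀ n k))] at h1
  exact_mod_cast h1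

/-- The entropy of an extension bounds the conditional entropies of long blocks given the
simultaneous blocks of the factor. -/
theorem exists_le_systemEntropy [IsProbabilityMeasure θ] (hθ : MeasurePreserving shift₂ θ θ) :
    ∃ L : ℝ, (L : EReal) ≤ systemEntropy θ shift₂ (Prod.fst : (ℤ → B) × (ℤ → A) → (ℤ → B)) ∧
      ∀ s > 0, ∀ᶠ n : ℕ in atTop, entropy θ (fun ω => (block n ω.2, block n ω.1))
        - entropy θ (fun ω => block n ω.1) ≤ n * (L + s) := by
  obtain ⟨⟨b₀⟩, ⟨a₀⟩⟩ := nonempty_alphabets θ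
  -- The supremum defining `systemEntropy` ranges over alphabets `Fin k`, so the coordinate process
  -- has to be recoded.
  let e := Fintype.equivFin A
  set η : (ℤ → B) × (ℤ → A) → ℤ → Fin (Fintype.card A) := fun ω i => e (ω.2 i) with hη'
  have hη : IsProcess θ shift₂ η := by
    refine ⟨measurable_pi_lambda _ fun i => ?_, ae_of_all _ fun ω => rfl⟩
    exact (measurable_of_countable e).comp ((measurable_pi_apply i).comp measurable_snd)
  have d₀ : Fin (Fintype.card A) := e a₀
  have : Nonempty (B × A × Fin (Fintype.card A)) := ⟨(b₀, a₀, d₀)⟩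
  have hx := isProcess_channels b₀ a₀ d₀ hη
  have H := stationaryPolymatroid_familyEntropy hθ hx
  have hg := isLimitIncrement_familyEntropy hx 0 Prod.fst (comap_channels_zero b₀ a₀ d₀)
  have hc : ∀ n : ℕ, SameInfo (subfamily (channels b₀ a₀ d₀ η) (seg 1 0 n))
      (fun ω => block n (η ω)) := by
    intro n ω ω'
    rw [subfamily_channels_eq_iff, block_eq_iff]
    simp [channels, hη']
  refine ⟨(H.limit_subadditive hg 1).lim, ?_, fun s hs => ?_⟩
  · rw [← processEntropy_eq_lim b₀ a₀ d₀ hη hη.1 hc H hg]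
    exact le_iSup_of_le (Fintype.card A) (le_iSup_of_le η (le_iSup_of_le hη le_rfl))
  · filter_upwards [H.eventually_increment_le hg 1 hs] with n hn
    rwa [increment_familyEntropy hx (F := fun ω => block n ω.2)
      (Z := fun ω => block n ω.1) ((measurable_block n).comp measurable_snd)
      ((measurable_block n).comp measurable_fst)
      (sameInfo_block_snd b₀ a₀ d₀ n) (sameInfo_block_fst b₀ a₀ d₀ n)] at hn

end Ext

/-! ### Transport between families of mass functions -/

section Transport

variable {V Z Z' Y : Type*} [Fintype V] [Fintype Z] [Fintype Z'] [Fintype Y]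

/-- The family `P` of mass functions on `V` can be transported to the family `R` at total cost at
most `t`. -/
def Transports (d : V → V → ℝ) (P R : Z → V → ℝ) (t : ℝ) : Prop :=
  ∃ c : Z → V → V → ℝ, (∀ z v w, 0 ≤ c z v w) ∧ (∀ z v, ∑ w, c z v w = P z v) ∧
    (∀ z w, ∑ v, c z v w = R z w) ∧ ∑ z, ∑ v, ∑ w, c z v w * d v w ≤ t

variable {d : V → V → ℝ} {P Q R : Z → V → ℝ} {t u : ℝ}

lemma Transports.mono (h : Transports d P Q t) (htu : t ≤ u) : Transports d P Q u := by
  obtain ⟨c, h1, h2, h3, h4⟩ := h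
  exact ⟨c, h1, h2, h3, h4.trans htu⟩

lemma Transports.symm (hd : ∀ v w, d v w = d w v) (h : Transports d P Q t) :
    Transports d Q P t := by
  obtain ⟨c, h1, h2, h3, h4⟩ := h
  refine ⟨fun z v w => c z w v, fun z v w => h1 z w v, h3, h2, h4.trans' (le_of_eq ?_)⟩
  refine Finset.sum_congr rfl fun z _ => ?_
  rw [Finset.sum_comm]
  exact Finset.sum_congr rfl fun v _ => Finset.sum_congr rfl fun w _ => by rw [hd]

lemma sum_mul_div_cancel {a : V → ℝ} {b m : ℝ} (ha : ∑ w, a w = m) (hb : m = 0 → b = 0) :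
    ∑ w, b * a w / m = b := by
  rw [← Finset.sum_div, ← Finset.mul_sum, ha]
  by_cases h0 : m = 0
  · rw [hb h0]; simp
  · field_simp

/-- Gluing: make the two couplings conditionally independent over the middle mass `Q`. Rows and
columns where `Q` vanishes carry no mass, so dividing by `Q` is safe. -/
lemma Transports.trans (htri : ∀ v w x, d v x ≤ d v w + d w x) (h : Transports d P Q t)
    (h' : Transports d Q R u) : Transports d P R (t + u) := by
  obtain ⟨c, h1, h2, h3, h4⟩ := h
  obtain ⟨c', h1', h2', h3', h4'⟩ := h'
  have hQ : ∀ z w, 0 ≤ Q z w := fun z w => h3 z w ▸ Finset.sum_nonneg fun v _ => h1 z v w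
  have hz : ∀ z v w, Q z w = 0 → c z v w = 0 := by
    intro z v w h0
    have := h3 z w
    rw [h0, Finset.sum_eq_zero_iff_of_nonneg fun v _ => h1 z v w] at this
    exact this v (Finset.mem_univ v)
  have hz' : ∀ z w x, Q z w = 0 → c' z w x = 0 := by
    intro z w x h0
    have := h2' z w
    rw [h0, Finset.sum_eq_zero_iff_of_nonneg fun v _ => h1' z w v] at this
    exact this x (Finset.mem_univ x)
  have hx : ∀ z v w, ∑ x, c z v w * c' z w x / Q z w = c z v w := fun z v w =>
    sum_mul_div_cancel (h2' z w) (hz z v w)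
  have hv : ∀ z w x, ∑ v, c z v w * c' z w x / Q z w = c' z w x := by
    intro z w x
    simp_rw [mul_comm (c z _ w)]
    exact sum_mul_div_cancel (h3 z w) (hz' z w x)
  refine ⟨fun z v x => ∑ w, c z v w * c' z w x / Q z w, fun z v x => Finset.sum_nonneg fun w _ =>
    div_nonneg (mul_nonneg (h1 z v w) (h1' z w x)) (hQ z w), fun z v => ?_, fun z x => ?_, ?_⟩
  · rw [Finset.sum_comm, ← h2]
    exact Finset.sum_congr rfl fun w _ => hx z v w
  · rw [Finset.sum_comm, ← h3']
    exact Finset.sum_congr rfl fun w _ => hv z w x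
  refine le_trans ?_ (add_le_add h4 h4')
  rw [← Finset.sum_add_distrib]
  refine Finset.sum_le_sum fun z _ => ?_
  have e1 : ∑ v, ∑ w, c z v w * d v w
      = ∑ v, ∑ w, ∑ x, c z v w * c' z w x / Q z w * d v w := by
    refine Finset.sum_congr rfl fun v _ => Finset.sum_congr rfl fun w _ => ?_
    rw [← Finset.sum_mul, hx]
  have e2 : ∑ w, ∑ x, c' z w x * d w x
      = ∑ v, ∑ w, ∑ x, c z v w * c' z w x / Q z w * d w x := by
    rw [Finset.sum_comm (s := (Finset.univ : Finset V)) (f := fun v w => ∑ x, _)]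
    refine Finset.sum_congr rfl fun w _ => ?_
    rw [Finset.sum_comm (f := fun v x => c z v w * c' z w x / Q z w * d w x)]
    refine Finset.sum_congr rfl fun x _ => ?_
    rw [← Finset.sum_mul, hv]
  rw [e1, e2, ← Finset.sum_add_distrib]
  refine Finset.sum_le_sum fun v _ => ?_
  simp_rw [Finset.sum_mul]
  rw [Finset.sum_comm, ← Finset.sum_add_distrib]
  refine Finset.sum_le_sum fun w _ => ?_
  rw [← Finset.sum_add_distrib]
  refine Finset.sum_le_sum fun x _ => ?_
  rw [← mul_add]
  exact mul_le_mul_of_nonneg_left (htri v w x)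
    (div_nonneg (mul_nonneg (h1 z v w) (h1' z w x)) (hQ z w))

open Classical in
lemma sum_comp_mul_le {f : Z' → Z} {W : Z' → ℝ} (hW : ∀ z, ∑ z', (if f z' = z then W z' else 0) ≤ 1)
    {K : Z → ℝ} (hK : ∀ z, 0 ≤ K z) : ∑ z', W z' * K (f z') ≤ ∑ z, K z := by
  have h1 : ∑ z', W z' * K (f z') = ∑ z, ∑ z', (if f z' = z then W z' else 0) * K z := by
    rw [Finset.sum_comm]
    refine Finset.sum_congr rfl fun z' _ => ?_
    simp
  rw [h1]
  refine Finset.sum_le_sum fun z _ => ?_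
  rw [← Finset.sum_mul]
  exact mul_le_of_le_one_left (hK z) (hW z)

open Classical in
-- Every `z'` receives the fraction `W z'` of the coupling at `f z'`. The fractions in a fibre total
-- at most 1 and the costs are nonnegative, so the total cost does not rise. In the chain
-- construction this distributes a coupling indexed by one past over pairs of pasts.
lemma Transports.comap (hd : ∀ v w, 0 ≤ d v w) (h : Transports d P Q t) (f : Z' → Z) {W : Z' → ℝ}
    (hW0 : ∀ z', 0 ≤ W z') (hW : ∀ z, ∑ z', (if f z' = z then W z' else 0) ≤ 1) :
    Transports d (fun z' v => W z' * P (f z') v) (fun z' v => W z' * Q (f z') v) t := by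
  obtain ⟨c, h1, h2, h3, h4⟩ := h
  refine ⟨fun z' v w => W z' * c (f z') v w, fun z' v w => mul_nonneg (hW0 _) (h1 _ _ _),
    fun z' v => by rw [← Finset.mul_sum, h2], fun z' v => by rw [← Finset.mul_sum, h3],
    h4.trans' ?_⟩
  refine le_trans (le_of_eq ?_) (sum_comp_mul_le hW (K := fun z => ∑ v, ∑ w, c z v w * d v w)
    fun z => Finset.sum_nonneg fun v _ => Finset.sum_nonneg fun w _ => mul_nonneg (h1 _ _ _) (hd _ _))
  refine Finset.sum_congr rfl fun z' _ => ?_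
  simp_rw [Finset.mul_sum, mul_assoc]

lemma Transports.reindex (h : Transports d P Q t) (e : Z' ≃ Z) :
    Transports d (fun z' => P (e z')) (fun z' => Q (e z')) t := by
  obtain ⟨c, h1, h2, h3, h4⟩ := h
  refine ⟨fun z' => c (e z'), fun z' => h1 _, fun z' => h2 _, fun z' => h3 _, ?_⟩
  rwa [Equiv.sum_comp e (fun z => ∑ v, ∑ w, c z v w * d v w)]

/-- Transport along the maximal coupling. -/
lemma transports_of_sum_abs_sub (hd1 : ∀ v w, d v w ≤ 1) (hd0 : ∀ v, d v v = 0)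
    (hP : ∀ z v, 0 ≤ P z v) (hQ : ∀ z v, 0 ≤ Q z v) (hPQ : ∀ z, ∑ v, P z v = ∑ v, Q z v) :
    Transports d P Q (∑ z, ∑ v, |P z v - Q z v|) := by
  classical
  set m : Z → V → ℝ := fun z v => min (P z v) (Q z v) with hm
  set s : Z → ℝ := fun z => ∑ v, (P z v - m z v) with hs
  have hs' : ∀ z, s z = ∑ v, (Q z v - m z v) := by
    intro z; rw [hs]; simp only [Finset.sum_sub_distrib, hPQ]
  have hPm : ∀ z v, 0 ≤ P z v - m z v := fun z v => sub_nonneg.2 (min_le_left _ _)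
  have hQm : ∀ z v, 0 ≤ Q z v - m z v := fun z v => sub_nonneg.2 (min_le_right _ _)
  have hs0 : ∀ z, 0 ≤ s z := fun z => Finset.sum_nonneg fun v _ => hPm z v
  have hp : ∀ z v, ∑ w, (P z v - m z v) * (Q z w - m z w) / s z = P z v - m z v := by
    intro z v
    refine sum_mul_div_cancel (hs' z).symm fun h0 => ?_
    rw [hs, Finset.sum_eq_zero_iff_of_nonneg fun v _ => hPm z v] at h0
    exact h0 v (Finset.mem_univ v)
  have hq : ∀ z w, ∑ v, (P z v - m z v) * (Q z w - m z w) / s z = Q z w - m z w := by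
    intro z w
    simp_rw [mul_comm (P z _ - m z _)]
    refine sum_mul_div_cancel rfl fun h0 => ?_
    have h0' := (hs' z).symm.trans h0
    rw [Finset.sum_eq_zero_iff_of_nonneg fun v _ => hQm z v] at h0'
    exact h0' w (Finset.mem_univ w)
  -- The common mass stays in place and the two excesses, of equal total `s z`, are coupled
  -- independently. Only the excess of `P` is charged, and it is at most `|P - Q|` pointwise.
  refine ⟨fun z v w => (if v = w then m z v else 0) + (P z v - m z v) * (Q z w - m z w) / s z,
    fun z v w => ?_, fun z v => ?_, fun z w => ?_, ?_⟩
  · refine add_nonneg ?_ (div_nonneg (mul_nonneg (hPm z v) (hQm z w)) (hs0 z))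
    split_ifs
    · exact le_min (hP z v) (hQ z v)
    · exact le_rfl
  · rw [Finset.sum_add_distrib, hp]; simp
  · rw [Finset.sum_add_distrib, hq]; simp
  · refine Finset.sum_le_sum fun z _ => Finset.sum_le_sum fun v _ => ?_
    have h1 : ∀ w, ((if v = w then m z v else 0) + (P z v - m z v) * (Q z w - m z w) / s z) * d v w
        ≤ (P z v - m z v) * (Q z w - m z w) / s z := by
      intro w
      have h2 : 0 ≤ (P z v - m z v) * (Q z w - m z w) / s z :=
        div_nonneg (mul_nonneg (hPm z v) (hQm z w)) (hs0 z)
      split_ifs with h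
      · subst h; rw [hd0, mul_zero]; exact h2
      · rw [zero_add]; exact mul_le_of_le_one_right h2 (hd1 _ _)
    refine (Finset.sum_le_sum fun w _ => h1 w).trans ?_
    rw [hp]
    rcases le_total (P z v) (Q z v) with h | h
    · simp [hm, min_eq_left h]
    · simp only [hm, min_eq_right h]; exact le_abs_self _

/-- The log-sum inequality. -/
lemma sum_mul_log_sum_div_le {a b : V → ℝ} (ha : ∀ v, 0 ≤ a v) (hb : ∀ v, 0 ≤ b v)
    (hab : ∀ v, b v = 0 → a v = 0) :
    (∑ v, a v) * Real.log ((∑ v, a v) / ∑ v, b v) ≤ ∑ v, a v * Real.log (a v / b v) := by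
  rcases (Finset.sum_nonneg fun v _ => ha v : 0 ≤ ∑ v, a v).eq_or_lt with h0 | hA
  · have : ∀ v, a v = 0 := fun v => by
      have h1 := h0.symm
      rw [Finset.sum_eq_zero_iff_of_nonneg fun v _ => ha v] at h1
      exact h1 v (Finset.mem_univ v)
    simp [this]
  have hB : 0 < ∑ v, b v := by
    refine (Finset.sum_nonneg fun v _ => hb v).lt_of_ne fun h0 => hA.ne' ?_
    have h1 := h0.symm
    rw [Finset.sum_eq_zero_iff_of_nonneg fun v _ => hb v] at h1
    exact Finset.sum_eq_zero fun v hv => hab v (h1 v hv)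
  -- Apply `log x ≤ x - 1` at `x = τ b / a`; with this ratio `τ` the linear terms cancel after
  -- summation.
  set τ := (∑ v, a v) / ∑ v, b v with hτ
  have hτ0 : 0 < τ := div_pos hA hB
  have key : ∀ v, a v * Real.log τ + a v - τ * b v ≤ a v * Real.log (a v / b v) := by
    intro v
    rcases (ha v).eq_or_lt with h0 | h0
    · rw [← h0]; simp; exact mul_nonneg hτ0.le (hb v)
    have hb0 : 0 < b v := (hb v).lt_of_ne fun h => h0.ne' (hab v h.symm)
    have h1 := Real.log_le_sub_one_of_pos (x := τ * b v / a v) (by positivity)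
    rw [Real.log_div (by positivity) h0.ne', Real.log_mul hτ0.ne' hb0.ne'] at h1
    have h2 := mul_le_mul_of_nonneg_left h1 h0.le
    have e : a v * (τ * b v / a v - 1) = τ * b v - a v := by field_simp
    rw [e] at h2
    rw [Real.log_div h0.ne' hb0.ne']
    linarith
  refine le_trans (le_of_eq ?_) (Finset.sum_le_sum fun v _ => key v)
  rw [Finset.sum_sub_distrib, Finset.sum_add_distrib, ← Finset.sum_mul, ← Finset.mul_sum, hτ,
    div_mul_cancel₀ _ hB.ne']
  ring

/-- Total mass of a row. -/
def rowSum (P : Z → V → ℝ) (z : Z) : ℝ := ∑ v, P z v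

/-- The finite form of extremality, for unnormalized mixtures. -/
def FinExtremal (d : V → V → ℝ) (p : V → ℝ) (κ r : ℝ) : Prop :=
  ∀ (m : ℕ) (g : Fin m → V → ℝ), (∀ i v, 0 ≤ g i v) → ∀ M : ℝ, 0 ≤ M →
    (∀ v, ∑ i, g i v = M * p v) → ∀ δ > 0,
    Transports d g (fun i v => rowSum g i * p v)
      ((∑ i, ∑ v, g i v * Real.log (g i v / (rowSum g i * p v))) / κ + M * (r + δ))

lemma FinExtremal.transports {p : V → ℝ} {κ r : ℝ} (h : FinExtremal d p κ r) {g : Z → V → ℝ}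
    (hg : ∀ i v, 0 ≤ g i v) {M : ℝ} (hM : 0 ≤ M) (hsum : ∀ v, ∑ i, g i v = M * p v) {δ : ℝ}
    (hδ : 0 < δ) : Transports d g (fun i v => rowSum g i * p v)
      ((∑ i, ∑ v, g i v * Real.log (g i v / (rowSum g i * p v))) / κ + M * (r + δ)) := by
  let e := Fintype.equivFin Z
  have h1 := (h _ (fun i => g (e.symm i)) (fun i => hg _) M hM (fun v => by
    rw [← hsum v, Equiv.sum_comp e.symm (fun z => g z v)]) δ hδ).reindex e
  have h3 := Equiv.sum_comp e.symm
    (fun i => ∑ v, g i v * Real.log (g i v / (rowSum g i * p v)))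
  rw [← h3]
  have h4 : ∀ i, rowSum (fun i => g (e.symm i)) i = rowSum g (e.symm i) := fun i => rfl
  simpa only [e.symm_apply_apply, h4] using h1

open Classical in
/-- Transport of the conditional distributions given a finer partition to the nearby conditional
distributions given a coarser one. -/
theorem transports_of_finExtremal (hd : ∀ v w, 0 ≤ d v w) (hd1 : ∀ v w, d v w ≤ 1)
    (hd0 : ∀ v, d v v = 0) (htri : ∀ v w x, d v x ≤ d v w + d w x) (f : Z → Y)
    (hQ : ∀ z v, 0 ≤ Q z v) {q : Y → V → ℝ}
    (hq : ∀ y v, q y v = ∑ z, if f z = y then Q z v else 0) {ν : Y → ℝ}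
    (hν : ∀ y, ∑ v, q y v = ν y) {η : Y → V → ℝ} (hη : ∀ y v, 0 ≤ η y v)
    (hη1 : ∀ y, ∑ v, η y v = 1) {κ : ℝ} (hκ : 0 < κ) {ρ : Y → ℝ}
    (hext : ∀ y, FinExtremal d (η y) κ (ρ y)) {δ : ℝ} (hδ : 0 < δ) :
    Transports d Q (fun z w => rowSum Q z * η (f z) w)
      ((∑ y, ∑ v, |q y v - ν y * η y v|)
        + ((∑ z, ∑ v, Q z v * Real.log (Q z v * ν (f z) / (rowSum Q z * q (f z) v))) / κ
        + ∑ y, ν y * (ρ y + δ))) := by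
  have hq0 : ∀ y v, 0 ≤ q y v := fun y v => by
    rw [hq]; exact Finset.sum_nonneg fun z _ => by split_ifs; exacts [hQ z v, le_rfl]
  have hν0 : ∀ y, 0 ≤ ν y := fun y => hν y ▸ Finset.sum_nonneg fun v _ => hq0 y v
  have hQq : ∀ z v, Q z v ≤ q (f z) v := by
    intro z v
    rw [hq]
    have := Finset.single_le_sum (f := fun z' => if f z' = f z then Q z' v else 0)
      (fun z' _ => by split_ifs; exacts [hQ z' v, le_rfl]) (Finset.mem_univ z)
    simpa using this
  obtain ⟨c, h1, h2, h3, h4⟩ := transports_of_sum_abs_sub (P := q)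
    (Q := fun y v => ν y * η y v) hd1 hd0 hq0 (fun y v => mul_nonneg (hν0 y) (hη y v))
    (fun y => by rw [hν, ← Finset.mul_sum, hη1, mul_one])
  replace h3 : ∀ y w, ∑ v, c y v w = ν y * η y w := h3
  have hc0 : ∀ y v w, q y v = 0 → c y v w = 0 := by
    intro y v w h0
    have := h2 y v
    rw [h0, Finset.sum_eq_zero_iff_of_nonneg fun w _ => h1 y v w] at this
    exact this w (Finset.mem_univ w)
  -- A joint mass on `(z, v, w)`: given `v` and the fibre, `w` is drawn from the maximal coupling
  -- `c` independently of `z`. Its `(z, v)`-marginal is `Q`, and its `(z, w)`-marginal is the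
  -- corrected family `G`.
  set L : Z → V → V → ℝ := fun z v w => Q z v * c (f z) v w / q (f z) v with hL
  have hL0 : ∀ z v w, 0 ≤ L z v w := fun z v w =>
    div_nonneg (mul_nonneg (hQ z v) (h1 _ _ _)) (hq0 _ _)
  set G : Z → V → ℝ := fun z w => ∑ v, L z v w with hG
  have hG0 : ∀ z w, 0 ≤ G z w := fun z w => Finset.sum_nonneg fun v _ => hL0 z v w
  have hLsum : ∀ z v, ∑ w, L z v w = Q z v := fun z v => sum_mul_div_cancel (h2 _ _) fun h0 =>
    le_antisymm (h0 ▸ hQq z v) (hQ z v)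
  have hLfib : ∀ y v w, ∑ z, (if f z = y then L z v w else 0) = c y v w := by
    intro y v w
    have e : ∀ z, (if f z = y then L z v w else 0)
        = c y v w * (if f z = y then Q z v else 0) / q y v := by
      intro z
      split_ifs with h
      · simp only [hL, h]; ring
      · simp
    simp_rw [e]
    exact sum_mul_div_cancel (hq y v).symm (hc0 y v w)
  have hrow : ∀ z, rowSum G z = rowSum Q z := by
    intro z
    simp only [rowSum, hG]
    rw [Finset.sum_comm]
    exact Finset.sum_congr rfl fun v _ => hLsum z v
  have first : Transports d Q G (∑ y, ∑ v, |q y v - ν y * η y v|) := by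
    refine ⟨L, hL0, hLsum, fun z w => rfl, h4.trans' (le_of_eq ?_)⟩
    have e : ∀ z, ∑ v, ∑ w, L z v w * d v w
        = ∑ y, ∑ v, ∑ w, (if f z = y then L z v w else 0) * d v w := by
      intro z
      rw [Finset.sum_eq_single (f z) (by
        intro y _ hy
        simp [hy.symm]) (by simp)]
      simp
    simp_rw [e]
    rw [Finset.sum_comm]
    refine Finset.sum_congr rfl fun y _ => ?_
    rw [Finset.sum_comm]
    refine Finset.sum_congr rfl fun v _ => ?_
    rw [Finset.sum_comm]
    refine Finset.sum_congr rfl fun w _ => ?_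
    rw [← Finset.sum_mul, hLfib]
  -- Over each `y` the rows of `G` add up exactly to `ν y * η y`, which those of `Q` need not do.
  -- This makes them a mixture to which extremality of `η y` applies.
  have second : Transports d G (fun z w => rowSum Q z * η (f z) w)
      ((∑ z, ∑ w, G z w * Real.log (G z w / (rowSum Q z * η (f z) w))) / κ
        + ∑ y, ν y * (ρ y + δ)) := by
    have hy : ∀ y, Transports d (fun z w => if f z = y then G z w else 0) _ _ := fun y =>
      (hext y).transports (g := fun z w => if f z = y then G z w else 0)
        (fun z w => by split_ifs; exacts [hG0 z w, le_rfl]) (hν0 y) (fun w => by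
          rw [← h3 y w]
          have : ∀ z, (if f z = y then G z w else 0) = ∑ v, if f z = y then L z v w else 0 := by
            intro z; split_ifs <;> simp [hG]
          simp_rw [this]
          rw [Finset.sum_comm]
          exact Finset.sum_congr rfl fun v _ => hLfib y v w) hδ
    choose C hC1 hC2 hC3 hC4 using hy
    refine ⟨fun z => C (f z) z, fun z => hC1 _ z, fun z v => by simp [hC2], fun z w => ?_, ?_⟩
    · rw [hC3]
      congr 1
      rw [← hrow z]
      simp [rowSum]
    have hcost : ∀ y z, 0 ≤ ∑ v, ∑ w, C y z v w * d v w := fun y z =>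
      Finset.sum_nonneg fun v _ => Finset.sum_nonneg fun w _ => mul_nonneg (hC1 _ _ _ _) (hd _ _)
    calc ∑ z, ∑ v, ∑ w, C (f z) z v w * d v w
        ≤ ∑ z, ∑ y, ∑ v, ∑ w, C y z v w * d v w := Finset.sum_le_sum fun z _ =>
          Finset.single_le_sum (f := fun y => ∑ v, ∑ w, C y z v w * d v w)
            (fun y _ => hcost y z) (Finset.mem_univ (f z))
      _ = ∑ y, ∑ z, ∑ v, ∑ w, C y z v w * d v w := Finset.sum_comm
      _ ≤ _ := Finset.sum_le_sum fun y _ => hC4 y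
      _ = _ := ?_
    rw [Finset.sum_add_distrib, ← Finset.sum_div, Finset.sum_comm]
    congr 2
    refine Finset.sum_congr rfl fun z _ => ?_
    rw [Finset.sum_eq_single (f z) (by
        intro y _ hy
        simp [hy.symm]) (by simp)]
    refine Finset.sum_congr rfl fun w _ => ?_
    have : rowSum (fun z' w => if f z' = f z then G z' w else 0) z = rowSum Q z := by
      rw [← hrow z]; simp [rowSum]
    rw [this]
    simp
  -- What remains is data processing: `G` arises from `Q` by a channel that depends only on the
  -- fibre, so its divergence is no larger. The log-sum inequality with reference masses `M / ν y *
  -- c y v w` proves this row by row.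
  refine (first.trans htri second).mono (add_le_add le_rfl (add_le_add ?_ le_rfl))
  refine div_le_div_of_nonneg_right (Finset.sum_le_sum fun z _ => ?_) hκ.le
  set y := f z with hy
  set M := rowSum Q z with hM
  have hM0 : 0 ≤ M := Finset.sum_nonneg fun v _ => hQ z v
  by_cases hMz : M = 0
  · have hQz : ∀ v, Q z v = 0 := fun v => by
      rw [hM, rowSum, Finset.sum_eq_zero_iff_of_nonneg fun v _ => hQ z v] at hMz
      exact hMz v (Finset.mem_univ v)
    simp [hG, hL, hQz]
  have hMpos : 0 < M := hM0.lt_of_ne (Ne.symm hMz)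
  have hMν : M ≤ ν y := by
    rw [hM, rowSum, ← hν]
    exact Finset.sum_le_sum fun v _ => hQq z v
  have hνpos : 0 < ν y := hMpos.trans_le hMν
  calc ∑ w, G z w * Real.log (G z w / (M * η y w))
      ≤ ∑ w, ∑ v, L z v w * Real.log (Q z v * ν y / (M * q y v)) := by
        refine Finset.sum_le_sum fun w _ => ?_
        have h5 := sum_mul_log_sum_div_le (a := fun v => L z v w)
          (b := fun v => M / ν y * c y v w) (fun v => hL0 z v w)
          (fun v => mul_nonneg (div_nonneg hM0 hνpos.le) (h1 _ _ _)) (fun v h0 => by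
            have : c y v w = 0 := (mul_eq_zero.1 h0).resolve_left (div_pos hMpos hνpos).ne'
            simp [hL, ← hy, this])
        rw [← Finset.mul_sum, h3] at h5
        have e1 : M / ν y * (ν y * η y w) = M * η y w := by field_simp
        rw [e1] at h5
        refine h5.trans (Finset.sum_le_sum fun v _ => ?_)
        rcases (hL0 z v w).eq_or_lt with h0 | h0
        · rw [← h0]; simp
        refine le_of_eq ?_
        congr 2
        have hcv : c y v w ≠ 0 := fun h => h0.ne' (by simp [hL, ← hy, h])
        have hqv : q y v ≠ 0 := fun h => hcv (hc0 y v w h)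
        simp only [hL, ← hy]
        field_simp
    _ = ∑ v, Q z v * Real.log (Q z v * ν y / (M * q y v)) := by
        rw [Finset.sum_comm]
        refine Finset.sum_congr rfl fun v _ => ?_
        rw [← Finset.sum_mul, hLsum]

end Transport

/-! ### Extremality of measures on finite spaces -/

section FiniteMeasures

variable {V : Type*} [Fintype V] [MeasurableSpace V] [MeasurableSingletonClass V]

/-- The measure on a finite set with given point masses. -/
def ofMass (f : V → ℝ) : Measure V := ∑ v, ENNReal.ofReal (f v) • Measure.dirac v

lemma ofMass_singleton (f : V → ℝ) (v : V) : ofMass f {v} = ENNReal.ofReal (f v) := by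
  classical
  simp only [ofMass, Measure.coe_finsetSum, Finset.sum_apply, Measure.smul_apply, smul_eq_mul]
  rw [Finset.sum_eq_single v]
  · simp
  · intro w _ hw
    rw [Measure.dirac_apply' _ (measurableSet_singleton v)]
    simp [hw]
  · simp

lemma ofMass_univ {f : V → ℝ} (hf : ∀ v, 0 ≤ f v) :
    ofMass f Set.univ = ENNReal.ofReal (∑ v, f v) := by
  rw [ENNReal.ofReal_sum_of_nonneg fun v _ => hf v]
  simp [ofMass]

lemma isProbabilityMeasure_ofMass {f : V → ℝ} (hf : ∀ v, 0 ≤ f v) (hf1 : ∑ v, f v = 1) :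
    IsProbabilityMeasure (ofMass f) := ⟨by rw [ofMass_univ hf, hf1, ENNReal.ofReal_one]⟩

lemma ofMass_real_singleton {f : V → ℝ} (hf : ∀ v, 0 ≤ f v) (v : V) :
    (ofMass f).real {v} = f v := by
  rw [measureReal_def, ofMass_singleton, ENNReal.toReal_ofReal (hf v)]

/-- The correction by total masses in `klDiv` cancels for probability measures, and at a point of
positive mass the Radon–Nikodym derivative is the ratio of the masses. -/
lemma klDiv_eq_sum (μ ν : Measure V) [IsProbabilityMeasure μ] [IsProbabilityMeasure ν]
    (h : ∀ v, ν.real {v} = 0 → μ.real {v} = 0) :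
    InformationTheory.klDiv μ ν
      = ENNReal.ofReal (∑ v, μ.real {v} * Real.log (μ.real {v} / ν.real {v})) := by
  have hac : μ ≪ ν := by
    intro s hs
    rw [← Set.biUnion_of_singleton s]
    refine (measure_biUnion_null_iff s.to_countable).2 fun v hv => ?_
    have h1 : ν.real {v} = 0 := by
      rw [measureReal_def, measure_mono_null (Set.singleton_subset_iff.2 hv) hs]; simp
    exact (measureReal_eq_zero_iff).1 (h v h1)
  rw [InformationTheory.klDiv_of_ac_of_integrable hac Integrable.of_finite,
    integral_fintype Integrable.of_finite]
  congr 1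
  simp only [probReal_univ, add_sub_cancel_right]
  refine Finset.sum_congr rfl fun v _ => ?_
  rw [smul_eq_mul]
  by_cases h0 : ν.real {v} = 0
  · simp [h v h0]
  congr 2
  have h1 := Measure.setLIntegral_rnDeriv hac {v}
  rw [lintegral_singleton] at h1
  rw [measureReal_def μ, ← h1, ENNReal.toReal_mul]
  change Real.log _ = Real.log (_ * ν.real {v} / ν.real {v})
  rw [mul_div_cancel_right₀ _ h0]

lemma sum_sum_real_singleton_mul (γ : Measure (V × V)) [IsFiniteMeasure γ] {d : V → V → ℝ}
    (hd : ∀ v w, 0 ≤ d v w) : ∫⁻ p, ENNReal.ofReal (d p.1 p.2) ∂γ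
      = ENNReal.ofReal (∑ v, ∑ w, γ.real {(v, w)} * d v w) := by
  rw [lintegral_fintype, ← Fintype.sum_prod_type', ENNReal.ofReal_sum_of_nonneg
    fun p _ => mul_nonneg measureReal_nonneg (hd _ _)]
  refine Finset.sum_congr rfl fun p _ => ?_
  rw [ENNReal.ofReal_mul measureReal_nonneg, ofReal_measureReal, mul_comm]

/-- The product coupling shows that the distance is at most 1, hence finite. No attainment of the
infimum is used, which is the origin of the slack `δ` throughout. -/
lemma exists_coupling (d : V → V → ℝ) (hd : ∀ v w, 0 ≤ d v w) (hd1 : ∀ v w, d v w ≤ 1)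
    (μ ν : Measure V) [IsProbabilityMeasure μ] [IsProbabilityMeasure ν] {δ : ℝ} (hδ : 0 < δ) :
    ∃ t : ℝ, 0 ≤ t ∧ transportDist d μ ν = ENNReal.ofReal t ∧ ∃ γ : Measure (V × V),
      (∀ v, ∑ w, γ.real {(v, w)} = μ.real {v}) ∧ (∀ w, ∑ v, γ.real {(v, w)} = ν.real {w}) ∧
      ∑ v, ∑ w, γ.real {(v, w)} * d v w ≤ t + δ := by
  have hle : transportDist d μ ν ≤ 1 := by
    refine (iInf₂_le (μ.prod ν) ⟨by simp, by simp⟩).trans ?_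
    refine (lintegral_mono (g := fun _ => 1) fun p => ?_).trans (by simp)
    exact ENNReal.ofReal_le_one.2 (hd1 _ _)
  have htop : transportDist d μ ν ≠ ∞ := ne_top_of_le_ne_top ENNReal.one_ne_top hle
  refine ⟨(transportDist d μ ν).toReal, ENNReal.toReal_nonneg, (ENNReal.ofReal_toReal htop).symm, ?_⟩
  set t := (transportDist d μ ν).toReal with ht
  have hlt : transportDist d μ ν < ENNReal.ofReal (t + δ) := by
    rw [← ENNReal.ofReal_toReal htop, ENNReal.ofReal_lt_ofReal_iff (by positivity)]
    linarith
  simp only [transportDist, iInf_lt_iff] at hlt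
  obtain ⟨γ, hγ, hlt⟩ := hlt
  have hp : IsProbabilityMeasure γ := by
    refine ⟨?_⟩
    have : γ.map Prod.fst Set.univ = 1 := by rw [hγ.1]; simp
    rwa [Measure.map_apply measurable_fst MeasurableSet.univ] at this
  refine ⟨γ, fun v => ?_, fun w => ?_, ?_⟩
  · rw [← hγ.1, map_measureReal_apply measurable_fst (measurableSet_singleton v)]
    exact sum_mass_right γ measurable_fst measurable_snd v
  · rw [← hγ.2, map_measureReal_apply measurable_snd (measurableSet_singleton w)]
    exact sum_mass_left γ measurable_fst measurable_snd w
  · rw [sum_sum_real_singleton_mul γ hd] at hlt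
    exact (ENNReal.ofReal_lt_ofReal_iff_of_nonneg (Finset.sum_nonneg fun v _ =>
      Finset.sum_nonneg fun w _ => mul_nonneg measureReal_nonneg (hd _ _))).1 hlt |>.le

end FiniteMeasures

theorem IsExtremal.finExtremal {V : Type u} [Fintype V] [MeasurableSpace V]
    [MeasurableSingletonClass V] {d : V → V → ℝ} (hd : ∀ v w, 0 ≤ d v w) (hd1 : ∀ v w, d v w ≤ 1)
    {p : Measure V} [IsProbabilityMeasure p] {κ r : ℝ} (hκ : 0 < κ) (hr : 0 ≤ r)
    (h : IsExtremal d p κ r) : FinExtremal d (fun v => p.real {v}) κ r := by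
  intro m g hg M hM hsum δ hδ
  replace hsum : ∀ v, ∑ i, g i v = M * p.real {v} := hsum
  rcases hM.eq_or_lt with rfl | hM
  · have h0 : ∀ i v, g i v = 0 := by
      intro i v
      have := hsum v
      rw [zero_mul, Finset.sum_eq_zero_iff_of_nonneg fun i _ => hg i v] at this
      exact this i (Finset.mem_univ i)
    exact ⟨fun _ _ _ => 0, by simp, by simp [h0], by simp [rowSum, h0], by simp [h0]⟩
  have hR0 : ∀ i, 0 ≤ rowSum g i := fun i => Finset.sum_nonneg fun v _ => hg i v
  have hRz : ∀ i, rowSum g i = 0 → ∀ v, g i v = 0 := fun i h0 v => by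
    rw [rowSum, Finset.sum_eq_zero_iff_of_nonneg fun v _ => hg i v] at h0
    exact h0 v (Finset.mem_univ v)
  have hp1 : ∑ v, p.real {v} = 1 := sum_mass p measurable_id
  have hRsum : ∑ i, rowSum g i = M := by
    simp only [rowSum]
    rw [Finset.sum_comm]
    simp_rw [hsum]
    rw [← Finset.mul_sum, hp1, mul_one]
  set D : Fin m → ℝ := fun i => ∑ v, g i v * Real.log (g i v / (rowSum g i * p.real {v})) with hD
  have hpz : ∀ i v, p.real {v} = 0 → g i v = 0 := by
    intro i v h0
    have := hsum v
    rw [h0, mul_zero, Finset.sum_eq_zero_iff_of_nonneg fun i _ => hg i v] at this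
    exact this i (Finset.mem_univ i)
  have hD0 : ∀ i, 0 ≤ D i := by
    intro i
    have h1 := sum_mul_log_sum_div_le (a := g i) (b := fun v => rowSum g i * p.real {v}) (hg i)
      (fun v => mul_nonneg (hR0 i) measureReal_nonneg)
      (fun v h0 => (mul_eq_zero.1 h0).elim (fun h0 => hRz i h0 v) (hpz i v))
    rw [← Finset.mul_sum, hp1, mul_one] at h1
    refine h1.trans' (le_of_eq ?_)
    change 0 = rowSum g i * Real.log (rowSum g i / rowSum g i)
    by_cases h0 : rowSum g i = 0
    · simp [h0]
    · simp [div_self h0]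
  -- Rows are normalized to probability measures. An empty row gets the dummy value `p`, so that the
  -- kernel is Markov; its weight is zero.
  set ρ : Fin m → Measure V := fun i =>
    if rowSum g i = 0 then p else ofMass fun v => g i v / rowSum g i with hρ
  have hρp : ∀ i, IsProbabilityMeasure (ρ i) := by
    intro i
    simp only [hρ]
    split_ifs with h0
    · infer_instance
    · refine isProbabilityMeasure_ofMass (fun v => div_nonneg (hg i v) (hR0 i)) ?_
      rw [← Finset.sum_div]
      exact div_self h0
  have hρg : ∀ i v, rowSum g i * (ρ i).real {v} = g i v := by
    intro i v
    simp only [hρ]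
    split_ifs with h0
    · rw [h0, zero_mul, hRz i h0]
    · rw [ofMass_real_singleton (fun v => div_nonneg (hg i v) (hR0 i))]
      field_simp
  have hw0 : ∀ i, 0 ≤ rowSum g i / M := fun i => div_nonneg (hR0 i) hM.le
  -- The definition of extremality wants the index space in the universe of `V`.
  let Ω := ULift.{u} (Fin m)
  let P : Measure Ω := ofMass fun i => rowSum g i.down / M
  have hsumΩ : ∀ F : Fin m → ℝ, ∑ i : Ω, F i.down = ∑ i, F i := fun F =>
    Equiv.sum_comp Equiv.ulift F
  have hsumΩ' : ∀ F : Fin m → ℝ≥0∞, ∑ i : Ω, F i.down = ∑ i, F i := fun F =>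
    Equiv.sum_comp Equiv.ulift F
  have hP : IsProbabilityMeasure P := by
    refine isProbabilityMeasure_ofMass (fun i => hw0 i.down) ?_
    rw [hsumΩ (fun i => rowSum g i / M), ← Finset.sum_div, hRsum, div_self hM.ne']
  let η : Kernel Ω V := Kernel.ofFunOfCountable fun i => ρ i.down
  have hη : IsMarkovKernel η := ⟨fun i => hρp i.down⟩
  have hbind : P.bind η = p := by
    refine Measure.ext_of_singleton fun v => ?_
    rw [Measure.bind_apply (measurableSet_singleton v) η.measurable.aemeasurable, lintegral_fintype]
    have h1 : ∀ i : Ω, η i {v} * P {i} = ENNReal.ofReal (g i.down v / M) := by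
      intro i
      have := hρp i.down
      change ρ i.down {v} * P {i} = _
      rw [ofMass_singleton, ← ofReal_measureReal (μ := ρ i.down),
        ← ENNReal.ofReal_mul measureReal_nonneg, ← hρg i.down v]
      congr 1
      ring
    simp_rw [h1]
    rw [hsumΩ' (fun i => ENNReal.ofReal (g i v / M)),
      ← ENNReal.ofReal_sum_of_nonneg fun i _ => div_nonneg (hg i v) hM.le, ← Finset.sum_div,
      hsum, mul_div_cancel_left₀ _ hM.ne', ofReal_measureReal]
  have key := h Ω P η hbind
  choose t ht0 ht γ hγ1 hγ2 hγ3 using fun i => exists_coupling d hd hd1 (ρ i) p hδ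
  rw [lintegral_fintype, lintegral_fintype] at key
  have h1 : ∀ i : Ω, transportDist d (η i) p * P {i}
      = ENNReal.ofReal (t i.down * (rowSum g i.down / M)) := by
    intro i
    change transportDist d (ρ i.down) p * P {i} = _
    rw [ofMass_singleton, ht, ← ENNReal.ofReal_mul (ht0 _)]
  have h2 : ∀ i : Ω, InformationTheory.klDiv (η i) p * P {i}
      = ENNReal.ofReal (D i.down / M) := by
    intro i
    have := hρp i.down
    change InformationTheory.klDiv (ρ i.down) p * P {i} = _
    rw [ofMass_singleton]
    by_cases h0 : rowSum g i.down = 0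
    · simp [h0, hD, hRz _ h0]
    rw [klDiv_eq_sum, ← ENNReal.ofReal_mul' (hw0 _)]
    · congr 1
      rw [Finset.sum_mul, hD, Finset.sum_div]
      refine Finset.sum_congr rfl fun v _ => ?_
      rw [← hρg i.down v, mul_div_mul_left _ _ h0]
      ring
    · intro v hv
      have := hρg i.down v
      rw [hpz i.down v hv] at this
      exact (mul_eq_zero.1 this).resolve_left h0
  simp_rw [h1, h2] at key
  rw [hsumΩ' (fun i => ENNReal.ofReal (t i * (rowSum g i / M))),
    hsumΩ' (fun i => ENNReal.ofReal (D i / M)),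
    ← ENNReal.ofReal_sum_of_nonneg fun i _ => mul_nonneg (ht0 i) (hw0 i),
    ← ENNReal.ofReal_sum_of_nonneg fun i _ => div_nonneg (hD0 i) hM.le,
    ← ENNReal.ofReal_div_of_pos hκ, ← ENNReal.ofReal_add (div_nonneg
      (Finset.sum_nonneg fun i _ => div_nonneg (hD0 i) hM.le) hκ.le) hr,
    ENNReal.ofReal_le_ofReal_iff (add_nonneg (div_nonneg
      (Finset.sum_nonneg fun i _ => div_nonneg (hD0 i) hM.le) hκ.le) hr)] at key
  refine ⟨fun i v w => rowSum g i * (γ i).real {(v, w)},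
    fun i v w => mul_nonneg (hR0 i) measureReal_nonneg, fun i v => ?_, fun i w => ?_, ?_⟩
  · rw [← Finset.mul_sum, hγ1, hρg]
  · rw [← Finset.mul_sum, hγ2]
  calc ∑ i, ∑ v, ∑ w, rowSum g i * (γ i).real {(v, w)} * d v w
      = ∑ i, rowSum g i * ∑ v, ∑ w, (γ i).real {(v, w)} * d v w := by
        simp_rw [Finset.mul_sum, mul_assoc]
    _ ≤ ∑ i, rowSum g i * (t i + δ) :=
        Finset.sum_le_sum fun i _ => mul_le_mul_of_nonneg_left (hγ3 i) (hR0 i)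
    _ = M * (∑ i, t i * (rowSum g i / M)) + M * δ := by
        simp_rw [mul_add]
        rw [Finset.sum_add_distrib, ← Finset.sum_mul, hRsum, Finset.mul_sum]
        congr 1
        refine Finset.sum_congr rfl fun i _ => ?_
        field_simp
    _ ≤ M * ((∑ i, D i / M) / κ + r) + M * δ := by gcongr
    _ = (∑ i, D i) / κ + M * (r + δ) := by
        rw [← Finset.sum_div]
        field_simp
        ring

/-! ### Concatenating block couplings -/

section Chain

variable {Ω S V : Type*} [MeasurableSpace Ω] [Fintype S] [MeasurableSpace S]
  [MeasurableSingletonClass S] [Fintype V] [MeasurableSpace V] [MeasurableSingletonClass V]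

/-- The joint mass function of `X k` and the pair of `s` and `X 0, …, X (k - 1)`. -/
def nextMass (μ : Measure Ω) (s : Ω → S) (X : ℕ → Ω → V) (k : ℕ) (z : S × (Fin k → V)) (v : V) : ℝ :=
  mass μ (fun ω => (X k ω, s ω, fun i : Fin k => X i ω)) (v, z)

lemma nextMass_nonneg (μ : Measure Ω) (s : Ω → S) (X : ℕ → Ω → V) (k : ℕ) (z : S × (Fin k → V))
    (v : V) : 0 ≤ nextMass μ s X k z v := mass_nonneg _ _ _

lemma rowSum_nextMass (μ : Measure Ω) [IsProbabilityMeasure μ] {s : Ω → S} (hs : Measurable s)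
    {X : ℕ → Ω → V} (hX : ∀ k, Measurable (X k)) (k : ℕ) (z : S × (Fin k → V)) :
    rowSum (nextMass μ s X k) z = mass μ (fun ω => (s ω, fun i : Fin k => X i ω)) z :=
  sum_mass_left μ (hX k) 
    (Y := fun ω => (s ω, fun i : Fin k => X i ω))
    (hs.prodMk (measurable_pi_lambda _ fun i : Fin k => hX i)) z

lemma nextMass_init_last (μ : Measure Ω) (s : Ω → S) (X : ℕ → Ω → V) (k : ℕ) (b : S)
    (w : Fin (k + 1) → V) : nextMass μ s X k (b, Fin.init w) (w (Fin.last k))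
      = mass μ (fun ω => (s ω, fun i : Fin (k + 1) => X i ω)) (b, w) := by
  refine congrArg μ.real ?_
  ext ω
  simp only [Set.mem_preimage, Set.mem_singleton_iff, Prod.mk.injEq, funext_iff]
  rw [Fin.forall_fin_succ']
  simp only [Fin.init, Fin.val_castSucc, Fin.val_last]
  tauto

lemma sum_snoc {V : Type*} [Fintype V] (k : ℕ) (F : (Fin (k + 1) → V) → ℝ) :
    ∑ w, F w = ∑ u : Fin k → V, ∑ v : V, F (Fin.snoc u v) := by
  rw [← Equiv.sum_comp (Fin.snocEquiv fun _ => V) F, Fintype.sum_prod_type_right]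
  rfl

/-- The target `e k b` ignores the past. So over every triple `(b, v, w)` of a factor word and two
coupled pasts, the two next-block laws can be joined through this common measure, at average cost `t
+ u` whatever the coupling of the pasts. Equality of the laws of `s` starts the induction. -/
theorem exists_chain_coupling (μ ν : Measure Ω) [IsProbabilityMeasure μ] [IsProbabilityMeasure ν]
    {s : Ω → S} (hs : Measurable s) {X : ℕ → Ω → V} (hX : ∀ k, Measurable (X k))
    (hμν : mass μ s = mass ν s) {d : V → V → ℝ} (hd : ∀ v w, 0 ≤ d v w)
    (hsymm : ∀ v w, d v w = d w v)
    (htri : ∀ v w x, d v x ≤ d v w + d w x) (e : ℕ → S → V → ℝ) {t u : ℝ} (K : ℕ)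
    (h1 : ∀ k < K, Transports d (nextMass μ s X k)
      (fun z w => rowSum (nextMass μ s X k) z * e k z.1 w) t)
    (h2 : ∀ k < K, Transports d (nextMass ν s X k)
      (fun z w => rowSum (nextMass ν s X k) z * e k z.1 w) u) :
    ∃ γ : S → (Fin K → V) → (Fin K → V) → ℝ, (∀ b v w, 0 ≤ γ b v w) ∧
      (∀ b v, ∑ w, γ b v w = mass μ (fun ω => (s ω, fun i : Fin K => X i ω)) (b, v)) ∧
      (∀ b w, ∑ v, γ b v w = mass ν (fun ω => (s ω, fun i : Fin K => X i ω)) (b, w)) ∧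
      ∑ b, ∑ v, ∑ w, γ b v w * ∑ i, d (v i) (w i) ≤ K * (t + u) := by
  classical
  induction K with
  | zero =>
    have h0 : ∀ (ρ : Measure Ω) (b : S) (v : Fin 0 → V),
        mass ρ (fun ω => (s ω, fun i : Fin 0 => X i ω)) (b, v) = mass ρ s b := by
      intro ρ b v
      refine congrArg ρ.real ?_
      ext ω
      simp only [Set.mem_preimage, Set.mem_singleton_iff, Prod.mk.injEq]
      exact ⟨fun h => h.1, fun h => ⟨h, Subsingleton.elim _ _⟩⟩
    refine ⟨fun b _ _ => mass μ s b, fun b _ _ => mass_nonneg _ _ _, fun b v => ?_, fun b w => ?_, ?_⟩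
    · rw [h0]; simp
    · rw [h0, ← hμν]; simp
    · simp
  | succ K ih =>
    obtain ⟨γ, g1, g2, g3, g4⟩ := ih (fun k hk => h1 k (by omega)) (fun k hk => h2 k (by omega))
    set P := nextMass μ s X K with hP
    set Q := nextMass ν s X K with hQ
    have hP2 : ∀ b v, ∑ w, γ b v w = rowSum P (b, v) := fun b v => by
      rw [g2, hP, rowSum_nextMass μ hs hX]
    have hQ2 : ∀ b w, ∑ v, γ b v w = rowSum Q (b, w) := fun b w => by
      rw [g3, hQ, rowSum_nextMass ν hs hX]
    have hP0 : ∀ z v, 0 ≤ P z v := nextMass_nonneg μ s X K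
    have hQ0 : ∀ z v, 0 ≤ Q z v := nextMass_nonneg ν s X K
    have hPr : ∀ z, 0 ≤ rowSum P z := fun z => Finset.sum_nonneg fun v _ => hP0 z v
    have hQr : ∀ z, 0 ≤ rowSum Q z := fun z => Finset.sum_nonneg fun v _ => hQ0 z v
    have hPz : ∀ z, rowSum P z = 0 → ∀ v, P z v = 0 := fun z h0 v => by
      rw [rowSum, Finset.sum_eq_zero_iff_of_nonneg fun v _ => hP0 z v] at h0
      exact h0 v (Finset.mem_univ v)
    have hQz : ∀ z, rowSum Q z = 0 → ∀ v, Q z v = 0 := fun z h0 v => by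
      rw [rowSum, Finset.sum_eq_zero_iff_of_nonneg fun v _ => hQ0 z v] at h0
      exact h0 v (Finset.mem_univ v)
    have hγP : ∀ b v w, rowSum P (b, v) = 0 → γ b v w = 0 := by
      intro b v w h0
      rw [← hP2, Finset.sum_eq_zero_iff_of_nonneg fun w _ => g1 b v w] at h0
      exact h0 w (Finset.mem_univ w)
    have hγQ : ∀ b v w, rowSum Q (b, w) = 0 → γ b v w = 0 := by
      intro b v w h0
      rw [← hQ2, Finset.sum_eq_zero_iff_of_nonneg fun v _ => g1 b v w] at h0
      exact h0 v (Finset.mem_univ v)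
    -- The transport at `(b, v)` is split among the partners `w` of `v` in proportion to `γ b v w`;
    -- `t2` does the same with the roles exchanged.
    have t1 := (h1 K (by omega)).comap hd
      (f := fun z : S × (Fin K → V) × (Fin K → V) => (z.1, z.2.1))
      (W := fun z => γ z.1 z.2.1 z.2.2 / rowSum P (z.1, z.2.1))
      (fun z => div_nonneg (g1 _ _ _) (hPr _)) (by
        rintro ⟨b, v⟩
        rw [Fintype.sum_prod_type, Finset.sum_eq_single b (by
          intro b' _ hb; simp [hb]) (by simp), Fintype.sum_prod_type, Finset.sum_eq_single v (by
          intro v' _ hv; simp [hv]) (by simp)]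
        simp only [if_true]
        rw [← Finset.sum_div, hP2]
        exact div_self_le_one _)
    have t2 := (h2 K (by omega)).comap hd
      (f := fun z : S × (Fin K → V) × (Fin K → V) => (z.1, z.2.2))
      (W := fun z => γ z.1 z.2.1 z.2.2 / rowSum Q (z.1, z.2.2))
      (fun z => div_nonneg (g1 _ _ _) (hQr _)) (by
        rintro ⟨b, v⟩
        rw [Fintype.sum_prod_type, Finset.sum_eq_single b (by
          intro b' _ hb; simp [hb]) (by simp), Fintype.sum_prod_type_right,
          Finset.sum_eq_single v (by intro v' _ hv; simp [hv]) (by simp)]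
        simp only [if_true]
        rw [← Finset.sum_div, hQ2]
        exact div_self_le_one _)
    -- After the splitting both transports end at the same family `γ * e K b`, so they can be
    -- composed.
    have m1 : ∀ (z : S × (Fin K → V) × (Fin K → V)) (x : V),
        γ z.1 z.2.1 z.2.2 / rowSum P (z.1, z.2.1) * (rowSum P (z.1, z.2.1) * e K z.1 x)
          = γ z.1 z.2.1 z.2.2 * e K z.1 x := by
      intro z x
      by_cases h0 : rowSum P (z.1, z.2.1) = 0
      · rw [hγP _ _ _ h0]; simp
      · field_simp
    have m2 : ∀ (z : S × (Fin K → V) × (Fin K → V)) (x : V),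
        γ z.1 z.2.1 z.2.2 / rowSum Q (z.1, z.2.2) * (rowSum Q (z.1, z.2.2) * e K z.1 x)
          = γ z.1 z.2.1 z.2.2 * e K z.1 x := by
      intro z x
      by_cases h0 : rowSum Q (z.1, z.2.2) = 0
      · rw [hγQ _ _ _ h0]; simp
      · field_simp
    simp only [← hP, ← hQ, m1, m2] at t1 t2
    obtain ⟨c, c1, c2, c3, c4⟩ := t1.trans htri (t2.symm hsymm)
    refine ⟨fun b v w => c (b, Fin.init v, Fin.init w) (v (Fin.last K)) (w (Fin.last K)),
      fun b v w => c1 _ _ _, fun b v => ?_, fun b w => ?_, ?_⟩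
    · rw [sum_snoc, ← nextMass_init_last, ← hP]
      simp only [Fin.init_snoc, Fin.snoc_last, c2]
      rw [← Finset.sum_mul, ← Finset.sum_div, hP2]
      by_cases h0 : rowSum P (b, Fin.init v) = 0
      · rw [hPz _ h0]; simp
      · rw [div_self h0, one_mul]
    · rw [sum_snoc, ← nextMass_init_last, ← hQ]
      simp only [Fin.init_snoc, Fin.snoc_last, c3]
      rw [← Finset.sum_mul, ← Finset.sum_div, hQ2]
      by_cases h0 : rowSum Q (b, Fin.init w) = 0
      · rw [hQz _ h0]; simp
      · rw [div_self h0, one_mul]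
    · have hc : ∀ b v w, ∑ x, ∑ y, c (b, v, w) x y = γ b v w := by
        intro b v w
        simp_rw [c2]
        rw [← Finset.mul_sum]
        change _ * rowSum P (b, v) = _
        by_cases h0 : rowSum P (b, v) = 0
        · rw [hγP _ _ _ h0]; simp
        · field_simp
      have hcost : ∀ b, (∑ v, ∑ w, c (b, Fin.init v, Fin.init w) (v (Fin.last K)) (w (Fin.last K))
            * ∑ i, d (v i) (w i))
          = (∑ v, ∑ w, γ b v w * ∑ i, d (v i) (w i))
            + ∑ v, ∑ w, ∑ x, ∑ y, c (b, v, w) x y * d x y := by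
        intro b
        simp only [sum_snoc K, Fin.init_snoc, Fin.snoc_last, Fin.sum_univ_castSucc,
          Fin.snoc_castSucc]
        rw [← Finset.sum_add_distrib]
        refine Finset.sum_congr rfl fun v _ => ?_
        rw [Finset.sum_comm, ← Finset.sum_add_distrib]
        refine Finset.sum_congr rfl fun w _ => ?_
        rw [← hc, Finset.sum_mul, ← Finset.sum_add_distrib]
        refine Finset.sum_congr rfl fun x _ => ?_
        rw [Finset.sum_mul, ← Finset.sum_add_distrib]
        refine Finset.sum_congr rfl fun y _ => ?_
        ring
      simp_rw [hcost]
      rw [Finset.sum_add_distrib]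
      simp only [Fintype.sum_prod_type] at c4
      push_cast
      linarith

end Chain

/-! ### Joinings as limits of averaged finite couplings -/

section Limit

variable {A B : Type*} [Fintype A] [MeasurableSpace A] [DiscreteMeasurableSpace A]
  [Fintype B] [MeasurableSpace B] [DiscreteMeasurableSpace B]

lemma borelSpace_of_discrete (A : Type*) [MeasurableSpace A] [DiscreteMeasurableSpace A]
    [TopologicalSpace A] [DiscreteTopology A] : BorelSpace A := by
  refine ⟨?_⟩
  rw [borel_eq_top_of_discrete]
  exact MeasurableSpace.ext fun s => ⟨fun _ => trivial, fun _ => MeasurableSet.of_discrete⟩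

lemma shift_iterate {A : Type*} (j : ℕ) (a : ℤ → A) (i : ℤ) : shift^[j] a i = a (i + j) := by
  induction j generalizing a with
  | zero => simp
  | succ j ih =>
    rw [Function.iterate_succ_apply, ih]
    simp only [shift]
    congr 1
    push_cast; ring

lemma shift₂_iterate {A B : Type*} (j : ℕ) (p : (ℤ → B) × (ℤ → A)) :
    shift₂^[j] p = (shift^[j] p.1, shift^[j] p.2) := by
  rw [shift₂, Prod.map_iterate]; rfl

lemma shift₃_iterate {A B : Type*} (j : ℕ) (p : (ℤ → B) × (ℤ → A) × (ℤ → A)) :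
    shift₃^[j] p = (shift^[j] p.1, shift^[j] p.2.1, shift^[j] p.2.2) := by
  rw [shift₃, Prod.map_iterate, Prod.map_iterate]; rfl

lemma measurable_shift₂ : Measurable (shift₂ : (ℤ → B) × (ℤ → A) → _) :=
  measurable_shift.prodMap measurable_shift

lemma measurable_shift₃ : Measurable (shift₃ : (ℤ → B) × (ℤ → A) × (ℤ → A) → _) :=
  measurable_shift.prodMap (measurable_shift.prodMap measurable_shift)

/-- The block of coordinates in `[-m, m)`. -/
def centeredBlock {A : Type*} (m : ℕ) (a : ℤ → A) : Fin (2 * m) → A := fun i => a (i - m)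

lemma measurable_centeredBlock (m : ℕ) :
    Measurable (centeredBlock m : (ℤ → A) → Fin (2 * m) → A) :=
  measurable_pi_lambda _ fun _ => measurable_pi_apply _

lemma centeredBlock_shift_iterate {A : Type*} (m : ℕ) (a : ℤ → A) :
    centeredBlock m (shift^[m] a) = block (2 * m) a := by
  ext i
  simp [centeredBlock, shift_iterate, block]

/-- The pair of centered blocks. -/
def centeredBlocks {A B : Type*} (m : ℕ) (p : (ℤ → B) × (ℤ → A)) :
    (Fin (2 * m) → B) × (Fin (2 * m) → A) := (centeredBlock m p.1, centeredBlock m p.2)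

lemma measurable_coord_centeredBlock {A Ω : Type*} [MeasurableSpace A] (f : Ω → ℤ → A) {m : ℕ}
    {i : ℤ} (hi : i.natAbs < m) :
    Measurable[MeasurableSpace.comap (fun ω => centeredBlock m (f ω)) inferInstance]
      fun ω => f ω i := by
  have e : (fun ω => f ω i) = (fun v : Fin (2 * m) → A => v ⟨(i + m).toNat, by omega⟩)
      ∘ fun ω => centeredBlock m (f ω) := by
    ext ω
    have : (((i + m).toNat : ℕ) : ℤ) - m = i := by omega
    change f ω i = f ω ((((i + m).toNat : ℕ) : ℤ) - m)
    rw [this]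
  rw [e]
  exact (measurable_pi_apply _).comp (comap_measurable _)

lemma comap_centeredBlock_mono {A Ω : Type*} [MeasurableSpace A] (f : Ω → ℤ → A) {m m' : ℕ}
    (h : m ≤ m') : MeasurableSpace.comap (fun ω => centeredBlock m (f ω)) inferInstance
      ≤ MeasurableSpace.comap (fun ω => centeredBlock m' (f ω)) inferInstance := by
  rcases h.eq_or_lt with rfl | h
  · exact le_rfl
  refine measurable_iff_comap_le.1 (@measurable_pi_lambda _ _ _ (_) _ _ fun i => ?_)
  have e : (fun ω => centeredBlock m (f ω) i)
      = (fun v : Fin (2 * m') → A => v ⟨i + (m' - m), by omega⟩)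
      ∘ fun ω => centeredBlock m' (f ω) := by
    ext ω
    simp only [centeredBlock, Function.comp_apply]
    congr 1
    push_cast [Nat.cast_sub h.le]
    ring
  rw [e]
  exact (measurable_pi_apply _).comp (comap_measurable _)

lemma iSup_comap_centeredBlocks : ⨆ m, MeasurableSpace.comap
    (centeredBlocks m : (ℤ → B) × (ℤ → A) → _) inferInstance
      = (inferInstance : MeasurableSpace ((ℤ → B) × (ℤ → A))) := by
  refine le_antisymm (iSup_le fun m => Measurable.comap_le ?_) (sup_le ?_ ?_)
  · exact ((measurable_centeredBlock m).comp measurable_fst).prodMk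
      ((measurable_centeredBlock m).comp measurable_snd)
  · refine measurable_iff_comap_le.1 (@measurable_pi_lambda _ _ _ (_) _ _ fun i => ?_)
    refine (measurable_coord_centeredBlock (m := i.natAbs + 1) Prod.fst (by omega)).mono
      (le_iSup_of_le (i.natAbs + 1) ?_) le_rfl
    exact measurable_iff_comap_le.1 (measurable_fst.comp (comap_measurable (centeredBlocks _)))
  · refine measurable_iff_comap_le.1 (@measurable_pi_lambda _ _ _ (_) _ _ fun i => ?_)
    refine (measurable_coord_centeredBlock (m := i.natAbs + 1) Prod.snd (by omega)).mono
      (le_iSup_of_le (i.natAbs + 1) ?_) le_rfl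
    exact measurable_iff_comap_le.1 (measurable_snd.comp (comap_measurable (centeredBlocks _)))

lemma comap_centeredBlocks_mono : Monotone fun m => MeasurableSpace.comap
    (centeredBlocks m : (ℤ → B) × (ℤ → A) → _) inferInstance := by
  intro m m' h
  have e : ∀ m, MeasurableSpace.comap (centeredBlocks m : (ℤ → B) × (ℤ → A) → _) inferInstance
      = MeasurableSpace.comap (fun p : (ℤ → B) × (ℤ → A) => centeredBlock m p.1) inferInstance
      ⊔ MeasurableSpace.comap (fun p : (ℤ → B) × (ℤ → A) => centeredBlock m p.2) inferInstance := by
    intro m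
    exact MeasurableSpace.comap_prodMk _ _
  dsimp only
  rw [e, e]
  exact sup_le_sup (comap_centeredBlock_mono _ h) (comap_centeredBlock_mono _ h)

/-- Shift-invariant measures are determined by their block laws. -/
theorem eq_of_blockLaw_eq {P Q : Measure ((ℤ → B) × (ℤ → A))} [IsProbabilityMeasure P]
    [IsProbabilityMeasure Q] (hP : MeasurePreserving shift₂ P P)
    (hQ : MeasurePreserving shift₂ Q Q) (h : ∀ n, blockLaw n P = blockLaw n Q) : P = Q := by
  refine ext_of_generate_finite
    (⋃ m, {s | MeasurableSet[MeasurableSpace.comap (centeredBlocks m) inferInstance] s}) ?_ ?_ ?_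
    (by simp)
  · exact iSup_comap_centeredBlocks.symm.trans
      (MeasurableSpace.generateFrom_iUnion_measurableSet _).symm
  · exact isPiSystem_iUnion_of_monotone _ (fun m => @MeasurableSpace.isPiSystem_measurableSet _ (_))
      fun m m' hm s hs => comap_centeredBlocks_mono hm s hs
  · intro s hs
    obtain ⟨m, hs⟩ := Set.mem_iUnion.1 hs
    obtain ⟨D, hD, rfl⟩ := hs
    have hm : Measurable (centeredBlocks m : (ℤ → B) × (ℤ → A) → _) :=
      ((measurable_centeredBlock m).comp measurable_fst).prodMk
        ((measurable_centeredBlock m).comp measurable_snd)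
    have hb : Measurable (Prod.map (block (2 * m)) (block (2 * m)) : (ℤ → B) × (ℤ → A) → _) :=
      (measurable_block _).prodMap (measurable_block _)
    -- Centered cylinders form a generating π-system, and invariance moves the window `[-m, m)` to
    -- `[0, 2 m)`, where block laws apply.
    have key : ∀ (R : Measure ((ℤ → B) × (ℤ → A))), MeasurePreserving shift₂ R R →
        R (centeredBlocks m ⁻¹' D) = blockLaw (2 * m) R D := by
      intro R hR
      rw [← (hR.iterate m).measure_preimage (hm hD).nullMeasurableSet, blockLaw,
        Measure.map_apply hb hD, ← Set.preimage_comp]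
      congr 2
      ext p : 1
      rw [Function.comp_apply, shift₂_iterate, centeredBlocks, centeredBlock_shift_iterate,
        centeredBlock_shift_iterate]
      rfl
    rw [key P hP, key Q hQ, h]

/-- The average of the first `N` shifts of a measure. -/
def averagedMeasure (Γ : Measure ((ℤ → B) × (ℤ → A) × (ℤ → A))) (N : ℕ) :
    Measure ((ℤ → B) × (ℤ → A) × (ℤ → A)) :=
  (N : ℝ≥0∞)⁻¹ • ∑ j ∈ Finset.range N, Γ.map shift₃^[j]

variable {Γ : Measure ((ℤ → B) × (ℤ → A) × (ℤ → A))} [IsProbabilityMeasure Γ] {N : ℕ}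

lemma isProbabilityMeasure_averagedMeasure (hN : 0 < N) :
    IsProbabilityMeasure (averagedMeasure Γ N) := by
  refine ⟨?_⟩
  have : ∀ j, (Γ.map shift₃^[j]) Set.univ = 1 := fun j => by
    rw [Measure.map_apply (measurable_shift₃.iterate j) MeasurableSet.univ]; simp
  simp only [averagedMeasure, Measure.smul_apply, Measure.coe_finsetSum, Finset.sum_apply, this,
    smul_eq_mul, Finset.sum_const, Finset.card_range, nsmul_eq_mul, mul_one]
  exact ENNReal.inv_mul_cancel (by exact_mod_cast hN.ne') (ENNReal.natCast_ne_top N)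

lemma averagedMeasure_real {s : Set ((ℤ → B) × (ℤ → A) × (ℤ → A))} (hs : MeasurableSet s) :
    (averagedMeasure Γ N).real s = (∑ j ∈ Finset.range N, Γ.real (shift₃^[j] ⁻¹' s)) / N := by
  simp only [measureReal_def, averagedMeasure, Measure.smul_apply, Measure.coe_finsetSum,
    Finset.sum_apply, smul_eq_mul, ENNReal.toReal_mul, ENNReal.toReal_inv, ENNReal.toReal_natCast]
  rw [ENNReal.toReal_sum]
  · rw [inv_mul_eq_div]
    congr 1
    refine Finset.sum_congr rfl fun j _ => ?_
    rw [Measure.map_apply (measurable_shift₃.iterate j) hs]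
  · intro j _
    rw [Measure.map_apply (measurable_shift₃.iterate j) hs]
    exact measure_ne_top _ _

/-- At most `m` of the `N` shifts push the window beyond time `N`, and each of these errs by at most
1. -/
lemma abs_averagedMeasure_real_sub_le {s : Set ((ℤ → B) × (ℤ → A) × (ℤ → A))}
    (hs : MeasurableSet s) {l : ℝ} (hl0 : 0 ≤ l) (hl1 : l ≤ 1) {m : ℕ} (hN : 0 < N)
    (h : ∀ j, j + m ≤ N → Γ.real (shift₃^[j] ⁻¹' s) = l) :
    |(averagedMeasure Γ N).real s - l| ≤ m / N := by
  have hN' : (0 : ℝ) < N := by exact_mod_cast hN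
  rw [averagedMeasure_real hs]
  have e : (∑ j ∈ Finset.range N, Γ.real (shift₃^[j] ⁻¹' s)) / N - l
      = (∑ j ∈ Finset.range N, (Γ.real (shift₃^[j] ⁻¹' s) - l)) / N := by
    rw [Finset.sum_sub_distrib]
    simp only [Finset.sum_const, Finset.card_range, nsmul_eq_mul]
    field_simp
  rw [e, abs_div, abs_of_pos hN']
  refine div_le_div_of_nonneg_right ((Finset.abs_sum_le_sum_abs _ _).trans ?_) hN'.le
  have h1 : ∀ j ∈ Finset.range N, |Γ.real (shift₃^[j] ⁻¹' s) - l| ≤ if N < j + m then 1 else 0 := by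
    intro j _
    split_ifs with hj
    · rw [abs_le]
      have := measureReal_nonneg (μ := Γ) (s := shift₃^[j] ⁻¹' s)
      have := measureReal_le_one (μ := Γ) (s := shift₃^[j] ⁻¹' s)
      constructor <;> linarith
    · rw [h j (by omega), sub_self, abs_zero]
  refine (Finset.sum_le_sum h1).trans ?_
  rw [Finset.sum_ite, Finset.sum_const_zero, add_zero, Finset.sum_const, nsmul_eq_mul, mul_one]
  norm_cast
  have hsub : (Finset.range N).filter (fun j => N < j + m) ⊆ Finset.Ico (N - m) N := by
    intro j hj
    simp only [Finset.mem_filter, Finset.mem_range, Finset.mem_Ico] at hj ⊢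
    omega
  refine (Finset.card_le_card hsub).trans ?_
  rw [Nat.card_Ico]
  omega

/-- The difference telescopes to the first and last terms, so the averages are asymptotically
invariant. -/
lemma integral_averagedMeasure_sub (hN : 0 < N) {f : (ℤ → B) × (ℤ → A) × (ℤ → A) → ℝ}
    (hf : Measurable f) {C : ℝ} (hC : ∀ p, |f p| ≤ C) :
    |∫ p, f (shift₃ p) ∂averagedMeasure Γ N - ∫ p, f p ∂averagedMeasure Γ N| ≤ 2 * C / N := by
  have hN' : (0 : ℝ) < N := by exact_mod_cast hN
  have hint : ∀ (g : (ℤ → B) × (ℤ → A) × (ℤ → A) → ℝ), Measurable g → (∀ p, |g p| ≤ C) →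
      ∫ p, g p ∂averagedMeasure Γ N
        = (∑ j ∈ Finset.range N, ∫ p, g (shift₃^[j] p) ∂Γ) / N := by
    intro g hg hgC
    rw [averagedMeasure, integral_smul_measure, integral_finsetSum_measure]
    · rw [ENNReal.toReal_inv, ENNReal.toReal_natCast, smul_eq_mul, inv_mul_eq_div]
      congr 1
      refine Finset.sum_congr rfl fun j _ => ?_
      rw [integral_map (measurable_shift₃.iterate j).aemeasurable hg.aestronglyMeasurable]
    · intro j _
      have : IsProbabilityMeasure (Γ.map shift₃^[j]) :=
        Measure.isProbabilityMeasure_map (measurable_shift₃.iterate j).aemeasurable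
      exact Integrable.of_bound hg.aestronglyMeasurable C (ae_of_all _ hgC)
  rw [hint (fun p => f (shift₃ p)) (hf.comp measurable_shift₃) fun p => hC _, hint f hf hC, ← sub_div,
    ← Finset.sum_sub_distrib]
  have e : ∀ j, ∫ p, f (shift₃ (shift₃^[j] p)) ∂Γ - ∫ p, f (shift₃^[j] p) ∂Γ
      = (fun j => ∫ p, f (shift₃^[j] p) ∂Γ) (j + 1) - (fun j => ∫ p, f (shift₃^[j] p) ∂Γ) j := by
    intro j
    simp only [Function.iterate_succ_apply']
  rw [Finset.sum_congr rfl fun j _ => e j, Finset.sum_range_sub (fun j => ∫ p, f (shift₃^[j] p) ∂Γ), abs_div, abs_of_pos hN']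
  refine div_le_div_of_nonneg_right ?_ hN'.le
  have hb : ∀ j, |∫ p, f (shift₃^[j] p) ∂Γ| ≤ C := by
    intro j
    have := norm_integral_le_of_norm_le_const (μ := Γ) (f := fun p => f (shift₃^[j] p)) (C := C)
      (ae_of_all _ fun p => hC _)
    simpa using this
  have h1 := hb N
  have h2 := hb 0
  rw [abs_le] at *
  constructor <;> linarith

lemma continuous_block [TopologicalSpace A] (m : ℕ) :
    Continuous (block m : (ℤ → A) → Fin m → A) :=
  continuous_pi fun _ => continuous_apply _

lemma continuous_shift [TopologicalSpace A] : Continuous (shift : (ℤ → A) → ℤ → A) :=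
  continuous_pi fun _ => continuous_apply _

lemma exists_tendsto_ultrafilter {E : Type*} [MeasurableSpace E] [TopologicalSpace E] [T2Space E]
    [BorelSpace E] [CompactSpace E] (G : ℕ → ProbabilityMeasure E) (U : Ultrafilter ℕ) :
    ∃ γ, Tendsto G U (nhds γ) := ⟨(U.map G).lim, (U.map G).le_nhds_lim⟩

/-- A Krylov–Bogolyubov argument: the averaged measures have a weak limit along an ultrafilter,
which is invariant. Cylinder events and the event of disagreement at time 0 are clopen, so marginals
and cost pass to the limit. -/
theorem relDbar_le_of_averages {l θ : Measure ((ℤ → B) × (ℤ → A))} [IsProbabilityMeasure l]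
    [IsProbabilityMeasure θ] (hl : MeasurePreserving shift₂ l l)
    (hθ : MeasurePreserving shift₂ θ θ) {c : ℝ}
    (Γ : ℕ → Measure ((ℤ → B) × (ℤ → A) × (ℤ → A))) [∀ K, IsProbabilityMeasure (Γ K)]
    {N : ℕ → ℕ} (hN : Tendsto N atTop atTop)
    (h1 : ∀ K m j, j + m ≤ N K → ∀ s, (Γ K).real {p | (block m (shift^[j] p.1),
      block m (shift^[j] p.2.1)) = s} = (blockLaw m l).real {s})
    (h2 : ∀ K m j, j + m ≤ N K → ∀ s, (Γ K).real {p | (block m (shift^[j] p.1),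
      block m (shift^[j] p.2.2)) = s} = (blockLaw m θ).real {s})
    (hcost : ∀ K, ∑ j ∈ Finset.range (N K), (Γ K).real {p | p.2.1 j ≠ p.2.2 j} ≤ N K * c) :
    relDbar l θ ≤ ENNReal.ofReal c := by
  -- With discrete topologies on the finite alphabets the sequence spaces are compact and the
  -- product σ-algebra is the Borel one.
  let tA : TopologicalSpace A := ⊥
  let tB : TopologicalSpace B := ⊥
  have dA : DiscreteTopology A := ⟨rfl⟩
  have dB : DiscreteTopology B := ⟨rfl⟩
  have bA := borelSpace_of_discrete A
  have bB := borelSpace_of_discrete B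
  obtain ⟨K₀, hK₀⟩ := eventually_atTop.1 (hN.eventually_gt_atTop 0)
  let G : ℕ → ProbabilityMeasure ((ℤ → B) × (ℤ → A) × (ℤ → A)) := fun K =>
    ⟨averagedMeasure (Γ (K + K₀)) (N (K + K₀)),
      isProbabilityMeasure_averagedMeasure (hK₀ _ (by omega))⟩
  let U : Ultrafilter ℕ := hyperfilter ℕ
  obtain ⟨γ, hlim⟩ := exists_tendsto_ultrafilter G U
  have hNU : Tendsto (fun K => (N (K + K₀) : ℝ)) U atTop :=
    (tendsto_natCast_atTop_atTop.comp (hN.comp (tendsto_add_atTop_nat K₀))).mono_left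
      Nat.hyperfilter_le_atTop
  have hzero : ∀ C : ℝ, Tendsto (fun K => C / N (K + K₀)) U (nhds 0) := fun C =>
    tendsto_const_nhds.div_atTop hNU
  have hclopen : ∀ s : Set ((ℤ → B) × (ℤ → A) × (ℤ → A)), IsClopen s →
      Tendsto (fun K => (averagedMeasure (Γ (K + K₀)) (N (K + K₀))).real s) U
        (nhds ((γ : Measure _).real s)) := by
    intro s hs
    have := ProbabilityMeasure.tendsto_measure_of_null_frontier_of_tendsto' hlim (E := s)
      (by rw [hs.frontier_eq]; simp)
    exact (ENNReal.tendsto_toReal (measure_ne_top _ _)).comp this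
  have hcs : Continuous (shift₃ : (ℤ → B) × (ℤ → A) × (ℤ → A) → _) :=
    continuous_shift.prodMap (continuous_shift.prodMap continuous_shift)
  have hinv : MeasurePreserving shift₃ (γ : Measure ((ℤ → B) × (ℤ → A) × (ℤ → A))) γ := by
    refine ⟨measurable_shift₃, ?_⟩
    have : IsProbabilityMeasure ((γ : Measure ((ℤ → B) × (ℤ → A) × (ℤ → A))).map shift₃) :=
      Measure.isProbabilityMeasure_map measurable_shift₃.aemeasurable
    refine ext_of_forall_integral_eq_of_IsFiniteMeasure fun f => ?_
    rw [integral_map measurable_shift₃.aemeasurable f.continuous.aestronglyMeasurable]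
    have t1 := (ProbabilityMeasure.tendsto_iff_forall_integral_tendsto.1 hlim) f
    have t2 := (ProbabilityMeasure.tendsto_iff_forall_integral_tendsto.1 hlim)
      (f.compContinuous ⟨shift₃, hcs⟩)
    have t3 := (t2.sub t1).abs
    have t4 := squeeze_zero (f := fun K => |_|) (fun K => abs_nonneg _) (fun K =>
      integral_averagedMeasure_sub (Γ := Γ (K + K₀)) (N := N (K + K₀)) (hK₀ _ (by omega))
        f.continuous.measurable (C := ‖f‖) fun p => f.norm_coe_le_norm p) (hzero (2 * ‖f‖))
    have t5 := tendsto_nhds_unique t3 t4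
    exact sub_eq_zero.1 (abs_eq_zero.1 t5)
  have hmarg : ∀ (Q : Measure ((ℤ → B) × (ℤ → A))) [IsProbabilityMeasure Q],
      MeasurePreserving shift₂ Q Q →
      ∀ (π : (ℤ → B) × (ℤ → A) × (ℤ → A) → (ℤ → B) × (ℤ → A)), Continuous π →
      (∀ p, π (shift₃ p) = shift₂ (π p)) →
      (∀ K m j, j + m ≤ N K → ∀ s, (Γ K).real {p | (block m (shift^[j] (π p).1),
        block m (shift^[j] (π p).2)) = s} = (blockLaw m Q).real {s}) →
      (γ : Measure _).map π = Q := by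
    intro Q _ hQ π hπ hcomm h
    have hπm := hπ.measurable
    have : IsProbabilityMeasure ((γ : Measure _).map π) :=
      Measure.isProbabilityMeasure_map hπm.aemeasurable
    refine eq_of_blockLaw_eq ⟨measurable_shift₂, ?_⟩ hQ fun m => ?_
    · rw [Measure.map_map measurable_shift₂ hπm]
      have : shift₂ ∘ π = π ∘ shift₃ := funext fun p => (hcomm p).symm
      rw [this, ← Measure.map_map hπm measurable_shift₃, hinv.map_eq]
    refine Measure.ext_of_singleton fun s => ?_
    have hb : Measurable (Prod.map (block m) (block m) : (ℤ → B) × (ℤ → A) → _) :=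
      (measurable_block _).prodMap (measurable_block _)
    have : IsProbabilityMeasure (blockLaw m Q) :=
      Measure.isProbabilityMeasure_map hb.aemeasurable
    have : IsProbabilityMeasure (blockLaw m ((γ : Measure _).map π)) :=
      Measure.isProbabilityMeasure_map hb.aemeasurable
    rw [← ENNReal.toReal_eq_toReal_iff' (measure_ne_top _ _) (measure_ne_top _ _)]
    change (blockLaw m ((γ : Measure _).map π)).real {s} = (blockLaw m Q).real {s}
    rw [blockLaw, map_measureReal_apply hb (measurableSet_singleton s),
      map_measureReal_apply hπm (hb (measurableSet_singleton s))]
    set E := π ⁻¹' (Prod.map (block m) (block m) ⁻¹' {s}) with hE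
    have hEc : IsClopen E := (isClopen_discrete {s}).preimage
      (((continuous_block m).prodMap (continuous_block m)).comp hπ)
    have hEj : ∀ j, shift₃^[j] ⁻¹' E
        = {p | (block m (shift^[j] (π p).1), block m (shift^[j] (π p).2)) = s} := by
      intro j
      ext p
      have : π (shift₃^[j] p) = shift₂^[j] (π p) :=
        (Function.Semiconj.iterate_right (show Function.Semiconj π shift₃ shift₂ from hcomm) j) p
      simp only [hE, Set.mem_preimage, this, shift₂_iterate, Set.mem_singleton_iff]
      rfl
    have t1 := (hclopen E hEc).sub_const ((blockLaw m Q).real {s}) |>.abs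
    have t2 := squeeze_zero (f := fun K => |_|) (fun K => abs_nonneg _) (fun K =>
      abs_averagedMeasure_real_sub_le (Γ := Γ (K + K₀)) (N := N (K + K₀)) hEc.1.measurableSet
        (l := (blockLaw m Q).real {s}) measureReal_nonneg measureReal_le_one (m := m)
        (hK₀ _ (by omega)) fun j hj => by rw [hEj]; exact h _ _ _ hj s) (hzero m)
    exact sub_eq_zero.1 (abs_eq_zero.1 (tendsto_nhds_unique t1 t2))
  have hjoin : (γ : Measure ((ℤ → B) × (ℤ → A) × (ℤ → A))) ∈ Join l θ := by
    refine ⟨inferInstance, hinv, ?_, ?_⟩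
    · exact hmarg l hl (fun p => (p.1, p.2.1)) (by fun_prop) (fun p => rfl) h1
    · exact hmarg θ hθ (fun p => (p.1, p.2.2)) (by fun_prop) (fun p => rfl) h2
  refine (iInf₂_le _ hjoin).trans ?_
  have hDc : IsClopen {p : (ℤ → B) × (ℤ → A) × (ℤ → A) | p.2.1 0 ≠ p.2.2 0} :=
    (isClopen_discrete {q : A × A | q.1 ≠ q.2}).preimage
      (show Continuous fun p : (ℤ → B) × (ℤ → A) × (ℤ → A) => (p.2.1 0, p.2.2 0) by fun_prop)
  have hle := le_of_tendsto' (hclopen _ hDc) (b := c) fun K => by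
    rw [averagedMeasure_real hDc.1.measurableSet]
    have hN0 : (0 : ℝ) < N (K + K₀) := by exact_mod_cast hK₀ _ (by omega)
    rw [div_le_iff₀ hN0, mul_comm]
    refine (hcost (K + K₀)).trans' (le_of_eq ?_)
    refine Finset.sum_congr rfl fun j _ => ?_
    congr 1
    ext p
    simp [shift₃_iterate, shift_iterate]
  rw [← ofReal_measureReal]
  exact ENNReal.ofReal_le_ofReal hle

end Limit

/-! ### From block couplings to joinings -/

section Padding

variable {A B : Type*}

/-- Extend a finite word by a constant. -/
def pad (a₀ : A) {N : ℕ} (v : Fin N → A) (i : ℤ) : A :=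
  if h : 0 ≤ i ∧ i < N then v ⟨i.toNat, by omega⟩ else a₀

lemma pad_natCast (a₀ : A) {N : ℕ} (v : Fin N → A) (i : ℕ) (hi : i < N) :
    pad a₀ v i = v ⟨i, hi⟩ := by
  have h : 0 ≤ (i : ℤ) ∧ (i : ℤ) < N := ⟨by omega, by omega⟩
  rw [pad, dif_pos h]
  simp

/-- The subword of length `m` starting at `j`. -/
def subword {N : ℕ} (j m : ℕ) (h : j + m ≤ N) (v : Fin N → A) : Fin m → A :=
  fun i => v ⟨j + i, by omega⟩

lemma block_shift_pad (a₀ : A) {N : ℕ} (v : Fin N → A) (j m : ℕ) (h : j + m ≤ N) :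
    block m (shift^[j] (pad a₀ v)) = subword j m h v := by
  ext i
  have e : ((i : ℕ) : ℤ) + j = (j + i : ℕ) := by push_cast; ring
  rw [block, shift_iterate, e, pad_natCast _ _ _ (by omega)]
  rfl

lemma block_shift (a : ℤ → A) {N : ℕ} (j m : ℕ) (h : j + m ≤ N) :
    block m (shift^[j] a) = subword j m h (block N a) := by
  ext i
  rw [block, shift_iterate, subword, block]
  congr 1
  push_cast; ring

/-- Concatenate `K` words of length `n`. -/
def concat {K n : ℕ} (u : Fin K → Fin n → A) : Fin (K * n) → A :=
  fun j => u (finProdFinEquiv.symm j).1 (finProdFinEquiv.symm j).2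

lemma concat_blks (K n : ℕ) (a : ℤ → A) : concat (blks n K a) = block (K * n) a := by
  ext j
  obtain ⟨⟨k, i⟩, rfl⟩ := finProdFinEquiv.surjective j
  simp only [concat, Equiv.symm_apply_apply, blks, blk, block]
  congr 1
  rw [finProdFinEquiv_apply_val]
  push_cast; ring

lemma sum_hammingMetric [DecidableEq A] {K n : ℕ} (hn : 0 < n) (u w : Fin K → Fin n → A) :
    ∑ j : Fin (K * n), (if concat u j ≠ concat w j then (1 : ℝ) else 0)
      = n * ∑ k, hammingMetric n (u k) (w k) := by
  rw [← Equiv.sum_comp finProdFinEquiv, Fintype.sum_prod_type, Finset.mul_sum]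
  refine Finset.sum_congr rfl fun k _ => ?_
  have hn' : (n : ℝ) ≠ 0 := by exact_mod_cast hn.ne'
  rw [hammingMetric, mul_div_cancel₀ _ hn', hammingDist, Finset.card_filter]
  simp only [concat, Equiv.symm_apply_apply]
  push_cast
  rfl

variable [Fintype A] [MeasurableSpace A] [DiscreteMeasurableSpace A] [DecidableEq A]
  [Fintype B] [MeasurableSpace B] [DiscreteMeasurableSpace B]

/-- Padding letters are irrelevant, since marginals are tested only on windows inside `[0, K n)`.
There stationarity of `l` and `θ` gives every window the right law, and `n` times the summed block
metrics counts the disagreements. -/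
theorem relDbar_le_of_block_couplings {l θ : Measure ((ℤ → B) × (ℤ → A))}
    [IsProbabilityMeasure l] [IsProbabilityMeasure θ] (hl : MeasurePreserving shift₂ l l)
    (hθ : MeasurePreserving shift₂ θ θ) {n : ℕ} (hn : 0 < n) {c : ℝ}
    (h : ∀ K : ℕ, ∃ γ : (Fin (K * n) → B) → (Fin K → Fin n → A) → (Fin K → Fin n → A) → ℝ,
      (∀ b v w, 0 ≤ γ b v w) ∧
      (∀ b v, ∑ w, γ b v w = mass l (fun ω => (block (K * n) ω.1, blks n K ω.2)) (b, v)) ∧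
      (∀ b w, ∑ v, γ b v w = mass θ (fun ω => (block (K * n) ω.1, blks n K ω.2)) (b, w)) ∧
      ∑ b, ∑ v, ∑ w, γ b v w * ∑ i, hammingMetric n (v i) (w i) ≤ K * c) :
    relDbar l θ ≤ ENNReal.ofReal c := by
  classical
  obtain ⟨⟨b₀⟩, ⟨a₀⟩⟩ := nonempty_alphabets l
  choose γ h0 h1 h2 h3 using h
  have hX : ∀ K, Measurable fun ω : (ℤ → B) × (ℤ → A) => (block (K * n) ω.1, blks n K ω.2) :=
    fun K => ((measurable_block _).comp measurable_fst).prodMk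
      ((measurable_blks n K).comp measurable_snd)
  let P : ∀ K : ℕ, Measure ((Fin (K * n) → B) × (Fin K → Fin n → A) × (Fin K → Fin n → A)) :=
    fun K => ofMass fun z => γ K z.1 z.2.1 z.2.2
  have hP : ∀ K, IsProbabilityMeasure (P K) := by
    intro K
    refine isProbabilityMeasure_ofMass (fun z => h0 _ _ _ _) ?_
    simp only [Fintype.sum_prod_type, h1]
    have := sum_mass l (hX K)
    rwa [Fintype.sum_prod_type] at this
  let F : ∀ K : ℕ, (Fin (K * n) → B) × (Fin K → Fin n → A) × (Fin K → Fin n → A) →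
    (ℤ → B) × (ℤ → A) × (ℤ → A) :=
    fun K z => (pad b₀ z.1, pad a₀ (concat z.2.1), pad a₀ (concat z.2.2))
  have hF : ∀ K, Measurable (F K) := fun K => measurable_of_countable _
  have hΓ : ∀ K, IsProbabilityMeasure ((P K).map (F K)) := fun K =>
    Measure.isProbabilityMeasure_map (hF K).aemeasurable
  have hreal : ∀ K D, MeasurableSet D → ((P K).map (F K)).real D
      = ∑ b, ∑ v, ∑ w, if F K (b, v, w) ∈ D then γ K b v w else 0 := by
    intro K D hD
    rw [map_measureReal_apply (hF K) hD]
    have := measureReal_preimage_eq_sum (P K) measurable_id (F K ⁻¹' D)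
    rw [Set.preimage_id] at this
    rw [this]
    simp only [Fintype.sum_prod_type]
    refine Finset.sum_congr rfl fun b _ => Finset.sum_congr rfl fun v _ =>
      Finset.sum_congr rfl fun w _ => ?_
    have e : mass (P K) id (b, v, w) = γ K b v w := ofMass_real_singleton (fun z => h0 _ _ _ _) _
    rw [e]; rfl
  have hlaw : ∀ (Q : Measure ((ℤ → B) × (ℤ → A))) [IsProbabilityMeasure Q],
      MeasurePreserving shift₂ Q Q → ∀ (K m j : ℕ) (hj : j + m ≤ K * n) (s),
      ∑ b, ∑ v, (if (subword j m hj b, subword j m hj (concat v)) = s then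
        mass Q (fun ω => (block (K * n) ω.1, blks n K ω.2)) (b, v) else 0)
        = (blockLaw m Q).real {s} := by
    intro Q _ hQ K m j hj s
    have hb : Measurable (Prod.map (block m) (block m) : (ℤ → B) × (ℤ → A) → _) :=
      (measurable_block _).prodMap (measurable_block _)
    rw [blockLaw, map_measureReal_apply hb (measurableSet_singleton s),
      ← (hQ.iterate j).measureReal_preimage (hb (measurableSet_singleton s)).nullMeasurableSet]
    have := measureReal_preimage_eq_sum Q (hX K)
      {z | (subword j m hj z.1, subword j m hj (concat z.2)) = s}
    rw [Fintype.sum_prod_type] at this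
    refine Eq.trans (Finset.sum_congr rfl fun b _ => Finset.sum_congr rfl fun v _ => ?_)
      (this.symm.trans ?_)
    · congr
    congr 1
    ext ω
    simp only [Set.mem_preimage, Set.mem_ofPred_eq, concat_blks, ← block_shift, shift₂_iterate,
      Set.mem_singleton_iff, Prod.map]
  have hmeas : ∀ (j m : ℕ) (s : (Fin m → B) × (Fin m → A))
      (f : (ℤ → B) × (ℤ → A) × (ℤ → A) → ℤ → A), Measurable f →
      MeasurableSet {p : (ℤ → B) × (ℤ → A) × (ℤ → A) | (block m (shift^[j] p.1),
        block m (shift^[j] (f p))) = s} := by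
    intro j m s f hf
    have hm : Measurable fun p : (ℤ → B) × (ℤ → A) × (ℤ → A) =>
        (block m (shift^[j] p.1), block m (shift^[j] (f p))) :=
      (((measurable_block m).comp (measurable_shift.iterate j)).comp measurable_fst).prodMk
        (((measurable_block m).comp (measurable_shift.iterate j)).comp hf)
    exact hm (measurableSet_singleton s)
  refine relDbar_le_of_averages hl hθ (fun K => (P K).map (F K)) (N := fun K => K * n)
    (tendsto_id.atTop_mul_const' hn) ?_ ?_ ?_
  · intro K m j hj s
    rw [hreal K _ (hmeas j m s (fun p => p.2.1) (by fun_prop)), ← hlaw l hl K m j hj s]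
    refine Finset.sum_congr rfl fun b _ => Finset.sum_congr rfl fun v _ => ?_
    simp only [F, Set.mem_ofPred_eq, block_shift_pad _ _ j m hj, ← h1]
    split_ifs <;> simp
  · intro K m j hj s
    rw [hreal K _ (hmeas j m s (fun p => p.2.2) (by fun_prop)), ← hlaw θ hθ K m j hj s]
    refine Finset.sum_congr rfl fun b _ => ?_
    rw [Finset.sum_comm]
    refine Finset.sum_congr rfl fun v _ => ?_
    simp only [F, Set.mem_ofPred_eq, block_shift_pad _ _ j m hj, ← h2]
    split_ifs <;> simp
  · intro K
    have hcost : ∀ j : Fin (K * n),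
        ((P K).map (F K)).real {p | p.2.1 (j : ℕ) ≠ p.2.2 (j : ℕ)}
        = ∑ b, ∑ v, ∑ w, γ K b v w * if concat v j ≠ concat w j then (1 : ℝ) else 0 := by
      intro j
      rw [hreal K _ (by
        have hm : Measurable fun p : (ℤ → B) × (ℤ → A) × (ℤ → A) =>
          (p.2.1 ((j : ℕ) : ℤ), p.2.2 ((j : ℕ) : ℤ)) := by fun_prop
        exact hm (MeasurableSet.of_discrete (s := {q : A × A | q.1 ≠ q.2})))]
      simp only [F, Set.mem_ofPred_eq, pad_natCast _ _ _ j.2, Fin.eta, mul_ite, mul_one, mul_zero]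
    rw [Finset.sum_range fun j => ((P K).map (F K)).real {p | p.2.1 (j : ℕ) ≠ p.2.2 (j : ℕ)}]
    simp_rw [hcost]
    have e : ∑ j : Fin (K * n), ∑ b, ∑ v, ∑ w,
        γ K b v w * (if concat v j ≠ concat w j then (1 : ℝ) else 0)
        = n * ∑ b, ∑ v, ∑ w, γ K b v w * ∑ i, hammingMetric n (v i) (w i) := by
      rw [Finset.sum_comm, Finset.mul_sum]
      refine Finset.sum_congr rfl fun b _ => ?_
      rw [Finset.sum_comm, Finset.mul_sum]
      refine Finset.sum_congr rfl fun v _ => ?_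
      rw [Finset.sum_comm, Finset.mul_sum]
      refine Finset.sum_congr rfl fun w _ => ?_
      rw [← Finset.mul_sum, sum_hammingMetric hn]
      ring
    rw [e]
    push_cast
    calc (n : ℝ) * _ ≤ n * (K * c) := mul_le_mul_of_nonneg_left (h3 K) (Nat.cast_nonneg n)
      _ = K * n * c := by ring

end Padding

/-! ### The main theorem -/

section Hamming

variable {A : Type*} [DecidableEq A] {n : ℕ}

lemma hammingMetric_nonneg (v w : Fin n → A) : 0 ≤ hammingMetric n v w := by
  unfold hammingMetric; positivity

lemma hammingMetric_le_one (v w : Fin n → A) : hammingMetric n v w ≤ 1 := by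
  refine div_le_one_of_le₀ ?_ (Nat.cast_nonneg n)
  exact_mod_cast hammingDist_le_card_fintype.trans_eq (Fintype.card_fin n)

lemma hammingMetric_self (v : Fin n → A) : hammingMetric n v v = 0 := by simp [hammingMetric]

lemma hammingMetric_comm (v w : Fin n → A) : hammingMetric n v w = hammingMetric n w v := by
  rw [hammingMetric, hammingMetric, hammingDist_comm]

lemma hammingMetric_triangle (v w x : Fin n → A) :
    hammingMetric n v x ≤ hammingMetric n v w + hammingMetric n w x := by
  rw [hammingMetric, hammingMetric, hammingMetric, ← add_div]
  refine div_le_div_of_nonneg_right ?_ (Nat.cast_nonneg n)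
  exact_mod_cast hammingDist_triangle v w x

end Hamming

open Classical in
/-- The mean information gain of a finer partition as a difference of entropies. -/
lemma sum_mul_log_eq {V Z Y : Type*} [Fintype V] [Fintype Z] [Fintype Y] {Q : Z → V → ℝ}
    (hQ : ∀ z v, 0 ≤ Q z v) (f : Z → Y) {q : Y → V → ℝ}
    (hq : ∀ y v, q y v = ∑ z, if f z = y then Q z v else 0) {ν : Y → ℝ}
    (hν : ∀ y, ∑ v, q y v = ν y) :
    ∑ z, ∑ v, Q z v * Real.log (Q z v * ν (f z) / (rowSum Q z * q (f z) v))
      = (∑ y, ∑ v, Real.negMulLog (q y v) - ∑ y, Real.negMulLog (ν y))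
        - (∑ z, ∑ v, Real.negMulLog (Q z v) - ∑ z, Real.negMulLog (rowSum Q z)) := by
  have hQq : ∀ z v, Q z v ≤ q (f z) v := by
    intro z v
    rw [hq]
    have := Finset.single_le_sum (f := fun z' => if f z' = f z then Q z' v else 0)
      (fun z' _ => by split_ifs; exacts [hQ z' v, le_rfl]) (Finset.mem_univ z)
    simpa using this
  have hq0 : ∀ y v, 0 ≤ q y v := fun y v => by
    rw [hq]; exact Finset.sum_nonneg fun z _ => by split_ifs; exacts [hQ z v, le_rfl]
  have hqν : ∀ y v, q y v ≤ ν y := fun y v => by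
    rw [← hν]; exact Finset.single_le_sum (fun v _ => hq0 y v) (Finset.mem_univ v)
  have hQr : ∀ z v, Q z v ≤ rowSum Q z := fun z v =>
    Finset.single_le_sum (fun v _ => hQ z v) (Finset.mem_univ v)
  have hterm : ∀ z v, Q z v * Real.log (Q z v * ν (f z) / (rowSum Q z * q (f z) v))
      = Q z v * Real.log (Q z v) + Q z v * Real.log (ν (f z)) - Q z v * Real.log (rowSum Q z)
        - Q z v * Real.log (q (f z) v) := by
    intro z v
    rcases (hQ z v).eq_or_lt with h0 | h0
    · rw [← h0]; simp
    have h1 := h0.trans_le (hQq z v)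
    have h2 := h1.trans_le (hqν _ _)
    have h3 := h0.trans_le (hQr z v)
    rw [Real.log_div (by positivity) (by positivity), Real.log_mul h0.ne' h2.ne',
      Real.log_mul h3.ne' h1.ne']
    ring
  have e1 : ∑ y, ∑ v, q y v * Real.log (q y v) = ∑ z, ∑ v, Q z v * Real.log (q (f z) v) := by
    rw [Finset.sum_comm, Finset.sum_comm (s := (Finset.univ : Finset Z))]
    refine Finset.sum_congr rfl fun v _ => ?_
    have : ∀ y, q y v * Real.log (q y v) = ∑ z, if f z = y then Q z v * Real.log (q (f z) v) else 0 := by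
      intro y
      nth_rewrite 1 [hq]
      rw [Finset.sum_mul]
      refine Finset.sum_congr rfl fun z _ => ?_
      split_ifs with h
      · rw [h]
      · simp
    simp_rw [this]
    rw [Finset.sum_comm]
    simp
  have e2 : ∑ y, ν y * Real.log (ν y) = ∑ z, ∑ v, Q z v * Real.log (ν (f z)) := by
    have : ∀ y, ν y * Real.log (ν y)
        = ∑ z, if f z = y then ∑ v, Q z v * Real.log (ν (f z)) else 0 := by
      intro y
      nth_rewrite 1 [← hν]
      rw [Finset.sum_mul]
      simp_rw [hq, Finset.sum_mul]
      rw [Finset.sum_comm]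
      refine Finset.sum_congr rfl fun z _ => ?_
      split_ifs with h
      · rw [h]
      · simp
    simp_rw [this]
    rw [Finset.sum_comm]
    simp
  have e3 : ∑ z, rowSum Q z * Real.log (rowSum Q z)
      = ∑ z, ∑ v, Q z v * Real.log (rowSum Q z) := by
    refine Finset.sum_congr rfl fun z _ => ?_
    rw [← Finset.sum_mul]; rfl
  simp only [Real.negMulLog_eq_neg, Finset.sum_neg_distrib, e1, e2, e3, hterm,
    Finset.sum_sub_distrib, Finset.sum_add_distrib]
  ring

/-! ### Block entropies of an extension and transport of its next block -/

section Main

variable {A B : Type*} [Fintype A] [DecidableEq A] [MeasurableSpace A] [DiscreteMeasurableSpace A]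
  [Fintype B] [MeasurableSpace B] [DiscreteMeasurableSpace B]

/-- The conditional entropy of a block given the simultaneous block of the factor. -/
def blockCondEntropy (n : ℕ) (θ : Measure ((ℤ → B) × (ℤ → A))) : ℝ :=
  entropy θ (fun ω => (block n ω.2, block n ω.1)) - entropy θ (fun ω => block n ω.1)

/-- The joint mass function of the blocks of length `n`. -/
def blockMass (n : ℕ) (θ : Measure ((ℤ → B) × (ℤ → A))) (y : Fin n → B) (v : Fin n → A) : ℝ :=
  mass θ (fun ω => (block n ω.2, block n ω.1)) (v, y)

lemma blockMass_eq_blockLaw (n : ℕ) (θ : Measure ((ℤ → B) × (ℤ → A))) (y : Fin n → B)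
    (v : Fin n → A) : blockMass n θ y v = (blockLaw n θ).real {(y, v)} := by
  have hb : Measurable (Prod.map (block n) (block n) : (ℤ → B) × (ℤ → A) → _) :=
    (measurable_block _).prodMap (measurable_block _)
  rw [blockLaw, map_measureReal_apply hb (measurableSet_singleton _)]
  refine congrArg θ.real ?_
  ext ω
  simp only [Set.mem_preimage, Set.mem_singleton_iff, Prod.mk.injEq, Prod.map]
  tauto

lemma blockCondEntropy_eq (n : ℕ) (θ : Measure ((ℤ → B) × (ℤ → A))) [IsProbabilityMeasure θ] :
    blockCondEntropy n θ = ∑ y, ∑ v, Real.negMulLog (blockMass n θ y v)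
      - ∑ y, Real.negMulLog (∑ v, blockMass n θ y v) := by
  rw [blockCondEntropy, entropy, entropy, Fintype.sum_prod_type_right]
  congr 1
  refine Finset.sum_congr rfl fun y _ => ?_
  congr 1
  exact (sum_mass_left θ ((measurable_block n).comp measurable_snd)
    ((measurable_block n).comp measurable_fst) y).symm

lemma tvNorm_blockLaw (n : ℕ) (θ l : Measure ((ℤ → B) × (ℤ → A))) :
    tvNorm (blockLaw n θ) (blockLaw n l) = ∑ y, ∑ v, |blockMass n θ y v - blockMass n l y v| := by
  simp only [tvNorm, Fintype.sum_prod_type, blockMass_eq_blockLaw]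

/-- The conditional block entropy is a continuous function of finitely many block masses, and total
variation dominates their sup distance. -/
lemma exists_blockCondEntropy_le (n : ℕ) (l : Measure ((ℤ → B) × (ℤ → A)))
    [IsProbabilityMeasure l] {s : ℝ} (hs : 0 < s) : ∃ ε > 0,
    ∀ (θ : Measure ((ℤ → B) × (ℤ → A))) [IsProbabilityMeasure θ],
      tvNorm (blockLaw n θ) (blockLaw n l) < ε →
      blockCondEntropy n θ ≤ blockCondEntropy n l + s := by
  let Φ : ((Fin n → B) → (Fin n → A) → ℝ) → ℝ := fun q =>
    ∑ y, ∑ v, Real.negMulLog (q y v) - ∑ y, Real.negMulLog (∑ v, q y v)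
  have hΦ : Continuous Φ := by
    have := Real.continuous_negMulLog
    fun_prop
  obtain ⟨ε, hε, h⟩ := Metric.continuousAt_iff.1 (hΦ.continuousAt (x := blockMass n l)) s hs
  refine ⟨ε, hε, fun θ _ hθ => ?_⟩
  rw [tvNorm_blockLaw] at hθ
  have hd : dist (blockMass n θ) (blockMass n l) < ε := by
    refine (dist_pi_lt_iff hε).2 fun y => (dist_pi_lt_iff hε).2 fun v => ?_
    rw [Real.dist_eq]
    refine lt_of_le_of_lt ?_ hθ
    refine (Finset.single_le_sum (f := fun v => |blockMass n θ y v - blockMass n l y v|)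
      (fun _ _ => abs_nonneg _) (Finset.mem_univ v)).trans ?_
    exact Finset.single_le_sum (f := fun y => ∑ v, |blockMass n θ y v - blockMass n l y v|)
      (fun _ _ => Finset.sum_nonneg fun _ _ => abs_nonneg _) (Finset.mem_univ y)
  have := h hd
  rw [Real.dist_eq, abs_lt] at this
  rw [blockCondEntropy_eq, blockCondEntropy_eq]
  change Φ _ ≤ Φ _ + s
  linarith

open Classical in
/-- The conditional distribution of the next block given the past and the factor is close on average
to the extremal conditional distribution given the simultaneous block of the factor. -/
theorem transports_nextMass {θ : Measure ((ℤ → B) × (ℤ → A))} [IsProbabilityMeasure θ]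
    (hθ : MeasurePreserving shift₂ θ θ) {n K k : ℕ} (hk : k < K)
    {η : (Fin n → B) → (Fin n → A) → ℝ} (hη : ∀ y v, 0 ≤ η y v) (hη1 : ∀ y, ∑ v, η y v = 1)
    {κ : ℝ} (hκ : 0 < κ) {ρ : (Fin n → B) → ℝ}
    (hext : ∀ y, FinExtremal (hammingMetric n) (η y) κ (ρ y)) {δ : ℝ} (hδ : 0 < δ) :
    Transports (hammingMetric n)
      (nextMass θ (fun ω => block (K * n) ω.1) (fun k ω => blk n k ω.2) k)
      (fun z w => rowSum (nextMass θ (fun ω => block (K * n) ω.1) (fun k ω => blk n k ω.2) k) z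
        * η (subword (k * n) n ((Nat.succ_mul k n).symm.trans_le (Nat.mul_le_mul_right n hk)) z.1) w)
      ((∑ y, ∑ v, |blockMass n θ y v - mass θ (fun ω => block n ω.1) y * η y v|)
        + ((blockCondEntropy n θ
          - (entropy θ (fun ω => (blk n k ω.2, block (K * n) ω.1, blks n k ω.2))
            - entropy θ (fun ω => (block (K * n) ω.1, blks n k ω.2)))) / κ
        + ∑ y, mass θ (fun ω => block n ω.1) y * (ρ y + δ))) := by
  have hkK : k * n + n ≤ K * n := (Nat.succ_mul k n).symm.trans_le (Nat.mul_le_mul_right n hk)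
  set Q := nextMass θ (fun ω => block (K * n) ω.1) (fun k ω => blk n k ω.2) k with hQ
  set f : (Fin (K * n) → B) × (Fin k → Fin n → A) → Fin n → B :=
    fun z => subword (k * n) n hkK z.1 with hf
  have hs : Measurable fun ω : (ℤ → B) × (ℤ → A) => block (K * n) ω.1 :=
    (measurable_block _).comp measurable_fst
  have hX : ∀ k, Measurable fun ω : (ℤ → B) × (ℤ → A) => blk n k ω.2 := fun k =>
    (measurable_blk n k).comp measurable_snd
  have hZ : Measurable fun ω : (ℤ → B) × (ℤ → A) => (block (K * n) ω.1, blks n k ω.2) :=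
    hs.prodMk ((measurable_blks n k).comp measurable_snd)
  have hb : Measurable fun ω : (ℤ → B) × (ℤ → A) => (block n ω.2, block n ω.1) :=
    ((measurable_block n).comp measurable_snd).prodMk ((measurable_block n).comp measurable_fst)
  -- By stationarity the `k`-th block and its simultaneous `b`-word have the law of the initial
  -- pair. Hence `Q` refines the block masses along `f`.
  have hq : ∀ y v, blockMass n θ y v = ∑ z, if f z = y then Q z v else 0 := by
    intro y v
    have h1 : blockMass n θ y v = mass θ (fun ω => (blk n k ω.2, f (block (K * n) ω.1, blks n k ω.2)))
        (v, y) := by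
      rw [blockMass, ← mass_comp_measurePreserving (hθ.iterate (k * n)) hb]
      congr 1
      ext ω : 1
      simp only [shift₂_iterate, hf, Prod.mk.injEq]
      refine ⟨?_, block_shift _ _ _ hkK⟩
      ext j
      simp only [block, shift_iterate, blk]
      push_cast
      rw [add_comm]
    rw [h1, mass_comp θ ((hX k).prodMk hZ) (fun p => (p.1, f p.2)) (v, y),
      Fintype.sum_prod_type_right]
    refine Finset.sum_congr rfl fun z _ => ?_
    rw [Finset.sum_eq_single v (by intro v' _ hv; simp [hv]) (by simp)]
    simp only [true_and, Prod.mk.injEq, hQ, nextMass]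
    rfl
  have hν : ∀ y, ∑ v, blockMass n θ y v = mass θ (fun ω => block n ω.1) y := fun y =>
    sum_mass_left θ ((measurable_block n).comp measurable_snd)
      ((measurable_block n).comp measurable_fst) y
  have hQ0 : ∀ z v, 0 ≤ Q z v := nextMass_nonneg _ _ _ _
  have key := transports_of_finExtremal hammingMetric_nonneg hammingMetric_le_one
    hammingMetric_self hammingMetric_triangle f hQ0 (fun y v => by convert hq y v) hν hη hη1 hκ hext hδ
  -- The mean divergence becomes the loss of conditional entropy when the past and the longer
  -- `b`-word are added to the simultaneous `b`-word.
  rw [sum_mul_log_eq hQ0 f (fun y v => by convert hq y v) hν] at key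
  convert key using 4
  · rw [blockCondEntropy_eq]
    simp_rw [hν]
    congr 2
    · rw [entropy, Fintype.sum_prod_type_right]
      rfl
    · rw [entropy]
      refine Finset.sum_congr rfl fun z _ => ?_
      rw [hQ, rowSum_nextMass θ hs hX]
      rfl

end Main

/-! ### From processes to mass functions of blocks -/

section Processes

variable {X A B : Type*} [MeasurableSpace X] [Fintype A] [MeasurableSpace A]
  [DiscreteMeasurableSpace A] [Fintype B] [MeasurableSpace B] [DiscreteMeasurableSpace B]

lemma IsProcess.map_mem_Ext {μ : Measure X} [IsProbabilityMeasure μ] {T : X → X}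
    (hT : MeasurePreserving T μ μ) {ξ : X → ℤ → A} {π : X → ℤ → B} (hξ : IsProcess μ T ξ)
    (hπ : IsProcess μ T π) : μ.map (fun x => (π x, ξ x)) ∈ Ext (μ.map π) A := by
  have hm : Measurable fun x => (π x, ξ x) := hπ.1.prodMk hξ.1
  refine ⟨Measure.isProbabilityMeasure_map hm.aemeasurable, ⟨measurable_shift₂, ?_⟩, ?_⟩
  · rw [Measure.map_map measurable_shift₂ hm]
    have h1 : shift₂ ∘ (fun x => (π x, ξ x)) =ᵐ[μ] (fun x => (π x, ξ x)) ∘ T := by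
      filter_upwards [hξ.2, hπ.2] with x h1 h2
      simp [shift₂, h1, h2]
    rw [Measure.map_congr h1, ← Measure.map_map hm hT.measurable, hT.map_eq]
  · rw [Measure.map_map measurable_fst hm]
    rfl

lemma mass_block_of_mem_Ext {ν : Measure (ℤ → B)} {θ : Measure ((ℤ → B) × (ℤ → A))}
    (hθ : θ ∈ Ext ν A) (N : ℕ) : mass θ (fun ω => block N ω.1) = mass ν (block N) := by
  ext y
  rw [mass, mass, ← hθ.2.2, map_measureReal_apply measurable_fst
    (measurable_block N (measurableSet_singleton y))]
  rfl

lemma mass_map {S Ω : Type*} [MeasurableSpace S] [MeasurableSingletonClass S] [MeasurableSpace Ω]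
    (μ : Measure X) {F : X → Ω} (hF : Measurable F) {G : Ω → S} (hG : Measurable G) :
    mass (μ.map F) G = mass μ (fun x => G (F x)) := by
  ext s
  rw [mass, map_measureReal_apply hF (hG (measurableSet_singleton s))]
  rfl

lemma compProd_real_singleton {Y V : Type*} [Fintype Y] [MeasurableSpace Y]
    [MeasurableSingletonClass Y] [MeasurableSpace V] [MeasurableSingletonClass V]
    (ν : Measure Y) [IsFiniteMeasure ν] (η : Kernel Y V) [IsMarkovKernel η] (y : Y) (v : V) :
    (ν.compProd η).real {(y, v)} = ν.real {y} * (η y).real {v} := by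
  classical
  rw [measureReal_def, Measure.compProd_apply (measurableSet_singleton _), lintegral_fintype,
    Finset.sum_eq_single y]
  · have : Prod.mk y ⁻¹' {(y, v)} = {v} := by ext; simp
    rw [this, ENNReal.toReal_mul, mul_comm]
    rfl
  · intro y' _ hy
    have : Prod.mk y' ⁻¹' {(y, v)} = ∅ := by ext; simp [hy]
    simp [this]
  · simp

/-- The finite content of relative extremality at a given block length. -/
lemma IsExtremalOver.exists_finExtremal [DecidableEq A] {μ : Measure X} [IsProbabilityMeasure μ]
    {ξ : X → ℤ → A} {π : X → ℤ → B} (hξ : Measurable ξ) (hπ : Measurable π) {n : ℕ} {κ r : ℝ}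
    (hκ : 0 < κ) (hr : 0 ≤ r) (h : IsExtremalOver (hammingMetric n) μ (fun x => block n (ξ x))
      (fun x => block n (π x)) κ r) :
    ∃ (η : (Fin n → B) → (Fin n → A) → ℝ) (ρ : (Fin n → B) → ℝ), (∀ y v, 0 ≤ η y v) ∧
      (∀ y, ∑ v, η y v = 1) ∧ (∀ y, FinExtremal (hammingMetric n) (η y) κ (ρ y)) ∧
      ∑ y, mass (μ.map π) (block n) y * ρ y ≤ r ∧
      ∀ y v, blockMass n (μ.map fun x => (π x, ξ x)) y v = mass (μ.map π) (block n) y * η y v := by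
  obtain ⟨η, hη, hcomp, ρ, hρm, hρ0, hρ, hint⟩ := h
  have hG : Measurable fun x => block n (π x) := (measurable_block n).comp hπ
  have hF : Measurable fun x => block n (ξ x) := (measurable_block n).comp hξ
  have hmass : ∀ y, mass (μ.map π) (block n) y = (μ.map fun x => block n (π x)).real {y} := by
    intro y
    rw [mass_map μ hπ (measurable_block n), map_measureReal_apply hG (measurableSet_singleton y)]
    rfl
  have hprob : IsProbabilityMeasure (μ.map fun x => block n (π x)) :=
    Measure.isProbabilityMeasure_map hG.aemeasurable
  refine ⟨fun y v => (η y).real {v}, ρ, fun y v => measureReal_nonneg,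
    fun y => sum_mass (η y) measurable_id, fun y =>
      (hρ y).finExtremal hammingMetric_nonneg hammingMetric_le_one hκ (hρ0 y).le, ?_, ?_⟩
  · rw [lintegral_fintype] at hint
    have e : ∀ y, ENNReal.ofReal (ρ y) * (μ.map fun x => block n (π x)) {y}
        = ENNReal.ofReal (mass (μ.map π) (block n) y * ρ y) := by
      intro y
      rw [hmass, ENNReal.ofReal_mul measureReal_nonneg, ofReal_measureReal, mul_comm]
    simp_rw [e] at hint
    rw [← ENNReal.ofReal_sum_of_nonneg fun y _ => mul_nonneg (mass_nonneg _ _ _) (hρ0 y).le] at hint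
    exact (ENNReal.ofReal_le_ofReal_iff hr).1 hint
  · intro y v
    rw [hmass, ← compProd_real_singleton, hcomp,
      map_measureReal_apply (hG.prodMk hF) (measurableSet_singleton _), blockMass,
      mass_map μ (hπ.prodMk hξ) (G := fun ω => (block n ω.2, block n ω.1))
        (((measurable_block n).comp measurable_snd).prodMk
          ((measurable_block n).comp measurable_fst))]
    refine congrArg μ.real ?_
    ext x
    simp only [Set.mem_preimage, Set.mem_singleton_iff, Prod.mk.injEq]
    tauto

end Processes

/-- If extremality holds at block length `n` and `θ` is close to `l` in block law and entropy, then
`θ` is close to `l` in the relative `d`-bar distance. -/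
theorem relDbar_le_of_extremal {A B : Type*} [Fintype A] [DecidableEq A] [MeasurableSpace A]
    [DiscreteMeasurableSpace A] [Fintype B] [MeasurableSpace B] [DiscreteMeasurableSpace B]
    {ν : Measure (ℤ → B)} {l θ : Measure ((ℤ → B) × (ℤ → A))} (hl : l ∈ Ext ν A)
    (hθ : θ ∈ Ext ν A) {n : ℕ} (hn : 0 < n) {η : (Fin n → B) → (Fin n → A) → ℝ}
    (hη : ∀ y v, 0 ≤ η y v) (hη1 : ∀ y, ∑ v, η y v = 1) {κ r : ℝ} (hκ : 0 < κ)
    {ρ : (Fin n → B) → ℝ} (hext : ∀ y, FinExtremal (hammingMetric n) (η y) κ (ρ y))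
    (hρ : ∑ y, mass ν (block n) y * ρ y ≤ r)
    (hlη : ∀ y v, blockMass n l y v = mass ν (block n) y * η y v) {ε s t δ : ℝ} (hδ : 0 < δ)
    (htv : tvNorm (blockLaw n θ) (blockLaw n l) ≤ ε)
    (hs : ∀ k N : ℕ, blockCondEntropy n l - s
      ≤ entropy l (fun ω => (blk n k ω.2, block N ω.1, blks n k ω.2))
        - entropy l (fun ω => (block N ω.1, blks n k ω.2)))
    (ht : ∀ k N : ℕ, blockCondEntropy n θ - t
      ≤ entropy θ (fun ω => (blk n k ω.2, block N ω.1, blks n k ω.2))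
        - entropy θ (fun ω => (block N ω.1, blks n k ω.2))) :
    relDbar l θ ≤ ENNReal.ofReal ((s / κ + (r + δ)) + (ε + (t / κ + (r + δ)))) := by
  have := hl.1
  have := hθ.1
  have hν1 : ∑ y, mass ν (block n) y = 1 := by
    rw [← mass_block_of_mem_Ext hl]
    exact sum_mass l ((measurable_block n).comp measurable_fst)
  have hρδ : ∑ y, mass ν (block n) y * (ρ y + δ) ≤ r + δ := by
    simp_rw [mul_add]
    rw [Finset.sum_add_distrib, ← Finset.sum_mul, hν1, one_mul]
    linarith
  -- The block length `n` is fixed while `K` is arbitrary; hence the entropy bounds `hs` and `ht`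
  -- are required for all `k` and `N`.
  refine relDbar_le_of_block_couplings hl.2.1 hθ.2.1 hn fun K => ?_
  refine exists_chain_coupling (s := fun ω => block (K * n) ω.1) (X := fun k ω => blk n k ω.2) l θ
    ((measurable_block _).comp measurable_fst)
    (fun k => (measurable_blk n k).comp measurable_snd)
    (by rw [mass_block_of_mem_Ext hl, mass_block_of_mem_Ext hθ])
    hammingMetric_nonneg hammingMetric_comm hammingMetric_triangle
    -- The value 0 is filler, as the chain only uses `k < K`; the bound on `k` makes the subword fit
    -- inside `b`.
    (fun k b v => if hk : k < K then η (subword (k * n) n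
      ((Nat.succ_mul k n).symm.trans_le (Nat.mul_le_mul_right n hk)) b) v else 0) K ?_ ?_
  · intro k hk
    simp only [dif_pos hk]
    refine (transports_nextMass hl.2.1 hk hη hη1 hκ hext hδ).mono ?_
    rw [mass_block_of_mem_Ext hl]
    -- The block law of `l` disintegrates exactly through `η`, so only `θ` pays the total variation
    -- term.
    have h0 : ∑ y, ∑ v, |blockMass n l y v - mass ν (block n) y * η y v| = 0 := by simp [hlη]
    rw [h0, zero_add]
    exact add_le_add (div_le_div_of_nonneg_right (by linarith [hs k (K * n)]) hκ.le) hρδ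
  · intro k hk
    simp only [dif_pos hk]
    refine (transports_nextMass hθ.2.1 hk hη hη1 hκ hext hδ).mono ?_
    rw [mass_block_of_mem_Ext hθ]
    refine add_le_add ?_ (add_le_add
      (div_le_div_of_nonneg_right (by linarith [ht k (K * n)]) hκ.le) hρδ)
    simp_rw [← hlη]
    rwa [← tvNorm_blockLaw]

/-- A relatively extremal process is relatively finitely determined. -/
lemma isRelFD_of_isRelExtremal {X A B : Type*} [MeasurableSpace X]
    [Fintype A] [DecidableEq A] [MeasurableSpace A] [DiscreteMeasurableSpace A]
    [Fintype B] [MeasurableSpace B] [DiscreteMeasurableSpace B]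
    (μ : Measure X) [IsProbabilityMeasure μ] (T : X ≃ᵐ X) (hT : MeasurePreserving T μ μ)
    (ξ : X → ℤ → A) (π : X → ℤ → B)
    (hξ : IsProcess μ T ξ) (hπ : IsProcess μ T π)
    (r : ℝ) (hr : 0 < r) (hext : ∃ κ : ℝ, 0 < κ ∧ IsRelExtremal μ ξ π κ r) :
    IsRelFD μ ξ π (7 * r) := by
  obtain ⟨κ, hκ, hext⟩ := hext
  have hl := hξ.map_mem_Ext hT hπ
  refine ⟨hl, ?_⟩
  set ν := μ.map π with hν
  set l := μ.map fun x => (π x, ξ x) with hl'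
  have := hl.1
  obtain ⟨L, hL, hLs⟩ := exists_le_systemEntropy hl.2.1
  -- An information loss of `n s`, divided by the extremality constant `κ n`, costs `r / 4`.
  set s := κ * r / 4 with hs
  have hs0 : 0 < s := by positivity
  obtain ⟨n, hextn, hLn, hn⟩ := (hext.and ((hLs s hs0).and (eventually_gt_atTop 0))).exists
  have hn' : (0 : ℝ) < n := by exact_mod_cast hn
  obtain ⟨η, ρ, hη, hη1, hfin, hρ, hlη⟩ :=
    hextn.exists_finExtremal hξ.1 hπ.1 (mul_pos hκ hn') hr.le
  obtain ⟨ε₀, hε₀, hcont⟩ := exists_blockCondEntropy_le n l (mul_pos hn' hs0)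
  -- `ε₀` controls the block entropy of `θ`, `s` its entropy deficit, and `r / 4` the total
  -- variation cost.
  refine ⟨min ε₀ (min s (r / 4)), by positivity, n, fun θ hθ hent htv => ?_⟩
  set ε := min ε₀ (min s (r / 4)) with hε
  have hε1 : ε ≤ s := (min_le_right _ _).trans (min_le_left _ _)
  have hε2 : ε ≤ r / 4 := (min_le_right _ _).trans (min_le_right _ _)
  have := hθ.1
  have hFl : blockCondEntropy n l ≤ n * (L + s) := hLn
  have hFθ := hcont θ (htv.trans_le (min_le_left _ _))
  have hbl : ∀ k N : ℕ, blockCondEntropy n l - n * s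
      ≤ entropy l (fun ω => (blk n k ω.2, block N ω.1, blks n k ω.2))
        - entropy l (fun ω => (block N ω.1, blks n k ω.2)) := by
    intro k N
    have h1 := EReal.coe_le_coe_iff.1 (hL.trans (systemEntropy_le hl.2.1 hn k N))
    rw [le_div_iff₀ hn'] at h1
    linarith
  -- One `s` comes from continuity of the block entropy, one from approximating the rate `L` at
  -- length `n`, and one from `ε ≤ s`.
  have hbθ : ∀ k N : ℕ, blockCondEntropy n θ - n * (3 * s)
      ≤ entropy θ (fun ω => (blk n k ω.2, block N ω.1, blks n k ω.2))
        - entropy θ (fun ω => (block N ω.1, blks n k ω.2)) := by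
    intro k N
    have h1 : ((L - ε : ℝ) : EReal) < _ :=
      (((EReal.coe_sub L ε).trans_le (EReal.sub_le_sub hL le_rfl)).trans_lt hent).trans_le
        (systemEntropy_le hθ.2.1 hn k N)
    have h2 := EReal.coe_lt_coe_iff.1 h1
    rw [lt_div_iff₀ hn'] at h2
    have h3 : (L - s) * n ≤ (L - ε) * n := by gcongr
    linarith
  refine (relDbar_le_of_extremal hl hθ hn hη hη1 (mul_pos hκ hn') hfin hρ hlη (δ := r / 4)
    (by positivity) htv.le hbl hbθ).trans_lt ?_
  -- The total is `7 r / 2 + ε ≤ 15 r / 4`, well below `7 r`.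
  rw [ENNReal.ofReal_lt_ofReal_iff (by positivity)]
  have e1 : n * s / (κ * n) = r / 4 := by rw [hs]; field_simp
  have e2 : n * (3 * s) / (κ * n) = 3 * r / 4 := by rw [hs]; field_simp
  rw [e1, e2]
  linarith

end

end RelOrnstein

theorem proposition10p1 {X A B : Type*} [MeasurableSpace X]
    [Fintype A] [DecidableEq A] [MeasurableSpace A] [DiscreteMeasurableSpace A]
    [Fintype B] [MeasurableSpace B] [DiscreteMeasurableSpace B]
    (μ : Measure X) [IsProbabilityMeasure μ] (T : X ≃ᵐ X) (hT : MeasurePreserving T μ μ)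
    (ξ : X → ℤ → A) (π : X → ℤ → B)
    (hξ : RelOrnstein.IsProcess μ T ξ) (hπ : RelOrnstein.IsProcess μ T π)
    (r : ℝ) (hr : 0 < r) (hext : ∃ κ : ℝ, 0 < κ ∧ RelOrnstein.IsRelExtremal μ ξ π κ r) :
    RelOrnstein.IsRelFD μ ξ π (7 * r) :=
  RelOrnstein.isRelFD_of_isRelExtremal μ T hT ξ π hξ hπ r hr hext
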